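/- **Setting.** Let $0\le r\le n$ be integers, $R$ a field and $q,Q\in R$ nonzero. Let $W_r=C_2\wr\mathfrak S_r$ be the group of permutations $w$ of $\{\pm1,\dots,\pm r\}$, acting on the right, with $(-i)w=-(iw)$. It is generated by $s_0=(1,-1)$ and $s_i=(i,i+1)(-i,-i-1)$ for $1\le i<r$. Let $\ell$ be the length function for these generators, and put $q_w=q^{\alpha}Q^{\beta}$ if a reduced expression of $w$ has $\alpha+\beta$ factors, exactly $\beta$ of them equal to $s_0$. The Hecke algebra $\mathcal H$ of type $B_r$ is the $R$-algebra with basis $\{T_w : w\in W_r\}$ such that $T_w=T_{v_1}\cdots T_{v_l}$ for every reduced expression $w=v_1\cdots v_l$, and such that $T_i=T_{s_i}$ satisfies $T_0^2=Q+(Q-1)T_0$ and $T_i^2=q+(q-1)T_i$ for $i\ge1$. Write $s_{i,j}=s_is_{i+1}\cdots s_{j-1}$ if $i\le j$ and $s_{i,j}=s_{i-1}s_{i-2}\cdots s_j$ if $i>j$; put $T_{i,j}=T_{s_{i,j}}$, $h_{a,r-a}=T_w$ with $w=(s_{1,r})^a$, and $$u_a^+=\prod_{i=1}^a\bigl(q^{i-1}+T_{i,1}T_0T_{1,i}\bigr),\qquad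 u_a^-=\prod_{i=1}^a\bigl(Qq^{i-1}-T_{i,1}T_0T_{1,i}\bigr).$$ Let $\Lambda$ be the set of bicompositions $\lambda=(\lambda^{(1)},\lambda^{(2)})$ of $r$ (ordered pairs of compositions, zero parts allowed) with $n$ parts in total; $\lambda$ is an $a$-bicomposition if $a=|\lambda^{(1)}|$. A $\lambda$-bitableau is a filling of the pair of diagrams of $\lambda^{(1)},\lambda^{(2)}$ by $r$ numbers, using exactly one of $i,-i$ for each $1\le i\le r$; $W_r$ acts on the entries. It is row standard if its entries increase along all rows and those in the first component are positive. For an $a$-bicomposition $\lambda$ let $\mathfrak t^\lambda$ have $1,\dots,a$ in order by rows in the first component and $a+1,\dots,r$ in order by rows in the second; let $\hat{\mathfrak t}^\lambda$ (resp. $\hat{\mathfrak t}_\lambda$) have $1,\dots,r-a$ in order by rows (resp. columns) in the second component and $r-a+1,\dots,r$ in order by rows (resp. columns) in the first. Let $\hat\pi_\lambda\in W_r$ be the element with $\hat{\mathfrak t}^\lambda\hat\pi_\lambda=\hat{\mathfrak t}_\lambda$, and put $$x_\lambda=\sum_{w}T_w,\qquad \hat y_\lambda=\sum_{w}(-q)^{-\ell(w)}T_w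 ,$$ the sums being over the $w\in W_r$ which stabilize the rows of $\mathfrak t^\lambda$, respectively the columns of $\hat{\mathfrak t}_\lambda$. Let $M^\lambda=u_a^+x_\lambda\mathcal H$, $\mathcal E=\bigoplus_{\lambda\in\Lambda}M^\lambda$ (tensor space), and let $\mathcal S=\operatorname{End}_{\mathcal H}(\mathcal E)$ be the $(Q,q)$-Schur algebra, acting on $\mathcal E$ on the left. Let $\omega=((-),(1^r))\in\Lambda$ (padded with zero parts), so that $M^\omega=\mathcal H$. For an $a$-bicomposition $\lambda\in\Lambda$ put $$c_\lambda=u_{r-a}^-\hat y_\lambda\in\mathcal H=M^\omega,\qquad z_\lambda=u_a^+x_\lambda h_{a,r-a}T_{\hat\pi_\lambda}u_{r-a}^-\hat y_\lambda\in M^\lambda,\qquad L^\lambda=\mathcal S c_\lambda,\qquad W^\lambda=\mathcal S z_\lambda .$$ $\mathcal E$ has as a basis the bitabloids $u_a^+x_\lambda T_w$ ($\lambda\in\Lambda$, $\mathfrak t^\lambda w$ row standard). Let $\langle\ ,\ \rangle$ be the bilinear form on $\mathcal E$ for which distinct bitabloids are orthogonal and $\langle u_a^+x_\lambda T_w,u_a^+x_\lambda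 T_w\rangle=q_w$. Let $*$ be the anti-automorphism of the $R$-algebra $\mathcal S$ with $\langle sx,y\rangle=\langle x,s^*y\rangle$ for all $s\in\mathcal S$, $x,y\in\mathcal E$. The contracted form on $L^\lambda$ is the bilinear form with $$\ll s_1c_\lambda,\,s_2c_\lambda\gg\;=\;\langle s_1\,1_{\mathcal H},\,s_2c_\lambda\rangle\qquad(s_1,s_2\in\mathcal S),$$ where $1_{\mathcal H}\in M^\omega$. Let $W^{\lambda\perp}=\{y\in L^\lambda : \ll x,y\gg=0\text{ for all }x\in W^\lambda\}$. **Statement.** Let $\lambda\in\Lambda$. The forms $\langle\ ,\ \rangle$ and $\ll\ ,\ \gg$ and the anti-automorphism $*$ just described exist and are unique, $W^\lambda\subseteq L^\lambda$, and $\ll z_\lambda,z_\lambda\gg\ne0$. Moreover: 1. $W^\lambda\cap W^{\lambda\perp}$ is an $\mathcal S$-submodule of $W^\lambda$, and it is the unique maximal submodule of $W^\lambda$. 2. The quotient $F^\lambda=W^\lambda/(W^\lambda\cap W^{\lambda\perp})$ is an absolutely irreducible $\mathcal S$-module: for every extension field $R'$ of $R$, the $R'\otimes_R\mathcal S$-module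 $R'\otimes_RF^\lambda$ is irreducible. 3. $F^\lambda$ is self-dual: it is isomorphic, as a left $\mathcal S$-module, to $\operatorname{Hom}_R(F^\lambda,R)$ with the action $(sf)(x)=f(s^*x)$. -/

import Mathlib

open scoped TensorProduct

noncomputable section

namespace QqSchur

universe u v

/-! ### The Weyl group of type B and its length function -/

/-- The group `W_r = C_2 ≀ S_r`, realised as the group of signed permutations of
`{±1, …, ±r}` (each extended to `ℤ` by fixing `0` and all `i` with `|i| > r`). -/
def W (r : ℕ) : Subgroup (Equiv.Perm ℤ) where
  carrier := {w | (∀ i, w (-i) = -w i) ∧ ∀ i : ℤ, (r : ℤ) < |i| → w i = i}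
  one_mem' := ⟨fun _ => rfl, fun _ _ => rfl⟩
  mul_mem' := by
    rintro a b ⟨ha, ha'⟩ ⟨hb, hb'⟩
    refine ⟨fun i => by simp [Equiv.Perm.mul_apply, ha, hb], fun i hi => ?_⟩
    rw [Equiv.Perm.mul_apply, hb' i hi, ha' i hi]
  inv_mem' := by
    rintro a ⟨ha, ha'⟩
    refine ⟨fun i => ?_, fun i hi => ?_⟩
    · rw [Equiv.Perm.inv_eq_iff_eq, ha]; simp
    · rw [Equiv.Perm.inv_eq_iff_eq, ha' i hi]

instance W.finite (r : ℕ) : Finite (W r) := by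
  have hmem : ∀ (w : W r) (i : ℤ), |i| ≤ r → |w.1 i| ≤ r := by
    intro w i hi
    by_contra hlt
    push Not at hlt
    have h1 := w.2.2 _ hlt
    have h2 : w.1 i = i := w.1.injective h1
    rw [h2] at hlt
    omega
  let f : W r → (Set.Icc (-(r : ℤ)) r → Set.Icc (-(r : ℤ)) r) := fun w i =>
    ⟨w.1 i.1, abs_le.mp (hmem w i.1 (abs_le.mpr i.2))⟩
  refine Finite.of_injective f fun w w' h => ?_
  apply Subtype.ext
  apply Equiv.ext
  intro i
  by_cases hi : |i| ≤ (r : ℤ)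
  · exact congrArg Subtype.val (congrFun h ⟨i, abs_le.mp hi⟩)
  · push Not at hi
    rw [w.2.2 i hi, w'.2.2 i hi]

instance W.fintype (r : ℕ) : Fintype (W r) := Fintype.ofFinite _

/-- The right action `i ↦ i w` of `W_r` on integers; it satisfies `i (w v) = (i w) v`. -/
def act {r : ℕ} (i : ℤ) (w : W r) : ℤ := (w⁻¹ : W r).1 i

/-- The generators `s_0 = (1, -1)` and `s_i = (i, i+1)(-i, -i-1)` for `1 ≤ i ≤ r - 1`. -/
def s {r : ℕ} (i : Fin r) : W r :=
  if h : (i : ℕ) = 0 then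
    ⟨Equiv.swap 1 (-1), by
      have := i.2
      refine ⟨fun k => ?_, fun k hk => ?_⟩
      · simp only [Equiv.swap_apply_def]; split_ifs <;> omega
      · have hk1 : k ≠ 1 := by rintro rfl; simp at hk; omega
        have hk2 : k ≠ -1 := by rintro rfl; simp at hk; omega
        exact Equiv.swap_apply_of_ne_of_ne hk1 hk2⟩
  else
    ⟨Equiv.swap (i : ℤ) (i + 1) * Equiv.swap (-(i : ℤ)) (-i - 1), by
      have := i.2
      refine ⟨fun k => ?_, fun k hk => ?_⟩
      · simp only [Equiv.Perm.mul_apply, Equiv.swap_apply_def]; split_ifs <;> omega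
      · have hk' : (r : ℤ) < k ∨ (r : ℤ) < -k := lt_abs.mp hk
        simp only [Equiv.Perm.mul_apply, Equiv.swap_apply_def]; split_ifs <;> omega⟩

/-- `s_i` for a natural number index (the identity if `i ≥ r`, which never matters). -/
def sNat (r i : ℕ) : W r := if h : i < r then s ⟨i, h⟩ else 1

/-- The element of `W_r` expressed by a word in the generators. -/
def wordProd {r : ℕ} (l : List (Fin r)) : W r := (l.map s).prod

/-- The length: the least number of factors in an expression as a product of generators. -/
def len {r : ℕ} (w : W r) : ℕ := sInf {k | ∃ l : List (Fin r), wordProd l = w ∧ l.length = k}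

/-- Reduced expressions. -/
def IsReduced {r : ℕ} (l : List (Fin r)) : Prop := l.length = len (wordProd l)

/-- The number of factors `s_0` in a reduced expression of `w`
(it is the same for all reduced expressions). -/
def numZero {r : ℕ} (w : W r) : ℕ :=
  sInf {k | ∃ l : List (Fin r), IsReduced l ∧ wordProd l = w ∧
    l.countP (fun i => (i : ℕ) = 0) = k}

/-- `s_{i,j} = s_i s_{i+1} ⋯ s_{j-1}` if `i ≤ j`, and `s_{i-1} s_{i-2} ⋯ s_j` if `i > j`. -/
def sij (r i j : ℕ) : W r :=
  if i ≤ j then ((List.range' i (j - i)).map (sNat r)).prod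
  else ((List.range' j (i - j)).reverse.map (sNat r)).prod

/-- `w_{a, r-a} = (s_{1,r})^a`. -/
def wa (r a : ℕ) : W r := sij r 1 r ^ a

/-! ### The Hecke algebra of type B -/

section HeckeAlgebra

variable {R : Type u} [CommRing R]

/-- `q_w = q^a Q^b`, where a reduced expression of `w` has `a + b` factors,
exactly `b` of which are `s_0`. -/
def qlen (q Q : Rˣ) {r : ℕ} (w : W r) : R :=
  (q : R) ^ (len w - numZero w) * (Q : R) ^ numZero w

/-- The parameter of the generator `s_i`: `Q` for `s_0`, and `q` for the others. -/
def param (q Q : Rˣ) {r : ℕ} (i : Fin r) : R := if (i : ℕ) = 0 then (Q : R) else (q : R)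

/-- The relations of the Hecke algebra between the symbols `T_w`:
`T_w = T_{v_1} ⋯ T_{v_l}` for each reduced expression `w = v_1 ⋯ v_l` (the empty one gives
`T_e = 1`), and `T_i ^ 2 = q_i + (q_i - 1) T_i`, with `q_0 = Q` and `q_i = q` for `i ≥ 1`. -/
inductive HeckeRel (q Q : Rˣ) (r : ℕ) : FreeAlgebra R (W r) → FreeAlgebra R (W r) → Prop
  | reduced (l : List (Fin r)) (hl : IsReduced l) :
      HeckeRel q Q r (FreeAlgebra.ι R (wordProd l))
        ((l.map fun i => FreeAlgebra.ι R (s i)).prod)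
  | quadratic (i : Fin r) :
      HeckeRel q Q r (FreeAlgebra.ι R (s i) * FreeAlgebra.ι R (s i))
        (algebraMap R _ (param q Q i) + algebraMap R _ (param q Q i - 1) * FreeAlgebra.ι R (s i))

/-- The Hecke algebra of type `B_r` over `R` with parameters `q, Q`: the `R`-algebra generated by
the `T_w` (`w ∈ W_r`) subject to the defining relations; the `T_w` form an `R`-basis of it. -/
def Hecke (q Q : Rˣ) (r : ℕ) : Type u := RingQuot (HeckeRel q Q r)

instance (q Q : Rˣ) (r : ℕ) : Ring (Hecke q Q r) :=
  inferInstanceAs (Ring (RingQuot (HeckeRel q Q r)))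

instance (q Q : Rˣ) (r : ℕ) : Algebra R (Hecke q Q r) :=
  inferInstanceAs (Algebra R (RingQuot (HeckeRel q Q r)))

/-- The element `T_w` of the Hecke algebra. -/
def T (q Q : Rˣ) {r : ℕ} (w : W r) : Hecke q Q r :=
  RingQuot.mkAlgHom R (HeckeRel q Q r) (FreeAlgebra.ι R w)

/-- `T_{i,1} T_0 T_{1,i}`. -/
def jm (q Q : Rˣ) (r i : ℕ) : Hecke q Q r :=
  T q Q (sij r i 1) * T q Q (sNat r 0) * T q Q (sij r 1 i)

/-- `u_a^+ = ∏_{i=1}^a (q^{i-1} + T_{i,1} T_0 T_{1,i})`. -/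
def uPlus (q Q : Rˣ) (r a : ℕ) : Hecke q Q r :=
  ((List.range' 1 a).map fun i => algebraMap R _ ((q : R) ^ (i - 1)) + jm q Q r i).prod

/-- `u_a^- = ∏_{i=1}^a (Q q^{i-1} - T_{i,1} T_0 T_{1,i})`. -/
def uMinus (q Q : Rˣ) (r a : ℕ) : Hecke q Q r :=
  ((List.range' 1 a).map fun i => algebraMap R _ ((Q : R) * (q : R) ^ (i - 1)) - jm q Q r i).prod

end HeckeAlgebra

/-! ### Bicompositions and bitableaux -/

/-- The bicompositions `(λ⁽¹⁾, λ⁽²⁾)` of `r` with `n` parts altogether (parts may be zero). -/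
@[ext] structure Bicomp (n r : ℕ) where
  fst : List ℕ
  snd : List ℕ
  length_add : fst.length + snd.length = n
  sum_add : fst.sum + snd.sum = r

namespace Bicomp

variable {n r : ℕ}

instance finite : Finite (Bicomp n r) := by
  have hle : ∀ (lam : Bicomp n r) (x : ℕ), x ∈ lam.fst ++ lam.snd → x < r + 1 := by
    intro lam x hx
    have h1 := List.le_sum_of_mem hx
    rw [List.sum_append, lam.sum_add] at h1
    omega
  let f : Bicomp n r → Fin (n + 1) × (Fin n → Fin (r + 1)) := fun lam =>
    (⟨lam.fst.length, by have := lam.length_add; omega⟩, fun i =>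
      ⟨(lam.fst ++ lam.snd)[(i : ℕ)]'(by
        rw [List.length_append, lam.length_add]; exact i.2), hle lam _ (List.getElem_mem _)⟩)
  refine Finite.of_injective f fun lam mu h => ?_
  have h1 : lam.fst.length = mu.fst.length := congrArg (fun p => (p.1 : ℕ)) h
  have h2 : lam.fst ++ lam.snd = mu.fst ++ mu.snd := by
    apply List.ext_getElem
    · rw [List.length_append, List.length_append, lam.length_add, mu.length_add]
    · intro i hi hi'
      rw [List.length_append, lam.length_add] at hi
      exact congrArg (fun p => ((p.2 ⟨i, hi⟩ : Fin (r + 1)) : ℕ)) h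
  obtain ⟨h3, h4⟩ := List.append_inj h2 h1
  exact Bicomp.ext h3 h4

/-- The number `a` such that `λ` is an `a`-bicomposition. -/
def a (lam : Bicomp n r) : ℕ := lam.fst.sum

/-- The component `λ⁽¹⁾` (index `0`) or `λ⁽²⁾` (index `1`). -/
def comp (lam : Bicomp n r) (c : Fin 2) : List ℕ := if c = 0 then lam.fst else lam.snd

/-- The diagram of `λ`: triples (component, row, column), rows and columns counted from `0`. -/
def Diagram (lam : Bicomp n r) : Type :=
  {x : Fin 2 × ℕ × ℕ // x.2.2 < (lam.comp x.1).getD x.2.1 0}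

/-- Fillings of the diagram of `λ` by integers. -/
abbrev Filling (lam : Bicomp n r) : Type := lam.Diagram → ℤ

/-- The filling `t w`, in which each entry `i` of `t` is replaced by `i w`. -/
def Filling.act {lam : Bicomp n r} (t : lam.Filling) (w : W r) : lam.Filling :=
  fun x => QqSchur.act (t x) w

/-- The entries of row `i` of component `c`. -/
def Filling.row {lam : Bicomp n r} (t : lam.Filling) (c : Fin 2) (i : ℕ) : Set ℤ :=
  {k | ∃ x : lam.Diagram, x.1.1 = c ∧ x.1.2.1 = i ∧ t x = k}

/-- The entries of column `j` of component `c`. -/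
def Filling.col {lam : Bicomp n r} (t : lam.Filling) (c : Fin 2) (j : ℕ) : Set ℤ :=
  {k | ∃ x : lam.Diagram, x.1.1 = c ∧ x.1.2.2 = j ∧ t x = k}

/-- `t` is row standard: its entries increase along the rows of both components, and all
entries of the first component are positive. -/
def Filling.RowStandard {lam : Bicomp n r} (t : lam.Filling) : Prop :=
  (∀ x y : lam.Diagram, x.1.1 = y.1.1 → x.1.2.1 = y.1.2.1 → x.1.2.2 < y.1.2.2 → t x < t y) ∧
  ∀ x : lam.Diagram, x.1.1 = 0 → 0 < t x

/-- `w` maps each row of `t` onto itself. -/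
def Filling.StabRows {lam : Bicomp n r} (t : lam.Filling) (w : W r) : Prop :=
  ∀ (c : Fin 2) (i : ℕ), (fun k => QqSchur.act k w) '' t.row c i = t.row c i

/-- `w` maps each column of `t` onto itself. -/
def Filling.StabCols {lam : Bicomp n r} (t : lam.Filling) (w : W r) : Prop :=
  ∀ (c : Fin 2) (j : ℕ), (fun k => QqSchur.act k w) '' t.col c j = t.col c j

/-- The entry of the node in row `i` and column `j` when the numbers `1, 2, …` are entered in
order by rows in the diagram of the composition `l`. -/
def rowEntry (l : List ℕ) (i j : ℕ) : ℕ := (l.take i).sum + j + 1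

/-- The entry of the node in row `i` and column `j` when the numbers `1, 2, …` are entered in
order by columns in the diagram of the composition `l`: the nodes before it are those of the
columns `k < j`, and those of column `j` in the rows above row `i`. -/
def colEntry (l : List ℕ) (i j : ℕ) : ℕ :=
  (∑ k ∈ Finset.range j, l.countP (fun p => k < p)) + (l.take i).countP (fun p => j < p) + 1

/-- `t^λ`: the numbers `1, …, a` in order by rows in the first component and `a+1, …, r` in
order by rows in the second. -/
def tUp (lam : Bicomp n r) : lam.Filling := fun x =>
  if x.1.1 = 0 then (rowEntry lam.fst x.1.2.1 x.1.2.2 : ℤ)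
  else (lam.a + rowEntry lam.snd x.1.2.1 x.1.2.2 : ℤ)

/-- `t̂^λ`: the numbers `1, …, r-a` in order by rows in the second component and
`r-a+1, …, r` in order by rows in the first. -/
def tHatUp (lam : Bicomp n r) : lam.Filling := fun x =>
  if x.1.1 = 0 then (lam.snd.sum + rowEntry lam.fst x.1.2.1 x.1.2.2 : ℤ)
  else (rowEntry lam.snd x.1.2.1 x.1.2.2 : ℤ)

/-- `t̂_λ`: the numbers `1, …, r-a` in order by columns in the second component and
`r-a+1, …, r` in order by columns in the first. -/
def tHatDown (lam : Bicomp n r) : lam.Filling := fun x =>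
  if x.1.1 = 0 then (lam.snd.sum + colEntry lam.fst x.1.2.1 x.1.2.2 : ℤ)
  else (colEntry lam.snd x.1.2.1 x.1.2.2 : ℤ)

/-- `π̂_λ`: the (unique) element of `W_r` with `t̂^λ π̂_λ = t̂_λ`. -/
def piHat (lam : Bicomp n r) : W r :=
  Classical.epsilon fun w : W r => lam.tHatUp.act w = lam.tHatDown

/-- `ω = ((-), (1^r))`, padded by zero parts to have `n` parts altogether. -/
def omega {n r : ℕ} (h : r ≤ n) : Bicomp n r where
  fst := []
  snd := List.replicate r 1 ++ List.replicate (n - r) 0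
  length_add := by simp; omega
  sum_add := by simp

end Bicomp

/-! ### The modules `M^λ`, tensor space and the Schur algebra -/

section Modules

variable {R : Type u} [CommRing R] (q Q : Rˣ) {n r : ℕ}

open Classical in
/-- `x_λ = ∑ T_w`, over all `w` stabilizing the rows of `t^λ`. -/
def xElt (lam : Bicomp n r) : Hecke q Q r :=
  ∑ w : W r with lam.tUp.StabRows w, T q Q w

open Classical in
/-- `ŷ_λ = ∑ (-q)^{-len w} T_w`, over all `w` stabilizing the columns of `t̂_λ`. -/
def yHatElt (lam : Bicomp n r) : Hecke q Q r :=
  ∑ w : W r with lam.tHatDown.StabCols w, ((((-q)⁻¹ ^ len w : Rˣ) : R) • T q Q w)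

/-- The generator `u_a^+ x_λ` of `M^λ`. -/
def mElt (lam : Bicomp n r) : Hecke q Q r := uPlus q Q r lam.a * xElt q Q lam

/-- The right ideal `M^λ = u_a^+ x_λ H`; right `H`-modules are modules over `Hᵐᵒᵖ`. -/
abbrev M (lam : Bicomp n r) : Submodule (Hecke q Q r)ᵐᵒᵖ (Hecke q Q r) :=
  Submodule.span (Hecke q Q r)ᵐᵒᵖ {mElt q Q lam}

/-- `(Q,q)`-tensor space `⨁_λ M^λ`, over the finitely many bicompositions of `r` with `n` parts
(the direct sum of a finite family is realised as the type of all tuples). -/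
def TensorSpace (n r : ℕ) : Type u := ∀ lam : Bicomp n r, M q Q lam

instance : AddCommGroup (TensorSpace q Q n r) :=
  inferInstanceAs (AddCommGroup (∀ lam : Bicomp n r, M q Q lam))

instance : Module R (TensorSpace q Q n r) :=
  inferInstanceAs (Module R (∀ lam : Bicomp n r, M q Q lam))

instance : Module (Hecke q Q r)ᵐᵒᵖ (TensorSpace q Q n r) :=
  inferInstanceAs (Module (Hecke q Q r)ᵐᵒᵖ (∀ lam : Bicomp n r, M q Q lam))

instance : SMulCommClass (Hecke q Q r)ᵐᵒᵖ R (TensorSpace q Q n r) :=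
  inferInstanceAs (SMulCommClass (Hecke q Q r)ᵐᵒᵖ R (∀ lam : Bicomp n r, M q Q lam))

instance : IsScalarTower R (Hecke q Q r)ᵐᵒᵖ (TensorSpace q Q n r) :=
  inferInstanceAs (IsScalarTower R (Hecke q Q r)ᵐᵒᵖ (∀ lam : Bicomp n r, M q Q lam))

/-- The `(Q,q)`-Schur algebra: the `H`-linear endomorphisms of tensor space, acting on the left. -/
abbrev Schur (n r : ℕ) : Type u := Module.End (Hecke q Q r)ᵐᵒᵖ (TensorSpace q Q n r)

open Classical in
/-- The element `u_a^+ x_λ h` of the summand `M^λ` of tensor space. -/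
def inM (lam : Bicomp n r) (h : Hecke q Q r) : TensorSpace q Q n r :=
  Pi.single (M := fun mu : Bicomp n r => M q Q mu) lam
    ⟨mElt q Q lam * h, Submodule.smul_mem _ (MulOpposite.op h) (Submodule.mem_span_singleton_self _)⟩

/-- `u_{r-a}^- ŷ_λ`. -/
def cElt (lam : Bicomp n r) : Hecke q Q r := uMinus q Q r (r - lam.a) * yHatElt q Q lam

/-- `z_λ = u_a^+ x_λ h_{a,r-a} T_{π̂_λ} u_{r-a}^- ŷ_λ`, in the summand `M^λ` of tensor space. -/
def zElt (lam : Bicomp n r) : TensorSpace q Q n r :=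
  inM q Q lam (T q Q (wa r lam.a) * T q Q lam.piHat * cElt q Q lam)

/-- The Weyl module `W^λ = S z_λ`. -/
abbrev Weyl (lam : Bicomp n r) : Submodule (Schur q Q n r) (TensorSpace q Q n r) :=
  Submodule.span (Schur q Q n r) {zElt q Q lam}

/-- `u_{r-a}^- ŷ_λ` as an element of the summand `M^ω = H` of tensor space
(note that `u_0^+ x_ω = 1`). -/
def cVec (h : r ≤ n) (lam : Bicomp n r) : TensorSpace q Q n r :=
  inM q Q (Bicomp.omega h) (cElt q Q lam)

/-- `L^λ = S u_{r-a}^- ŷ_λ`. -/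
abbrev LMod (h : r ≤ n) (lam : Bicomp n r) : Submodule (Schur q Q n r) (TensorSpace q Q n r) :=
  Submodule.span (Schur q Q n r) {cVec q Q h lam}

/-! ### The bilinear forms -/

open Classical in
/-- `B` is the bilinear form on tensor space that is given on the bitabloids
`{t^λ w} = u_a^+ x_λ T_w` (`t^λ w` row standard), which form a basis, as follows: distinct
bitabloids are orthogonal, and the value of `{t^λ w}` with itself is `q_w`. -/
def IsTensorForm (B : LinearMap.BilinForm R (TensorSpace q Q n r)) : Prop :=
  ∀ (lam mu : Bicomp n r) (w v : W r),
    (lam.tUp.act w).RowStandard → (mu.tUp.act v).RowStandard →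
    B (inM q Q lam (T q Q w)) (inM q Q mu (T q Q v)) =
      if lam = mu ∧ w = v then qlen q Q w else 0

variable {q Q}

/-- `star` is the anti-automorphism of the Schur algebra that takes adjoints with respect
to `B`. -/
def IsAdjointStar (B : LinearMap.BilinForm R (TensorSpace q Q n r))
    (star : Schur q Q n r ≃ₐ[R] (Schur q Q n r)ᵐᵒᵖ) : Prop :=
  ∀ (φ : Schur q Q n r) (x y : TensorSpace q Q n r),
    B (φ • x) y = B x ((star φ).unop • y)

/-- `C` is the contracted form on `L^λ = S c`, `c = u_{r-a}^- ŷ_λ ∈ H = M^ω`: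
`C (φ c) (ψ c) = B (φ 1_H) (ψ c)` for all `φ, ψ` in the Schur algebra. -/
def IsContractedForm (h : r ≤ n) (lam : Bicomp n r)
    (B : LinearMap.BilinForm R (TensorSpace q Q n r))
    (C : LinearMap.BilinForm R (LMod q Q h lam)) : Prop :=
  ∀ (φ ψ : Schur q Q n r) (x y : LMod q Q h lam),
    (x : TensorSpace q Q n r) = φ • cVec q Q h lam →
    (y : TensorSpace q Q n r) = ψ • cVec q Q h lam →
    C x y = B (φ • inM q Q (Bicomp.omega h) 1) (ψ • cVec q Q h lam)

/-- `W^{λ⊥}`: the elements of `L^λ` that are orthogonal to `W^λ` for the form `C`. -/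
def weylPerp (h : r ≤ n) (lam : Bicomp n r) (C : LinearMap.BilinForm R (LMod q Q h lam)) :
    Set (TensorSpace q Q n r) :=
  {y | ∃ y' : LMod q Q h lam, (y' : TensorSpace q Q n r) = y ∧
    ∀ x : LMod q Q h lam, (x : TensorSpace q Q n r) ∈ Weyl q Q lam → C x y' = 0}

end Modules

/-! ### Absolutely irreducible modules and self-dual modules -/

section Irreducible

variable (K : Type u) [Field K] (S : Type v) [Ring S] [Algebra K S]
  (F : Type*) [AddCommGroup F] [Module K F] [Module S F] [IsScalarTower K S F]

/-- `F` is absolutely irreducible: for each extension field `K'` of `K`, the module `K' ⊗ F` is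
nonzero, and its only `K'`-subspaces that are stable under `S` (that is, its only
`K' ⊗ S`-submodules) are `0` and `K' ⊗ F`. -/
def IsAbsolutelyIrreducible : Prop :=
  ∀ (K' : Type u) [Field K'] [Algebra K K'], Nontrivial (K' ⊗[K] F) ∧
    ∀ U : Submodule K' (K' ⊗[K] F),
      (∀ (φ : S), ∀ x ∈ U, (Algebra.lsmul K K F φ).baseChange K' x ∈ U) → U = ⊥ ∨ U = ⊤

variable {K S}

/-- `F` is self-dual: it is isomorphic as an `S`-module to its dual `Hom_K(F, K)`, on which `S`
acts by `(φ f)(x) = f (φ* x)`, where `φ ↦ φ*` is the anti-automorphism `star` of `S`. -/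
def IsSelfDual (star : S ≃ₐ[K] Sᵐᵒᵖ) : Prop :=
  ∃ Φ : F ≃ₗ[K] Module.Dual K F,
    ∀ (φ : S) (x y : F), Φ (φ • x) y = Φ x ((star φ).unop • y)

end Irreducible

end QqSchur

end

/-!
The Weyl module `W^λ = S z_λ` is a cyclic module with a contravariant form, and everything asserted
about it follows from three facts: `≪z_λ, z_λ≫ ≠ 0`; the projection `e` of tensor space to its
summand `M^λ` is a self-adjoint element of the Schur algebra with `e z_λ = z_λ`; and `e` maps all of
`L^λ` to the line spanned by `z_λ`.
Indeed a submodule on which `e` does not vanish contains `z_λ`, and one on which it vanishes is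
orthogonal to `z_λ`, hence to `S z_λ`, so that the radical of the form is the unique maximal
submodule. On the quotient the form is nondegenerate, which makes the quotient self-dual, and
nondegeneracy survives extension of scalars, which makes it absolutely irreducible. This formal part
is `ContravariantForm.isCoatom_iff`, `ContravariantForm.isAbsolutelyIrreducible` and
`ContravariantForm.isSelfDual`.

The forms exist because bitabloids are a basis. The algebra `H` is shown to have the basis `T_w` by
means of its left regular representation (`regRep`), which commutes with right multiplications.
The bitabloids span `M^λ` since a generator `T_i` acts on them as in the regular representation or
has them as eigenvectors (`RowStd.mul_Ts_of_not`), and they are independent since the row standard `T_e` occur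
in them with coefficient the constant term of `u_a^+`, or not at all (`coeffs_rowElt_mul_T`).
The generators `T_i` are then self-adjoint (`rowForm_mul_Ts`), so adjoints of elements of the Schur
algebra are again `H`-linear (`exists_adjoint`). As `M^ω = H`, one has `L^λ = {x c_λ}` with `x` in
tensor space, and the contracted form `≪x c_λ, y c_λ≫ = ⟨x, y c_λ⟩ = ⟨x c_λ, y⟩` is well defined
because `c_λ` is fixed by the anti-involution `T_w ↦ T_{w⁻¹}` (`exists_contractedForm`).

What remains is combinatorial: `M^λ c_λ` is the line spanned by `z_λ`
(`ColumnStd.exists_rowElt_mul_eq`), and `≪z_λ, z_λ≫` is a unit (`ColumnStd.rowForm_self`). For the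
first, `u_{r-a}^-` kills the bitabloids with one of `1, …, r-a` in the first component and makes
signs in the second irrelevant, while `ŷ_λ` kills those with two entries of a column in one row;
a bitabloid not killed comes from `t̂_λ` by a column permutation (`Bicomp.columnStd_dHat`). For the
second, up to bitabloids with a negative entry `u_{r-a}^-` acts by its constant term
(`RegularOn.mul_uProd_sub_mem`), and the terms of `ŷ_λ` move `t̂_λ` to different row standard
tableaux.

Elements `w` of `W_r` are used as permutations acting on the left, and `d k` is the position
in `t^λ` of the entry `k` of `t^λ d`.
-/

noncomputable section

namespace QqSchur

/-! ### Signed permutations, inversions and length -/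

section SignedPermutations

variable {r : ℕ}

lemma W.map_neg (w : W r) (k : ℤ) : w.1 (-k) = -w.1 k := w.2.1 k

lemma W.map_zero (w : W r) : w.1 0 = 0 := by
  have := w.2.1 0
  rw [neg_zero] at this
  omega

lemma W.mul_apply (w v : W r) (k : ℤ) : (w * v).1 k = w.1 (v.1 k) := rfl

lemma W.one_apply (k : ℤ) : (1 : W r).1 k = k := rfl

@[simp] lemma W.inv_apply_self (w : W r) (k : ℤ) : (w⁻¹).1 (w.1 k) = k :=
  w.1.symm_apply_apply k

@[simp] lemma W.apply_inv_self (w : W r) (k : ℤ) : w.1 ((w⁻¹).1 k) = k :=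
  w.1.apply_symm_apply k

lemma W.map_eq_zero (w : W r) {k : ℤ} : w.1 k = 0 ↔ k = 0 := by
  constructor
  · intro h
    rw [← W.map_zero w] at h
    exact w.1.injective h
  · rintro rfl
    exact W.map_zero w

lemma W.abs_map_le (w : W r) {k : ℤ} (hk : |k| ≤ r) : |w.1 k| ≤ r := by
  by_contra hlt
  push Not at hlt
  have h1 := w.2.2 _ hlt
  rw [w.1.injective h1] at hlt
  omega

lemma W.ext_pos {w v : W r} (h : ∀ k : ℤ, 1 ≤ k → k ≤ r → w.1 k = v.1 k) : w = v := by
  apply Subtype.ext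
  apply Equiv.ext
  intro k
  rcases lt_trichotomy k 0 with hk | rfl | hk
  · by_cases hk' : -k ≤ r
    · have := h (-k) (by omega) hk'
      rw [W.map_neg, W.map_neg] at this
      omega
    · have : (r : ℤ) < |k| := by rw [lt_abs]; omega
      rw [w.2.2 _ this, v.2.2 _ this]
  · rw [W.map_zero, W.map_zero]
  · by_cases hk' : k ≤ r
    · exact h k (by omega) hk'
    · have : (r : ℤ) < |k| := by rw [lt_abs]; omega
      rw [w.2.2 _ this, v.2.2 _ this]

/-- The smaller of the two adjacent nonzero integers interchanged by `s_i`. -/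
def lo (i : Fin r) : ℤ := if (i : ℕ) = 0 then -1 else i

/-- The larger of the two adjacent nonzero integers interchanged by `s_i`. -/
def hi (i : Fin r) : ℤ := i + 1

lemma lo_zero {i : Fin r} (h : (i : ℕ) = 0) : lo i = -1 := if_pos h
lemma lo_pos {i : Fin r} (h : (i : ℕ) ≠ 0) : lo i = i := if_neg h

lemma s_apply (i : Fin r) (k : ℤ) : (s i).1 k =
    if k = lo i then hi i else if k = hi i then lo i else if k = -lo i then -hi i
    else if k = -hi i then -lo i else k := by
  unfold s lo hi
  split_ifs with h <;>
    simp only [Equiv.Perm.mul_apply, Equiv.swap_apply_def] <;> split_ifs <;> omega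

lemma s_lo (i : Fin r) : (s i).1 (lo i) = hi i := by rw [s_apply, if_pos rfl]

lemma lo_lt_hi (i : Fin r) : lo i < hi i := by unfold lo hi; split_ifs <;> omega

lemma s_hi (i : Fin r) : (s i).1 (hi i) = lo i := by
  rw [s_apply, if_neg (lo_lt_hi i).ne', if_pos rfl]

lemma s_zero_apply {i : Fin r} (h : (i : ℕ) = 0) (k : ℤ) :
    (s i).1 k = if k = 1 then -1 else if k = -1 then 1 else k := by
  rw [s_apply, lo_zero h, hi, h]; split_ifs <;> omega

lemma s_pos_apply {i : Fin r} (h : (i : ℕ) ≠ 0) (k : ℤ) :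
    (s i).1 k = if k = i then (i + 1 : ℤ) else if k = i + 1 then (i : ℤ)
      else if k = -i then (-i - 1 : ℤ) else if k = -i - 1 then (-i : ℤ) else k := by
  rw [s_apply, lo_pos h, hi]; split_ifs <;> omega

lemma s_s_apply (i : Fin r) (k : ℤ) : (s i).1 ((s i).1 k) = k := by
  by_cases h : (i : ℕ) = 0
  · rw [s_zero_apply h k]; split_ifs <;> simp [s_zero_apply h, *]
  · rw [s_pos_apply h k]; split_ifs <;> rw [s_pos_apply h] <;> split_ifs <;> omega

@[simp] lemma s_mul_s (i : Fin r) : s i * s i = 1 := W.ext_pos fun k _ _ => s_s_apply i k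

@[simp] lemma s_inv (i : Fin r) : (s i)⁻¹ = s i := inv_eq_of_mul_eq_one_left (s_mul_s i)

@[simp] lemma mul_s_s (w : W r) (i : Fin r) : w * s i * s i = w := by rw [mul_assoc]; simp

/-- A generator reverses the order of no pair of nonzero integers other than the one it swaps
(and the negative of that pair). -/
lemma s_reverses {i : Fin r} {a b : ℤ} (ha : a ≠ 0) (hb : b ≠ 0) (hab : a < b)
    (h : (s i).1 b < (s i).1 a) : (a = lo i ∧ b = hi i) ∨ (a = -hi i ∧ b = -lo i) := by
  by_cases h0 : (i : ℕ) = 0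
  · rw [s_zero_apply h0, s_zero_apply h0] at h
    rw [lo_zero h0, hi, h0]; split_ifs at h <;> omega
  · rw [s_pos_apply h0, s_pos_apply h0] at h
    rw [lo_pos h0, hi]; split_ifs at h <;> omega

lemma s_abs_le {i : Fin r} {k : ℤ} : |(s i).1 k| ≤ r ↔ |k| ≤ r := by
  constructor
  · intro h
    have := W.abs_map_le (s i) h
    rwa [s_s_apply] at this
  · exact W.abs_map_le (s i)

/-- `s_i` is an ascent of `w`: multiplication by `s_i` on the right makes `w` longer. -/
def Up (w : W r) (i : Fin r) : Prop := w.1 (lo i) < w.1 (hi i)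

lemma up_zero {w : W r} {i : Fin r} (h : (i : ℕ) = 0) : Up w i ↔ 0 < w.1 1 := by
  rw [Up, lo_zero h, hi, h, W.map_neg]; norm_num

lemma up_pos {w : W r} {i : Fin r} (h : (i : ℕ) ≠ 0) :
    Up w i ↔ w.1 i < w.1 (i + 1) := by
  rw [Up, lo_pos h, hi]

lemma not_up {w : W r} {i : Fin r} : ¬ Up w i ↔ Up (w * s i) i := by
  rw [Up, Up, W.mul_apply, W.mul_apply, s_lo, s_hi, not_lt]
  constructor
  · intro h
    exact lt_of_le_of_ne h fun h' => (lo_lt_hi i).ne' (w.1.injective h')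
  · exact le_of_lt

open Classical in
/-- The pairs of nonzero integers in `[-r, r]` whose order is reversed by `w`. -/
def invs (w : W r) : Finset (ℤ × ℤ) :=
  (Finset.Icc (-(r : ℤ)) r ×ˢ Finset.Icc (-(r : ℤ)) r).filter fun p =>
    p.1 ≠ 0 ∧ p.2 ≠ 0 ∧ p.1 < p.2 ∧ w.1 p.2 < w.1 p.1

lemma mem_invs {w : W r} {p : ℤ × ℤ} : p ∈ invs w ↔
    (|p.1| ≤ r ∧ |p.2| ≤ r) ∧ p.1 ≠ 0 ∧ p.2 ≠ 0 ∧ p.1 < p.2 ∧ w.1 p.2 < w.1 p.1 := by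
  simp [invs, abs_le]

open Classical in
/-- The integers in `[1, r]` made negative by `w`. -/
def negs (w : W r) : Finset ℤ := (Finset.Icc (1 : ℤ) r).filter fun k => w.1 k < 0

lemma mem_negs {w : W r} {k : ℤ} : k ∈ negs w ↔ (1 ≤ k ∧ k ≤ r) ∧ w.1 k < 0 := by
  simp [negs]

lemma lo_hi_bounds (i : Fin r) : |lo i| ≤ r ∧ |hi i| ≤ r ∧ lo i ≠ 0 ∧ hi i ≠ 0 := by
  have := i.2
  unfold lo hi
  split_ifs <;> simp only [abs_le] <;> omega

/-- The pairs inverted by `w * s_i` are the images under `s_i` of those inverted by `w`, together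
with the pair swapped by `s_i` and its negative; these two pairs coincide if `i = 0`. -/
lemma card_invs_mul_s {w : W r} {i : Fin r} (h : Up w i) :
    (invs (w * s i)).card = (invs w).card + if (i : ℕ) = 0 then 1 else 2 := by
  classical
  let σ : ℤ × ℤ ≃ ℤ × ℤ := (s i).1.prodCongr (s i).1
  have hσ : ∀ p, σ p = ((s i).1 p.1, (s i).1 p.2) := fun p => rfl
  let F : Finset (ℤ × ℤ) := {(lo i, hi i), (-hi i, -lo i)}
  have hF : F.card = if (i : ℕ) = 0 then 1 else 2 := by
    by_cases h0 : (i : ℕ) = 0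
    · simp [F, h0, lo, hi]
    · rw [if_neg h0, Finset.card_pair]
      simp only [ne_eq, Prod.mk.injEq, not_and, lo_pos h0, hi]
      omega
  obtain ⟨h1, h2, h3, h4⟩ := lo_hi_bounds i
  have hlt := lo_lt_hi i
  have hnz : ∀ k : ℤ, k ≠ 0 → (s i).1 k ≠ 0 := fun k hk h' => hk ((W.map_eq_zero (s i)).1 h')
  have hset : invs (w * s i) = (invs w).map σ.toEmbedding ∪ F := by
    ext ⟨a, b⟩
    have hmap : (a, b) ∈ (invs w).map σ.toEmbedding ↔ σ (a, b) ∈ invs w := by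
      rw [Finset.mem_map_equiv]
      have : σ.symm = σ := by
        ext p <;> simp [hσ, Equiv.symm_apply_eq, σ, s_s_apply]
      rw [this]
    rw [Finset.mem_union, hmap, hσ, mem_invs, mem_invs]
    simp only [F, Finset.mem_insert, Finset.mem_singleton, Prod.mk.injEq, W.mul_apply, s_abs_le]
    constructor
    · rintro ⟨hb, ha0, hb0, hab, hw⟩
      by_cases hs : (s i).1 a < (s i).1 b
      · exact Or.inl ⟨hb, hnz _ ha0, hnz _ hb0, hs, hw⟩
      · have : (s i).1 b < (s i).1 a :=
          lt_of_le_of_ne (not_lt.1 hs) fun h' => hab.ne' ((s i).1.injective h')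
        exact Or.inr (s_reverses ha0 hb0 hab this)
    · rintro (⟨hb, ha0, hb0, hab, hw⟩ | ⟨rfl, rfl⟩ | ⟨rfl, rfl⟩)
      · have ha0' : a ≠ 0 := fun h' => ha0 ((W.map_eq_zero (s i)).2 h')
        have hb0' : b ≠ 0 := fun h' => hb0 ((W.map_eq_zero (s i)).2 h')
        refine ⟨hb, ha0', hb0', ?_, hw⟩
        by_contra hcon
        have hba : b < a := lt_of_le_of_ne (not_lt.1 hcon) fun h' => by
          rw [h'] at hab; exact lt_irrefl _ hab
        rcases s_reverses hb0' ha0' hba hab with ⟨rfl, rfl⟩ | ⟨rfl, rfl⟩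
        · rw [s_lo, s_hi] at hw
          exact lt_asymm hw h
        · rw [W.map_neg, W.map_neg (s i), s_lo, s_hi, W.map_neg, W.map_neg] at hw
          exact lt_asymm h (neg_lt_neg_iff.1 hw)
      · exact ⟨⟨h1, h2⟩, h3, h4, hlt, by rw [s_lo, s_hi]; exact h⟩
      · refine ⟨⟨by rwa [abs_neg], by rwa [abs_neg]⟩, by omega, by omega, by omega, ?_⟩
        rw [W.map_neg, W.map_neg (s i), s_lo, s_hi, W.map_neg, W.map_neg]
        exact neg_lt_neg h
  have hdisj : Disjoint ((invs w).map σ.toEmbedding) F := by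
    rw [Finset.disjoint_left]
    rintro p hp hpF
    obtain ⟨⟨a, b⟩, hab, rfl⟩ := Finset.mem_map.1 hp
    rw [mem_invs] at hab
    obtain ⟨-, -, -, hab, hw⟩ := hab
    simp only [F, Finset.mem_insert, Finset.mem_singleton] at hpF
    have e1 : σ.toEmbedding (a, b) = ((s i).1 a, (s i).1 b) := rfl
    rw [e1, Prod.mk.injEq, Prod.mk.injEq] at hpF
    rcases hpF with ⟨ha, hb⟩ | ⟨ha, hb⟩
    · have ha' := congrArg (s i).1 ha
      have hb' := congrArg (s i).1 hb
      rw [s_s_apply, s_lo] at ha'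
      rw [s_s_apply, s_hi] at hb'
      simp only at hab
      omega
    · have ha' := congrArg (s i).1 ha
      have hb' := congrArg (s i).1 hb
      rw [s_s_apply, W.map_neg, s_hi] at ha'
      rw [s_s_apply, W.map_neg, s_lo] at hb'
      simp only at hab
      omega
  rw [hset, Finset.card_union_of_disjoint hdisj, Finset.card_map, hF]

lemma card_negs_mul_s {w : W r} {i : Fin r} (h : Up w i) :
    (negs (w * s i)).card = (negs w).card + if (i : ℕ) = 0 then 1 else 0 := by
  classical
  have hi := i.2
  by_cases h0 : (i : ℕ) = 0
  · rw [up_zero h0] at h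
    have : negs (w * s i) = insert 1 (negs w) := by
      ext k
      rw [Finset.mem_insert, mem_negs, mem_negs, W.mul_apply, s_zero_apply h0]
      by_cases hk : k = 1
      · subst hk
        simp only [if_true, true_or, iff_true, W.map_neg]
        omega
      · rw [if_neg hk]
        by_cases hk' : k = -1
        · subst hk'; omega
        · rw [if_neg hk']; tauto
    rw [this, Finset.card_insert_of_notMem, if_pos h0]
    rw [mem_negs]; omega
  · rw [if_neg h0, add_zero]
    have : negs (w * s i) = (negs w).map (s i).1.toEmbedding := by
      ext k
      have hsymm : (s i).1.symm = (s i).1 := by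
        ext k; rw [Equiv.symm_apply_eq, s_s_apply]
      rw [Finset.mem_map_equiv, hsymm, mem_negs, mem_negs, W.mul_apply]
      have : (1 ≤ (s i).1 k ∧ (s i).1 k ≤ r) ↔ (1 ≤ k ∧ k ≤ r) := by
        rw [s_pos_apply h0]; split_ifs <;> omega
      rw [this]
    rw [this, Finset.card_map]

/-- Twice the length of a signed permutation, computed from its inversions. -/
def twiceLen (w : W r) : ℕ := (invs w).card + (negs w).card

lemma twiceLen_mul_s {w : W r} {i : Fin r} (h : Up w i) :
    twiceLen (w * s i) = twiceLen w + 2 := by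
  rw [twiceLen, twiceLen, card_invs_mul_s h, card_negs_mul_s h]
  split_ifs <;> omega

lemma twiceLen_one : twiceLen (1 : W r) = 0 := by
  have h1 : invs (1 : W r) = ∅ := by
    ext p; simp only [mem_invs, W.one_apply, Finset.notMem_empty, iff_false]; omega
  have h2 : negs (1 : W r) = ∅ := by
    ext p; simp only [mem_negs, W.one_apply, Finset.notMem_empty, iff_false]; omega
  rw [twiceLen, h1, h2]; rfl

/-- Only the identity has no descent: then `0 < w 1 < w 2 < ⋯ < w r ≤ r`. -/
lemma eq_one_of_forall_up {w : W r} (h : ∀ i, Up w i) : w = 1 := by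
  have hstep : ∀ k : ℕ, 1 ≤ k → k < r → w.1 k < w.1 (k + 1) := fun k hk hk' =>
    (up_pos (i := ⟨k, hk'⟩) (by simp; omega)).1 (h _)
  have hge : ∀ k : ℕ, k < r → (k : ℤ) + 1 ≤ w.1 (k + 1) := by
    intro k
    induction k with
    | zero =>
      intro hk
      have := (up_zero (w := w) (i := ⟨0, hk⟩) rfl).1 (h _)
      simp only [Nat.cast_zero, zero_add]
      omega
    | succ k ih =>
      intro hk
      have h1 := hstep (k + 1) (by omega) hk
      have h2 := ih (by omega)
      push_cast at h1 ⊢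
      omega
  have hle : ∀ k m : ℕ, m + k + 1 = r → w.1 (m + 1) ≤ m + 1 := by
    intro k
    induction k with
    | zero =>
      intro m hm
      have h1 := W.abs_map_le w (k := m + 1) (by rw [abs_le]; omega)
      rw [abs_le] at h1
      omega
    | succ k ih =>
      intro m hm
      have h1 := hstep (m + 1) (by omega) (by omega)
      have h2 := ih (m + 1) (by omega)
      push_cast at h1 h2
      omega
  refine W.ext_pos fun k hk hk' => ?_
  obtain ⟨m, rfl⟩ : ∃ m : ℕ, k = m + 1 := ⟨(k - 1).toNat, by omega⟩
  have h1 := hge m (by omega)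
  have h2 := hle (r - m - 1) m (by omega)
  rw [W.one_apply]
  omega

/-- Induction over signed permutations, along ascents. -/
lemma up_induction {P : W r → Prop} (one : P 1)
    (mul : ∀ w i, Up w i → P w → P (w * s i)) (w : W r) : P w := by
  induction hn : twiceLen w using Nat.strong_induction_on generalizing w with
  | _ n ih =>
    by_cases h : ∀ i, Up w i
    · rw [eq_one_of_forall_up h]; exact one
    · push Not at h
      obtain ⟨i, hi⟩ := h
      have h1 := not_up.1 hi
      have h2 := twiceLen_mul_s h1
      rw [mul_s_s] at h2
      have := mul _ i h1 (ih (twiceLen (w * s i)) (by omega) _ rfl)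
      rwa [mul_s_s] at this

lemma wordProd_nil : wordProd ([] : List (Fin r)) = 1 := rfl

lemma wordProd_append (l l' : List (Fin r)) :
    wordProd (l ++ l') = wordProd l * wordProd l' := by
  simp [wordProd]

lemma wordProd_singleton (i : Fin r) : wordProd [i] = s i := by simp [wordProd]

lemma wordProd_cons (i : Fin r) (l : List (Fin r)) : wordProd (i :: l) = s i * wordProd l := by
  simp [wordProd]

lemma twiceLen_mul_s_le (w : W r) (i : Fin r) : twiceLen (w * s i) ≤ twiceLen w + 2 := by
  by_cases h : Up w i
  · exact (twiceLen_mul_s h).le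
  · have := twiceLen_mul_s (not_up.1 h)
    rw [mul_s_s] at this
    omega

lemma twiceLen_wordProd_le (l : List (Fin r)) : twiceLen (wordProd l) ≤ 2 * l.length := by
  induction l using List.reverseRecOn with
  | nil => rw [wordProd_nil, twiceLen_one]; simp
  | append_singleton l i ih =>
    rw [wordProd_append, wordProd_singleton, List.length_append]
    have := twiceLen_mul_s_le (wordProd l) i
    simp only [List.length_singleton]
    omega

lemma exists_word (w : W r) : ∃ l : List (Fin r), wordProd l = w ∧ 2 * l.length = twiceLen w := by
  induction w using up_induction with
  | one => exact ⟨[], rfl, by rw [twiceLen_one]; rfl⟩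
  | mul w i h ih =>
    obtain ⟨l, rfl, hl⟩ := ih
    refine ⟨l ++ [i], by rw [wordProd_append, wordProd_singleton], ?_⟩
    rw [twiceLen_mul_s h, List.length_append, List.length_singleton]
    omega

/-- `twiceLen` grows by exactly two at each ascent and drops by two at each descent, hence is twice
the length. -/
lemma two_mul_len (w : W r) : 2 * len w = twiceLen w := by
  obtain ⟨l, hl, hl'⟩ := exists_word w
  have h1 : len w ≤ l.length := Nat.sInf_le ⟨l, hl, rfl⟩
  obtain ⟨l', hw, hlen⟩ : len w ∈ {k | ∃ l : List (Fin r), wordProd l = w ∧ l.length = k} :=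
    Nat.sInf_mem ⟨_, l, hl, rfl⟩
  have h2 := twiceLen_wordProd_le l'
  rw [hw, hlen] at h2
  omega

lemma len_one : len (1 : W r) = 0 := by
  have := two_mul_len (1 : W r)
  rw [twiceLen_one] at this
  omega

lemma len_mul_s {w : W r} {i : Fin r} (h : Up w i) : len (w * s i) = len w + 1 := by
  have h1 := twiceLen_mul_s h
  rw [← two_mul_len, ← two_mul_len] at h1
  omega

lemma len_mul_s_of_not_up {w : W r} {i : Fin r} (h : ¬ Up w i) : len w = len (w * s i) + 1 := by
  have := len_mul_s (not_up.1 h)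
  rwa [mul_s_s] at this

lemma up_iff_len {w : W r} {i : Fin r} : Up w i ↔ len w < len (w * s i) := by
  constructor
  · intro h; rw [len_mul_s h]; omega
  · intro h
    by_contra h'
    have := len_mul_s_of_not_up h'
    omega

lemma len_wordProd_le (l : List (Fin r)) : len (wordProd l) ≤ l.length := by
  have := twiceLen_wordProd_le l
  rw [← two_mul_len] at this
  omega

lemma exists_reduced (w : W r) : ∃ l : List (Fin r), IsReduced l ∧ wordProd l = w := by
  obtain ⟨l, rfl, hl⟩ := exists_word w
  rw [← two_mul_len] at hl
  exact ⟨l, by rw [IsReduced]; omega, rfl⟩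

lemma wordProd_reverse (l : List (Fin r)) : wordProd l.reverse = (wordProd l)⁻¹ := by
  induction l with
  | nil => simp [wordProd_nil]
  | cons i l ih =>
    rw [List.reverse_cons, wordProd_append, ih, wordProd_singleton, wordProd_cons, mul_inv_rev,
      s_inv]

lemma len_inv (w : W r) : len w⁻¹ = len w := by
  have key : ∀ v : W r, len v⁻¹ ≤ len v := by
    intro v
    obtain ⟨l, hl, rfl⟩ := exists_reduced v
    rw [← wordProd_reverse, ← hl, ← List.length_reverse]
    exact len_wordProd_le _
  refine le_antisymm (key w) ?_
  have := key w⁻¹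
  rwa [inv_inv] at this

lemma IsReduced.reverse {l : List (Fin r)} (h : IsReduced l) : IsReduced l.reverse := by
  rw [IsReduced, wordProd_reverse, len_inv, List.length_reverse]
  exact h

lemma isReduced_append_singleton {l : List (Fin r)} {i : Fin r} :
    IsReduced (l ++ [i]) ↔ IsReduced l ∧ Up (wordProd l) i := by
  rw [IsReduced, IsReduced, wordProd_append, wordProd_singleton, List.length_append,
    List.length_singleton]
  have h1 := len_wordProd_le l
  constructor
  · intro h
    have hup : Up (wordProd l) i := up_iff_len.2 (by omega)
    rw [len_mul_s hup] at h
    exact ⟨by omega, hup⟩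
  · rintro ⟨h, hup⟩
    rw [len_mul_s hup]; omega

/-- The number of factors `s_0` in a reduced expression is the number of sign changes: along a
reduced word, the latter grows by one exactly at the letters `s_0`. -/
lemma numZero_eq (w : W r) : numZero w = (negs w).card := by
  -- The letters of a word are counted after coercion of the word to a list of natural numbers.
  have hmap : ∀ l : List (Fin r), (do let a ← l; pure (a : ℕ)) = l.map Fin.val := by
    intro l; simp [List.map_eq_flatMap]
  have key : ∀ l : List (Fin r), IsReduced l →
      (l.map Fin.val).countP (fun i => i = 0) = (negs (wordProd l)).card := by
    intro l
    induction l using List.reverseRecOn with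
    | nil =>
      intro _
      have := @twiceLen_one r
      rw [twiceLen] at this
      rw [wordProd_nil, List.map_nil, List.countP_nil]
      omega
    | append_singleton l i ih =>
      intro h
      obtain ⟨h1, h2⟩ := isReduced_append_singleton.1 h
      rw [List.map_append, List.countP_append, ih h1, wordProd_append, wordProd_singleton,
        card_negs_mul_s h2]
      simp [List.countP_cons]
  have hset : {k | ∃ l : List (Fin r), IsReduced l ∧ wordProd l = w ∧
      l.countP (fun i => (i : ℕ) = 0) = k} = {(negs w).card} := by
    ext k
    simp only [Set.mem_ofPred_eq, Set.mem_singleton_iff, hmap]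
    constructor
    · rintro ⟨l, hl, rfl, rfl⟩; exact key l hl
    · rintro rfl
      obtain ⟨l, hl, rfl⟩ := exists_reduced w
      exact ⟨l, hl, rfl, key l hl⟩
  rw [numZero, hset, csInf_singleton]

lemma numZero_le_len (w : W r) : numZero w ≤ len w := by
  rw [numZero_eq]
  induction w using up_induction with
  | one =>
    have := @twiceLen_one r
    rw [twiceLen] at this
    omega
  | mul w i h ih => rw [len_mul_s h, card_negs_mul_s h]; split_ifs <;> omega

/-- Lengths add in `w v` as soon as `w` does not undo any of the inversions of `v`. -/
lemma len_mul_of_inversions {w v : W r}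
    (h : ∀ a b : ℤ, a ≠ 0 → b ≠ 0 → a < b → v.1 b < v.1 a → w.1 (v.1 b) < w.1 (v.1 a)) :
    len (w * v) = len w + len v := by
  induction v using up_induction with
  | one => rw [mul_one, len_one, add_zero]
  | mul v i hup ih =>
    have hb := lo_hi_bounds i
    have h1 : Up (w * v) i := by
      have := h (lo i) (hi i) hb.2.2.1 hb.2.2.2 (lo_lt_hi i)
      rw [W.mul_apply, W.mul_apply, s_lo, s_hi] at this
      exact this hup
    rw [← mul_assoc, len_mul_s h1, len_mul_s hup, ih, add_assoc]
    intro a b ha hb hab hv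
    have key := h ((s i).1 a) ((s i).1 b) (fun h' => ha ((W.map_eq_zero (s i)).1 h'))
      (fun h' => hb ((W.map_eq_zero (s i)).1 h'))
    rw [W.mul_apply, W.mul_apply, s_s_apply, s_s_apply] at key
    by_cases hs : (s i).1 a < (s i).1 b
    · exact key hs hv
    · exfalso
      have : (s i).1 b < (s i).1 a :=
        lt_of_le_of_ne (not_lt.1 hs) fun h' => hab.ne' ((s i).1.injective h')
      rcases s_reverses ha hb hab this with ⟨rfl, rfl⟩ | ⟨rfl, rfl⟩
      · exact lt_asymm hup hv
      · rw [W.map_neg, W.map_neg] at hv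
        exact lt_asymm hup (neg_lt_neg_iff.1 hv)

lemma len_s_mul (w : W r) (i : Fin r) : len (s i * w) = len (w⁻¹ * s i) := by
  rw [← len_inv, mul_inv_rev, s_inv]

/-- The exchange property behind the commutation of left and right multiplications. -/
lemma s_mul_eq_mul_s {w : W r} {i j : Fin r} (h : Up w⁻¹ i) (h' : ¬ Up (w * s j)⁻¹ i) :
    s i * w = w * s j := by
  have hb := lo_hi_bounds i
  have hnz : ∀ k : ℤ, k ≠ 0 → (w⁻¹).1 k ≠ 0 := fun k hk h' => hk ((W.map_eq_zero w⁻¹).1 h')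
  have h2 : (s j).1 ((w⁻¹).1 (hi i)) < (s j).1 ((w⁻¹).1 (lo i)) := by
    rw [mul_inv_rev, s_inv, not_up, Up] at h'
    simp only [W.mul_apply, s_lo, s_hi] at h'
    exact h'
  have hkey := s_reverses (hnz _ hb.2.2.1) (hnz _ hb.2.2.2) h h2
  have e : ∀ {k m : ℤ}, (w⁻¹).1 k = m → k = w.1 m := by
    rintro k m rfl; simp
  suffices hs : ∀ k, (s i).1 (w.1 k) = w.1 ((s j).1 k) from W.ext_pos fun k _ _ => hs k
  intro k
  have hinj : ∀ {x y : ℤ}, w.1 x = w.1 y ↔ x = y := w.1.injective.eq_iff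
  rcases hkey with ⟨ha, hc⟩ | ⟨ha, hc⟩
  · rw [s_apply, e ha, e hc, s_apply, ← W.map_neg, ← W.map_neg]
    simp only [hinj]
    split_ifs <;> rfl
  · rw [s_apply, e ha, e hc, s_apply, ← W.map_neg, ← W.map_neg]
    simp only [hinj, neg_neg]
    have hj : (lo j = -1 ∧ hi j = 1) ∨ (0 < lo j ∧ lo j < hi j) := by
      unfold lo hi; split_ifs <;> omega
    split_ifs <;> first | rfl | (exfalso; omega) | (refine congrArg w.1 ?_; omega)

end SignedPermutations

/-! ### The regular representation of the Hecke algebra -/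

section RegularRepresentation

variable {R : Type u} [CommRing R] (q Q : Rˣ) {r : ℕ}

lemma up_inv_iff_len {w : W r} {i : Fin r} : Up w⁻¹ i ↔ len w < len (s i * w) := by
  rw [up_iff_len, len_inv, len_s_mul]

lemma up_s_mul_inv {w : W r} {i : Fin r} : Up (s i * w)⁻¹ i ↔ ¬ Up w⁻¹ i := by
  rw [mul_inv_rev, s_inv, not_up]

lemma len_s_mul_eq {w : W r} {i : Fin r} (h : Up w⁻¹ i) : len (s i * w) = len w + 1 := by
  rw [len_s_mul, len_mul_s h, len_inv]

lemma len_s_mul_eq' {w : W r} {i : Fin r} (h : ¬ Up w⁻¹ i) : len w = len (s i * w) + 1 := by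
  rw [len_s_mul, ← len_mul_s_of_not_up h, len_inv]

/-- The quadratic parameters of conjugate generators agree. -/
lemma param_eq_of_conj {w : W r} {i j : Fin r} (h : s i * w = w * s j) :
    param q Q i = param q Q j := by
  have key : ∀ (v : W r) (i j : Fin r), s i * v = v * s j → (i : ℕ) = 0 → (j : ℕ) = 0 := by
    intro v i j h h0
    by_contra hj
    have h1 : (s i).1 (v.1 j) = v.1 ((s j).1 j) := congrArg (fun x : W r => x.1 j) h
    rw [← lo_pos hj, s_lo, s_zero_apply h0, lo_pos hj, hi] at h1
    have hinj : ∀ {x y : ℤ}, v.1 x = v.1 y → x = y := fun h => v.1.injective h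
    split_ifs at h1 with h2 h3
    · rw [← h2, ← W.map_neg] at h1; have := hinj h1; omega
    · have : v.1 (-(j : ℤ)) = 1 := by rw [W.map_neg, h3]; rfl
      rw [← this] at h1; have := hinj h1; omega
    · have := hinj h1; omega
  have h' : s j * w⁻¹ = w⁻¹ * s i := by
    rw [← s_inv j, ← mul_inv_rev, ← h, mul_inv_rev, s_inv]
  have : (i : ℕ) = 0 ↔ (j : ℕ) = 0 := ⟨key w i j h, key w⁻¹ j i h'⟩
  simp only [param, this]

open Classical in
/-- Left multiplication by `T_i` on the free module with basis `W_r`. -/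
def leftOp (i : Fin r) : Module.End R (W r →₀ R) :=
  Finsupp.lsum R fun w => LinearMap.toSpanSingleton R _
    (if Up w⁻¹ i then Finsupp.single (s i * w) (1 : R)
      else param q Q i • Finsupp.single (s i * w) 1 + (param q Q i - 1) • Finsupp.single w 1)

open Classical in
/-- Right multiplication by `T_i` on the free module with basis `W_r`. -/
def rightOp (i : Fin r) : Module.End R (W r →₀ R) :=
  Finsupp.lsum R fun w => LinearMap.toSpanSingleton R _
    (if Up w i then Finsupp.single (w * s i) (1 : R)
      else param q Q i • Finsupp.single (w * s i) 1 + (param q Q i - 1) • Finsupp.single w 1)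

open Classical in
lemma leftOp_single (i : Fin r) (w : W r) : leftOp q Q i (Finsupp.single w 1) =
    if Up w⁻¹ i then Finsupp.single (s i * w) (1 : R)
      else param q Q i • Finsupp.single (s i * w) 1 + (param q Q i - 1) • Finsupp.single w 1 := by
  simp [leftOp]

open Classical in
lemma rightOp_single (i : Fin r) (w : W r) : rightOp q Q i (Finsupp.single w 1) =
    if Up w i then Finsupp.single (w * s i) (1 : R)
      else param q Q i • Finsupp.single (w * s i) 1 + (param q Q i - 1) • Finsupp.single w 1 := by
  simp [rightOp]

/-- Left and right multiplications commute; this is where the exchange property enters. -/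
lemma leftOp_rightOp_single (i j : Fin r) (w : W r) :
    leftOp q Q i (rightOp q Q j (Finsupp.single w 1)) =
      rightOp q Q j (leftOp q Q i (Finsupp.single w 1)) := by
  classical
  by_cases hAC : Up w⁻¹ i ↔ Up (w * s j)⁻¹ i
  -- If `s_i` on the left lengthens both or neither of `w` and `w s_j`, then `s_j` on the right
  -- lengthens both or neither of `w` and `s_i w`.
  · have hBD : Up w j ↔ Up (s i * w) j := by
      rw [up_iff_len, up_iff_len, mul_assoc]
      by_cases hA : Up w⁻¹ i
      · rw [len_s_mul_eq hA, len_s_mul_eq (hAC.1 hA)]; omega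
      · have h1 := len_s_mul_eq' hA
        have h2 := len_s_mul_eq' (fun h => hA (hAC.2 h))
        omega
    rw [leftOp_single, rightOp_single]
    split_ifs with h1 h2 h2
    · rw [leftOp_single, rightOp_single, if_pos (hAC.1 h2), if_pos (hBD.1 h1), mul_assoc]
    · rw [leftOp_single, if_neg (hAC.not.1 h2), map_add, map_smul, map_smul,
        rightOp_single, rightOp_single, if_pos (hBD.1 h1), if_pos h1, mul_assoc]
    · rw [rightOp_single, if_neg (hBD.not.1 h1), map_add, map_smul, map_smul,
        leftOp_single, leftOp_single, if_pos (hAC.1 h2), if_pos h2, mul_assoc]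
    · rw [map_add, map_smul, map_smul, map_add, map_smul, map_smul, leftOp_single, leftOp_single,
        rightOp_single, rightOp_single, if_neg (hAC.not.1 h2), if_neg (hBD.not.1 h1), if_neg h1,
        if_neg h2, mul_assoc]
      module
  -- Otherwise `s_i w = w s_j` by the exchange property.
  · have hconj : s i * w = w * s j := by
      by_cases hA : Up w⁻¹ i
      · exact s_mul_eq_mul_s hA fun h => hAC ⟨fun _ => h, fun _ => hA⟩
      · have hC : Up (w * s j)⁻¹ i := by
          by_contra hC
          exact hAC ⟨fun h => absurd h hA, fun h => absurd h hC⟩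
        have := s_mul_eq_mul_s (j := j) hC (by rwa [mul_s_s])
        rw [mul_s_s] at this
        rw [← this, ← mul_assoc, ← mul_assoc, s_mul_s, one_mul, this]
    have hp := param_eq_of_conj q Q hconj
    have hsw : s i * (w * s j) = w := by rw [← hconj, ← mul_assoc, s_mul_s, one_mul]
    have hAB : Up w⁻¹ i ↔ Up w j := by rw [up_inv_iff_len, up_iff_len, hconj]
    have hC : Up (w * s j)⁻¹ i ↔ ¬ Up w j := by
      rw [← hconj, up_s_mul_inv, hAB]
    have hD : Up (w * s j) j ↔ ¬ Up w j := not_up.symm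
    rw [leftOp_single, rightOp_single]
    by_cases hB : Up w j
    · rw [if_pos hB, if_pos (hAB.2 hB), hconj, leftOp_single, rightOp_single,
        if_neg (hC.not.2 (not_not.2 hB)), if_neg (hD.not.2 (not_not.2 hB)), hsw, mul_s_s, hp]
    · rw [if_neg hB, if_neg (hAB.not.2 hB), map_add, map_smul, map_smul, map_add, map_smul,
        map_smul, hconj, leftOp_single, rightOp_single, leftOp_single, rightOp_single,
        if_pos (hC.2 hB), if_pos (hD.2 hB), if_neg hB, if_neg (hAB.not.2 hB), hsw, mul_s_s, hconj,
        hp]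

lemma leftOp_commute_rightOp (i j : Fin r) : Commute (leftOp q Q i) (rightOp q Q j) := by
  refine Finsupp.lhom_ext' fun w => LinearMap.ext_ring ?_
  exact leftOp_rightOp_single q Q i j w

lemma leftOp_mul_self (i : Fin r) : leftOp q Q i * leftOp q Q i =
    algebraMap R _ (param q Q i) + algebraMap R _ (param q Q i - 1) * leftOp q Q i := by
  classical
  refine Finsupp.lhom_ext' fun w => LinearMap.ext_ring ?_
  have hs : s i * (s i * w) = w := by rw [← mul_assoc, s_mul_s, one_mul]
  change leftOp q Q i (leftOp q Q i (Finsupp.single w 1)) = param q Q i • Finsupp.single w 1 +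
    (param q Q i - 1) • leftOp q Q i (Finsupp.single w 1)
  rw [leftOp_single]
  by_cases h : Up w⁻¹ i
  · rw [if_pos h, leftOp_single, if_neg (up_s_mul_inv.not.2 (not_not.2 h)), hs]
  · rw [if_neg h, map_add, map_smul, map_smul, leftOp_single, leftOp_single, if_neg h,
      if_pos (up_s_mul_inv.2 h), hs]

/-- An operator commuting with all right multiplications is determined by its value at the
identity element. -/
lemma eq_of_commute_rightOp {f g : Module.End R (W r →₀ R)}
    (hf : ∀ j, Commute f (rightOp q Q j)) (hg : ∀ j, Commute g (rightOp q Q j))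
    (h : f (Finsupp.single 1 1) = g (Finsupp.single 1 1)) : f = g := by
  classical
  refine Finsupp.lhom_ext' fun w => LinearMap.ext_ring ?_
  change f (Finsupp.single w 1) = g (Finsupp.single w 1)
  induction w using up_induction with
  | one => exact h
  | mul w i hup ih =>
    have h1 : rightOp q Q i (Finsupp.single w 1) = Finsupp.single (w * s i) 1 := by
      rw [rightOp_single, if_pos hup]
    rw [← h1]
    have h2 := LinearMap.congr_fun (hf i).eq (Finsupp.single w 1)
    have h3 := LinearMap.congr_fun (hg i).eq (Finsupp.single w 1)
    rw [Module.End.mul_apply, Module.End.mul_apply] at h2 h3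
    rw [h2, h3, ih]

/-- The product of left multiplications along a word. -/
def leftWord (l : List (Fin r)) : Module.End R (W r →₀ R) := (l.map (leftOp q Q)).prod

lemma isReduced_cons {l : List (Fin r)} {i : Fin r} (h : IsReduced (i :: l)) :
    IsReduced l ∧ Up (wordProd l)⁻¹ i := by
  have h1 := h.reverse
  rw [List.reverse_cons, isReduced_append_singleton, wordProd_reverse] at h1
  refine ⟨?_, h1.2⟩
  have := h1.1.reverse
  rwa [List.reverse_reverse] at this

lemma leftWord_single_one {l : List (Fin r)} (h : IsReduced l) :
    leftWord q Q l (Finsupp.single 1 1) = Finsupp.single (wordProd l) 1 := by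
  classical
  induction l with
  | nil => simp [leftWord, wordProd_nil]
  | cons i l ih =>
    obtain ⟨h1, h2⟩ := isReduced_cons h
    rw [leftWord, List.map_cons, List.prod_cons, Module.End.mul_apply]
    have := ih h1
    rw [leftWord] at this
    rw [this, leftOp_single, if_pos h2, wordProd_cons]

lemma leftWord_commute (l : List (Fin r)) (j : Fin r) :
    Commute (leftWord q Q l) (rightOp q Q j) := by
  refine (Commute.list_prod_right _ _ fun x hx => ?_).symm
  obtain ⟨i, -, rfl⟩ := List.mem_map.1 hx
  exact (leftOp_commute_rightOp q Q i j).symm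

/-- Words for the same element that are both reduced give the same operator, as its value at the
identity element is the same: the braid relations are not needed. -/
lemma leftWord_eq {l l' : List (Fin r)} (h : IsReduced l) (h' : IsReduced l')
    (e : wordProd l = wordProd l') : leftWord q Q l = leftWord q Q l' :=
  eq_of_commute_rightOp q Q (leftWord_commute q Q l) (leftWord_commute q Q l')
    (by rw [leftWord_single_one q Q h, leftWord_single_one q Q h', e])

lemma isReduced_singleton (i : Fin r) : IsReduced [i] := by
  have : IsReduced ([] ++ [i]) := isReduced_append_singleton.2
    ⟨by rw [IsReduced, wordProd_nil, len_one]; rfl, by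
      rw [wordProd_nil, Up]; exact lo_lt_hi i⟩
  exact this

/-- The left regular representation of the Hecke algebra on the free module with basis `W_r`. -/
def regRep : Hecke q Q r →ₐ[R] Module.End R (W r →₀ R) :=
  RingQuot.liftAlgHom R ⟨FreeAlgebra.lift R fun w => leftWord q Q (exists_reduced w).choose, by
    have key : ∀ l : List (Fin r), IsReduced l →
        leftWord q Q (exists_reduced (wordProd l)).choose = leftWord q Q l := fun l hl =>
      leftWord_eq q Q (exists_reduced (wordProd l)).choose_spec.1 hl
        (exists_reduced (wordProd l)).choose_spec.2
    have keys : ∀ i : Fin r, leftWord q Q (exists_reduced (s i)).choose = leftOp q Q i := by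
      intro i
      have h := key [i] (isReduced_singleton i)
      rw [wordProd_singleton] at h
      rw [h]; simp [leftWord]
    intro x y hxy
    induction hxy with
    | reduced l hl =>
      rw [FreeAlgebra.lift_ι_apply, key l hl, map_list_prod, leftWord, List.map_map]
      congr 1
      refine List.map_congr_left fun i _ => ?_
      rw [Function.comp_apply, FreeAlgebra.lift_ι_apply, keys]
    | quadratic i =>
      rw [map_mul, map_add, map_mul, AlgHom.commutes, AlgHom.commutes, FreeAlgebra.lift_ι_apply,
        keys, leftOp_mul_self]⟩

lemma regRep_T (w : W r) : regRep q Q (T q Q w) (Finsupp.single 1 1) = Finsupp.single w 1 := by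
  have h : regRep q Q (T q Q w) = leftWord q Q (exists_reduced w).choose := by
    unfold regRep T
    erw [RingQuot.liftAlgHom_mkAlgHom_apply]
    rw [FreeAlgebra.lift_ι_apply]
  rw [h, leftWord_single_one q Q (exists_reduced w).choose_spec.1,
    (exists_reduced w).choose_spec.2]

end RegularRepresentation

/-! ### Multiplication, coefficients and the anti-involution -/

section HeckeAlgebra

variable {R : Type u} [CommRing R] (q Q : Rˣ) {r : ℕ}

/-- The generators `T_i` of the Hecke algebra. -/
abbrev Ts (i : Fin r) : Hecke q Q r := T q Q (s i)

variable {q Q}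

lemma T_wordProd {l : List (Fin r)} (hl : IsReduced l) :
    T q Q (wordProd l) = (l.map (Ts q Q)).prod := by
  have h := RingQuot.mkAlgHom_rel R (HeckeRel.reduced (q := q) (Q := Q) l hl)
  rw [map_list_prod, List.map_map] at h
  exact h

@[simp] lemma T_one : T q Q (1 : W r) = 1 := by
  have := T_wordProd (q := q) (Q := Q) (r := r) (l := [])
    (by rw [IsReduced, wordProd_nil, len_one]; rfl)
  simpa [wordProd_nil] using this

lemma Ts_mul_self (i : Fin r) : Ts q Q i * Ts q Q i =
    algebraMap R _ (param q Q i) + algebraMap R _ (param q Q i - 1) * Ts q Q i := by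
  have h := RingQuot.mkAlgHom_rel R (HeckeRel.quadratic (q := q) (Q := Q) i)
  rw [map_mul, map_add, map_mul, AlgHom.commutes, AlgHom.commutes] at h
  exact h

/-- `T_w T_v = T_{wv}` as soon as `w` does not undo any of the inversions of `v`. -/
lemma T_mul_Ts {w : W r} {i : Fin r} (h : Up w i) : T q Q w * Ts q Q i = T q Q (w * s i) := by
  obtain ⟨l, hl, rfl⟩ := exists_reduced w
  rw [← wordProd_singleton, ← wordProd_append, T_wordProd hl,
    T_wordProd (isReduced_append_singleton.2 ⟨hl, h⟩)]
  simp

lemma T_mul_Ts_of_not_up {w : W r} {i : Fin r} (h : ¬ Up w i) : T q Q w * Ts q Q i =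
    param q Q i • T q Q (w * s i) + (param q Q i - 1) • T q Q w := by
  have h1 := T_mul_Ts (q := q) (Q := Q) (not_up.1 h)
  rw [mul_s_s] at h1
  rw [← h1, mul_assoc, Ts_mul_self, mul_add, ← Algebra.smul_def, mul_smul_comm,
    ← Algebra.commutes, ← Algebra.smul_def]

lemma Ts_mul_T {w : W r} {i : Fin r} (h : Up w⁻¹ i) : Ts q Q i * T q Q w = T q Q (s i * w) := by
  obtain ⟨l, hl, rfl⟩ := exists_reduced w
  have h2 : IsReduced (i :: l) := by
    have : IsReduced (l.reverse ++ [i]) := isReduced_append_singleton.2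
      ⟨hl.reverse, by rwa [wordProd_reverse]⟩
    simpa using this.reverse
  rw [← wordProd_cons, T_wordProd hl, T_wordProd h2, List.map_cons, List.prod_cons]

lemma Ts_mul_T_of_not_up {w : W r} {i : Fin r} (h : ¬ Up w⁻¹ i) : Ts q Q i * T q Q w =
    param q Q i • T q Q (s i * w) + (param q Q i - 1) • T q Q w := by
  have h1 := Ts_mul_T (q := q) (Q := Q) (up_s_mul_inv.2 h)
  rw [← mul_assoc, s_mul_s, one_mul] at h1
  rw [← h1, ← mul_assoc, Ts_mul_self, add_mul, ← Algebra.smul_def, mul_assoc, ← Algebra.smul_def]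

lemma T_mul_T_of_len {w v : W r} (h : len (w * v) = len w + len v) :
    T q Q w * T q Q v = T q Q (w * v) := by
  obtain ⟨l, hl, rfl⟩ := exists_reduced w
  obtain ⟨l', hl', rfl⟩ := exists_reduced v
  rw [← wordProd_append, T_wordProd hl, T_wordProd hl', T_wordProd, List.map_append,
    List.prod_append]
  rw [IsReduced, List.length_append, wordProd_append, h, hl, hl']

lemma T_mul_T {w v : W r}
    (h : ∀ a b : ℤ, a ≠ 0 → b ≠ 0 → a < b → v.1 b < v.1 a → w.1 (v.1 b) < w.1 (v.1 a)) :
    T q Q w * T q Q v = T q Q (w * v) :=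
  T_mul_T_of_len (len_mul_of_inversions h)

/-- A generator commuting with `w` in the group commutes with `T_w` in the Hecke algebra. -/
lemma Ts_commute_T {w : W r} {i : Fin r} (h : s i * w = w * s i) :
    Commute (Ts q Q i) (T q Q w) := by
  have hup : Up w⁻¹ i ↔ Up w i := by rw [up_inv_iff_len, up_iff_len, h]
  by_cases hw : Up w i
  · rw [Commute, SemiconjBy, Ts_mul_T (hup.2 hw), T_mul_Ts hw, h]
  · rw [Commute, SemiconjBy, Ts_mul_T_of_not_up (hup.not.2 hw), T_mul_Ts_of_not_up hw, h]

/-- The Hecke algebra is generated by the `T_i`. -/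
lemma Hecke.induction {P : Hecke q Q r → Prop} (scalar : ∀ c : R, P (algebraMap R _ c))
    (gen : ∀ i, P (Ts q Q i)) (add : ∀ x y, P x → P y → P (x + y))
    (mul : ∀ x y, P x → P y → P (x * y)) (h : Hecke q Q r) : P h := by
  obtain ⟨x, rfl⟩ := RingQuot.mkAlgHom_surjective R (HeckeRel q Q r) h
  induction x using FreeAlgebra.induction with
  | grade0 c => rw [AlgHom.commutes]; exact scalar c
  | grade1 w =>
    change P (T q Q w)
    induction w using up_induction with
    | one => rw [T_one, ← map_one (algebraMap R _)]; exact scalar 1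
    | mul w i hup ih => rw [← T_mul_Ts hup]; exact mul _ _ ih (gen i)
  | mul a b ha hb => rw [map_mul]; exact mul _ _ ha hb
  | add a b ha hb => rw [map_add]; exact add _ _ ha hb

/-- Right multiplication by the Hecke algebra preserves a submodule as soon as right
multiplication by the generators does. -/
lemma mul_mem_of_Ts {N : Submodule R (Hecke q Q r)}
    (hN : ∀ x ∈ N, ∀ i, x * Ts q Q i ∈ N) (h : Hecke q Q r) :
    ∀ x ∈ N, x * h ∈ N := by
  induction h using Hecke.induction with
  | scalar c =>
    intro x hx
    rw [← Algebra.commutes, ← Algebra.smul_def]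
    exact N.smul_mem _ hx
  | gen i => exact fun x hx => hN x hx i
  | add h h' ih ih' => exact fun x hx => by rw [mul_add]; exact N.add_mem (ih x hx) (ih' x hx)
  | mul h h' ih ih' => exact fun x hx => by rw [← mul_assoc]; exact ih' _ (ih x hx)

variable (q Q) in
/-- The coefficients of an element of the Hecke algebra with respect to the `T_w`. -/
def coeffs : Hecke q Q r →ₗ[R] (W r →₀ R) :=
  (LinearMap.applyₗ (Finsupp.single 1 1)).comp (regRep q Q).toLinearMap

lemma coeffs_T (w : W r) : coeffs q Q (T q Q w) = Finsupp.single w 1 := regRep_T q Q w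

variable (q Q) in
/-- The `R`-linear involution `T_w ↦ T_{w⁻¹}`, as a homomorphism to the opposite algebra. -/
def starHom : Hecke q Q r →ₐ[R] (Hecke q Q r)ᵐᵒᵖ :=
  RingQuot.liftAlgHom R ⟨FreeAlgebra.lift R fun w => MulOpposite.op (T q Q w⁻¹), by
    intro x y hxy
    induction hxy with
    | reduced l hl =>
      rw [FreeAlgebra.lift_ι_apply, ← wordProd_reverse, T_wordProd hl.reverse, map_list_prod,
        List.map_map, MulOpposite.op_list_prod, ← List.map_reverse, ← List.map_reverse,
        List.reverse_reverse, List.map_map]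
      congr 1
      refine List.map_congr_left fun i _ => ?_
      rw [Function.comp_apply, Function.comp_apply, FreeAlgebra.lift_ι_apply, s_inv]
    | quadratic i =>
      rw [map_mul, map_add, map_mul, AlgHom.commutes, AlgHom.commutes, FreeAlgebra.lift_ι_apply,
        s_inv, ← MulOpposite.op_mul, Ts_mul_self, MulOpposite.op_add, MulOpposite.op_mul,
        MulOpposite.algebraMap_apply, MulOpposite.algebraMap_apply, ← MulOpposite.op_mul,
        ← MulOpposite.op_mul, Algebra.commutes]⟩

variable (q Q) in
/-- The anti-involution `T_w ↦ T_{w⁻¹}` of the Hecke algebra. -/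
def hstar (h : Hecke q Q r) : Hecke q Q r := (starHom q Q h).unop

lemma hstar_T (w : W r) : hstar q Q (T q Q w) = T q Q w⁻¹ := by
  have h : starHom q Q (T q Q w) = MulOpposite.op (T q Q w⁻¹) := by
    unfold starHom T
    erw [RingQuot.liftAlgHom_mkAlgHom_apply]
    rw [FreeAlgebra.lift_ι_apply]
  rw [hstar, h, MulOpposite.unop_op]

lemma hstar_mul (x y : Hecke q Q r) : hstar q Q (x * y) = hstar q Q y * hstar q Q x := by
  rw [hstar, map_mul, MulOpposite.unop_mul]; rfl

lemma hstar_add (x y : Hecke q Q r) : hstar q Q (x + y) = hstar q Q x + hstar q Q y := by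
  rw [hstar, map_add, MulOpposite.unop_add]; rfl

lemma hstar_smul (c : R) (x : Hecke q Q r) : hstar q Q (c • x) = c • hstar q Q x := by
  rw [hstar, map_smul, MulOpposite.unop_smul]; rfl

lemma hstar_algebraMap (c : R) :
    hstar q Q (algebraMap R (Hecke q Q r) c) = algebraMap R _ c := by
  rw [hstar, AlgHom.commutes, MulOpposite.algebraMap_apply, MulOpposite.unop_op]

lemma isUnit_param (i : Fin r) : IsUnit (param q Q i) := by
  unfold param; split_ifs
  exacts [Q.isUnit, q.isUnit]

/-- The generators `T_i` are invertible. -/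
lemma isUnit_Ts (i : Fin r) : IsUnit (Ts q Q i) := by
  obtain ⟨p, hp⟩ := isUnit_param (q := q) (Q := Q) i
  have h := Ts_mul_self (q := q) (Q := Q) i
  rw [← hp] at h
  have key : Ts q Q i * ((↑p⁻¹ : R) • (Ts q Q i - algebraMap R _ ((p : R) - 1))) = 1 := by
    rw [mul_smul_comm, mul_sub, h, ← Algebra.commutes ((p : R) - 1), add_sub_cancel_right,
      Algebra.smul_def, ← map_mul, p.inv_mul, map_one]
  have key' : ((↑p⁻¹ : R) • (Ts q Q i - algebraMap R _ ((p : R) - 1))) * Ts q Q i = 1 := by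
    rw [smul_mul_assoc, sub_mul, h, add_sub_cancel_right,
      Algebra.smul_def, ← map_mul, p.inv_mul, map_one]
  exact ⟨⟨_, _, key, key'⟩, rfl⟩

lemma qlen_mul_s {w : W r} {i : Fin r} (h : Up w i) :
    qlen q Q (w * s i) = param q Q i * qlen q Q w := by
  have h1 := numZero_le_len w
  rw [qlen, qlen, len_mul_s h, numZero_eq, card_negs_mul_s h, ← numZero_eq, param]
  split_ifs
  · rw [show len w + 1 - (numZero w + 1) = len w - numZero w by omega]; ring
  · rw [show len w + 1 - (numZero w + 0) = len w - numZero w + 1 by omega]; ring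

lemma isUnit_qlen (w : W r) : IsUnit (qlen q Q w) :=
  (q.isUnit.pow _).mul (Q.isUnit.pow _)

end HeckeAlgebra

/-! ### Sign changes and Jucys–Murphy elements -/

section JucysMurphy

variable {r : ℕ}

/-- The element of `W_r` that changes the sign of `i` (for `i ≤ r`). -/
def signFlip (r i : ℕ) : W r :=
  if h : i ≤ r then
    ⟨Equiv.swap (i : ℤ) (-i), by
      refine ⟨fun k => ?_, fun k hk => ?_⟩
      · simp only [Equiv.swap_apply_def]; split_ifs <;> omega
      · have hk' : (r : ℤ) < k ∨ (r : ℤ) < -k := lt_abs.mp hk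
        simp only [Equiv.swap_apply_def]; split_ifs <;> omega⟩
  else 1

lemma signFlip_apply {i : ℕ} (h : i ≤ r) (k : ℤ) :
    (signFlip r i).1 k = if k = i then (-i : ℤ) else if k = -i then (i : ℤ) else k := by
  rw [signFlip, dif_pos h]; exact Equiv.swap_apply_def _ _ _

lemma signFlip_inv {i : ℕ} (h : i ≤ r) : (signFlip r i)⁻¹ = signFlip r i := by
  refine inv_eq_of_mul_eq_one_left (W.ext_pos fun k _ _ => ?_)
  rw [W.mul_apply, signFlip_apply h k, W.one_apply]
  split_ifs <;> rw [signFlip_apply h] <;> split_ifs <;> omega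

lemma signFlip_one (h : 0 < r) : signFlip r 1 = s ⟨0, h⟩ := by
  refine W.ext_pos fun k _ _ => ?_
  rw [signFlip_apply h, s_zero_apply rfl]; rfl

lemma signFlip_succ {i : Fin r} (h : (i : ℕ) ≠ 0) :
    signFlip r (i + 1) = s i * signFlip r i * s i := by
  have hi := i.2
  refine W.ext_pos fun k hk hk' => ?_
  rw [W.mul_apply, W.mul_apply, signFlip_apply (show (i : ℕ) + 1 ≤ r by omega), s_pos_apply h k]
  split_ifs <;> rw [signFlip_apply hi.le] <;> split_ifs <;> rw [s_pos_apply h] <;>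
    split_ifs <;> push_cast at * <;> omega

lemma s_mul_signFlip {i : ℕ} {j : Fin r} (hi : 1 ≤ i) (hi' : i ≤ r) (h1 : i ≠ j)
    (h2 : i ≠ j + 1) : s j * signFlip r i = signFlip r i * s j := by
  refine W.ext_pos fun k hk hk' => ?_
  rw [W.mul_apply, W.mul_apply, signFlip_apply hi' k]
  by_cases h : (j : ℕ) = 0
  · rw [s_zero_apply h k]
    split_ifs <;> rw [signFlip_apply hi'] <;> rw [s_zero_apply h] <;>
      first | (split_ifs <;> omega) | (norm_num; omega)
  · rw [s_pos_apply h k]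
    split_ifs <;> rw [signFlip_apply hi'] <;> rw [s_pos_apply h] <;> split_ifs <;> omega

lemma sNat_of_lt {i : ℕ} (h : i < r) : sNat r i = s ⟨i, h⟩ := dif_pos h

lemma sij_one_succ {i : ℕ} (h : 1 ≤ i) : sij r 1 (i + 1) = sij r 1 i * sNat r i := by
  obtain ⟨j, rfl⟩ : ∃ j, i = j + 1 := ⟨i - 1, by omega⟩
  rw [sij, sij, if_pos (by omega), if_pos (by omega)]
  rw [show j + 1 + 1 - 1 = j + 1 by omega, show j + 1 - 1 = j by omega, List.range'_1_concat,
    List.map_append, List.prod_append]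
  simp [add_comm]

lemma sij_succ_one {i : ℕ} (h : 1 ≤ i) : sij r (i + 1) 1 = sNat r i * sij r i 1 := by
  obtain ⟨j, rfl⟩ : ∃ j, i = j + 1 := ⟨i - 1, by omega⟩
  rw [sij, if_neg (by omega), show j + 1 + 1 - 1 = j + 1 by omega, List.range'_1_concat,
    List.reverse_append, List.map_append, List.prod_append]
  by_cases hj : j = 0
  · subst hj; simp [sij]
  · rw [sij, if_neg (by omega), show j + 1 - 1 = j by omega]
    simp [add_comm]

lemma sij_one_one : sij r 1 1 = 1 := by simp [sij]

/-- `s_{1,i}`, regarded as a permutation acting on the left, moves `i` down to `1` past the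
numbers smaller than `i`. -/
lemma sij_one_apply {i : ℕ} (hi : 1 ≤ i) (hi' : i ≤ r) (k : ℤ) (hk : 1 ≤ k) :
    (sij r 1 i).1 k = if k = i then 1 else if k < i then k + 1 else k := by
  induction i, hi using Nat.le_induction generalizing k with
  | base => rw [sij_one_one, W.one_apply]; split_ifs <;> omega
  | succ i hi ih =>
    have h0 : ((⟨i, hi'⟩ : Fin r) : ℕ) ≠ 0 := by simp; omega
    rw [sij_one_succ hi, sNat_of_lt hi', W.mul_apply, s_pos_apply h0]
    simp only
    split_ifs <;> (first | omega | (rw [ih (by omega) _ (by omega)]; split_ifs <;> omega))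

lemma sij_one_inv (i : ℕ) (hi : 1 ≤ i) (hi' : i ≤ r) : (sij r 1 i)⁻¹ = sij r i 1 := by
  induction i, hi using Nat.le_induction with
  | base => rw [sij_one_one, inv_one]
  | succ i hi ih =>
    rw [sij_one_succ hi, sij_succ_one hi, mul_inv_rev, ih (by omega), sNat_of_lt hi', s_inv]

end JucysMurphy

section JucysMurphyElements

variable {R : Type u} [CommRing R] {q Q : Rˣ} {r : ℕ}

lemma T_sij_one_succ {i : Fin r} (h : (i : ℕ) ≠ 0) :
    T q Q (sij r 1 (i + 1)) = T q Q (sij r 1 i) * Ts q Q i := by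
  have hi := i.2
  rw [sij_one_succ (by omega), sNat_of_lt i.2, T_mul_Ts]
  rw [up_pos h, sij_one_apply (by omega) hi.le _ (by omega),
    sij_one_apply (by omega) hi.le _ (by omega)]
  split_ifs <;> omega

lemma T_sij_succ_one {i : Fin r} (h : (i : ℕ) ≠ 0) :
    T q Q (sij r (i + 1) 1) = Ts q Q i * T q Q (sij r i 1) := by
  have hi := i.2
  rw [← sij_one_inv _ (by omega) (by omega), ← hstar_T, T_sij_one_succ h, hstar_mul, hstar_T,
    hstar_T, s_inv, sij_one_inv _ (by omega) (by omega)]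

lemma jm_one (h : 0 < r) : jm q Q r 1 = Ts q Q ⟨0, h⟩ := by
  rw [jm, sij_one_one, T_one, one_mul, mul_one, sNat_of_lt h]

lemma jm_succ {i : Fin r} (h : (i : ℕ) ≠ 0) :
    jm q Q r (i + 1) = Ts q Q i * jm q Q r i * Ts q Q i := by
  rw [jm, jm, T_sij_succ_one h, T_sij_one_succ h]
  simp only [mul_assoc]

/-- The Jucys–Murphy type element `T_{i,1} T_0 T_{1,i}` is the basis element of a sign change. -/
lemma jm_eq_T {i : ℕ} (hi : 1 ≤ i) (hi' : i ≤ r) : jm q Q r i = T q Q (signFlip r i) := by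
  induction i, hi using Nat.le_induction with
  | base => rw [jm_one hi', signFlip_one hi']
  | succ i hi ih =>
    have h0 : ((⟨i, hi'⟩ : Fin r) : ℕ) ≠ 0 := by simp; omega
    rw [show i + 1 = ((⟨i, hi'⟩ : Fin r) : ℕ) + 1 from rfl, jm_succ h0, signFlip_succ h0]
    have e1 : (((⟨i, hi'⟩ : Fin r) : ℕ)) = i := rfl
    have hup : Up (signFlip r i)⁻¹ ⟨i, hi'⟩ := by
      rw [signFlip_inv (by omega), up_pos h0, signFlip_apply (by omega), signFlip_apply (by omega)]
      simp only
      split_ifs <;> omega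
    rw [e1, ih (by omega), Ts_mul_T hup, T_mul_Ts]
    rw [up_pos h0, W.mul_apply, W.mul_apply, signFlip_apply (by omega), signFlip_apply (by omega)]
    simp only [if_true]
    rw [if_neg (by omega), if_neg (by omega), s_pos_apply h0, s_pos_apply h0]
    simp only
    split_ifs <;> omega

lemma Ts_commute_jm {i : ℕ} {j : Fin r} (hi : 1 ≤ i) (hi' : i ≤ r) (h1 : i ≠ j)
    (h2 : i ≠ j + 1) : Commute (Ts q Q j) (jm q Q r i) := by
  rw [jm_eq_T hi hi']
  exact Ts_commute_T (s_mul_signFlip hi hi' h1 h2)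

lemma jm_commute_of_lt {i : ℕ} (hi : 1 ≤ i) {j : ℕ} (hij : i < j) (hj : j ≤ r) :
    Commute (jm q Q r i) (jm q Q r j) := by
  induction i, hi using Nat.le_induction with
  | base =>
    rw [jm_one (show 0 < r by omega)]
    exact Ts_commute_jm (by omega) hj (by simp; omega) (by simp; omega)
  | succ i hi ih =>
    have hi' : i < r := by omega
    have h0 : ((⟨i, hi'⟩ : Fin r) : ℕ) ≠ 0 := by simp; omega
    have h1 : Commute (Ts q Q (⟨i, hi'⟩ : Fin r)) (jm q Q r j) :=
      Ts_commute_jm (by omega) hj (by simp; omega) (by simp; omega)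
    rw [show i + 1 = ((⟨i, hi'⟩ : Fin r) : ℕ) + 1 from rfl, jm_succ h0]
    exact (h1.mul_left (ih (by omega))).mul_left h1

lemma jm_commute {i j : ℕ} (hi : 1 ≤ i) (hi' : i ≤ r) (hj : 1 ≤ j) (hj' : j ≤ r) :
    Commute (jm q Q r i) (jm q Q r j) := by
  rcases lt_trichotomy i j with h | rfl | h
  · exact jm_commute_of_lt hi h hj'
  · exact Commute.refl _
  · exact (jm_commute_of_lt hj h hi').symm

lemma hstar_jm {i : ℕ} (hi : 1 ≤ i) (hi' : i ≤ r) : hstar q Q (jm q Q r i) = jm q Q r i := by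
  rw [jm_eq_T hi hi', hstar_T, signFlip_inv hi']

variable (q Q r) in
/-- The factor `κ q^{i-1} + ε T_{i,1} T_0 T_{1,i}`, which occurs in `u_a^+` (with `κ = ε = 1`) and
in `u_a^-` (with `κ = Q` and `ε = -1`). -/
def uFactor (κ ε : R) (i : ℕ) : Hecke q Q r :=
  algebraMap R _ (κ * (q : R) ^ (i - 1)) + ε • jm q Q r i

variable (q Q r) in
/-- The product of the first `a` factors `uFactor`: a common generalization of `u_a^+`
and `u_a^-`. -/
def uProd (κ ε : R) (a : ℕ) : Hecke q Q r := ((List.range' 1 a).map (uFactor q Q r κ ε)).prod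

lemma uPlus_eq (a : ℕ) : uPlus q Q r a = uProd q Q r 1 1 a := by
  rw [uPlus, uProd]
  congr 2
  funext i
  rw [uFactor, one_mul, one_smul]

lemma uMinus_eq (a : ℕ) : uMinus q Q r a = uProd q Q r (Q : R) (-1) a := by
  rw [uMinus, uProd]
  congr 2
  funext i
  rw [uFactor, neg_smul, one_smul, sub_eq_add_neg]

lemma uProd_zero (κ ε : R) : uProd q Q r κ ε 0 = 1 := by simp [uProd]

lemma uProd_succ (κ ε : R) (a : ℕ) :
    uProd q Q r κ ε (a + 1) = uProd q Q r κ ε a * uFactor q Q r κ ε (a + 1) := by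
  simp [uProd, List.range'_1_concat, add_comm]

lemma uFactor_commute {κ ε : R} {i j : ℕ} (hi : 1 ≤ i) (hi' : i ≤ r) (hj : 1 ≤ j) (hj' : j ≤ r) :
    Commute (uFactor q Q r κ ε i) (uFactor q Q r κ ε j) := by
  refine Commute.add_left (Algebra.commutes _ _) (Commute.add_right ?_ ?_)
  · exact (Algebra.commutes _ _).symm
  · exact ((jm_commute hi hi' hj hj').smul_left _).smul_right _

lemma uProd_commute_uFactor {κ ε : R} {a j : ℕ} (ha : a ≤ r) (hj : 1 ≤ j) (hj' : j ≤ r) :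
    Commute (uProd q Q r κ ε a) (uFactor q Q r κ ε j) := by
  induction a with
  | zero => rw [uProd_zero]; exact Commute.one_left _
  | succ a ih =>
    rw [uProd_succ]
    exact (ih (by omega)).mul_left (uFactor_commute (by omega) ha hj hj')

lemma hstar_uProd {κ ε : R} {a : ℕ} (ha : a ≤ r) :
    hstar q Q (uProd q Q r κ ε a) = uProd q Q r κ ε a := by
  induction a with
  | zero => rw [uProd_zero, ← T_one, hstar_T, inv_one]
  | succ a ih =>
    rw [uProd_succ, hstar_mul, ih (by omega), uFactor, hstar_add, hstar_smul,
      hstar_jm (by omega) ha, hstar_algebraMap, ← uFactor]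
    exact (uProd_commute_uFactor (by omega) (by omega) ha).eq.symm

lemma Ts_commute_uFactor {κ ε : R} {i : ℕ} {j : Fin r} (hi : 1 ≤ i) (hi' : i ≤ r) (h1 : i ≠ j)
    (h2 : i ≠ j + 1) : Commute (Ts q Q j) (uFactor q Q r κ ε i) :=
  Commute.add_right (Algebra.commute_algebraMap_right _ _)
    ((Ts_commute_jm hi hi' h1 h2).smul_right _)

lemma param_of_ne {i : Fin r} (h : (i : ℕ) ≠ 0) : param q Q i = (q : R) := if_neg h

lemma param_zero {i : Fin r} (h : (i : ℕ) = 0) : param q Q i = (Q : R) := if_pos h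

/-- `T_i` commutes with the product of the two factors it would interchange, because it commutes
with the symmetric expressions `q J_i + J_{i+1}` and `J_i J_{i+1}` in the Jucys–Murphy elements. -/
lemma Ts_commute_two_uFactor {κ ε : R} {i : Fin r} (h : (i : ℕ) ≠ 0) :
    Commute (Ts q Q i) (uFactor q Q r κ ε i * uFactor q Q r κ ε (i + 1)) := by
  have hi := i.2
  have hflip : s i * (signFlip r i * signFlip r (i + 1)) =
      signFlip r i * signFlip r (i + 1) * s i := by
    rw [signFlip_succ h]
    have e : signFlip r i * (s i * signFlip r i * s i) =
        s i * signFlip r i * s i * signFlip r i := by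
      rw [← signFlip_succ h]
      refine W.ext_pos fun k hk hk' => ?_
      have h1 : (i : ℕ) ≤ r := hi.le
      have h2 : (i : ℕ) + 1 ≤ r := hi
      rw [W.mul_apply, W.mul_apply, signFlip_apply h1 k, signFlip_apply h2 k]
      split_ifs <;> rw [signFlip_apply h1, signFlip_apply h2] <;> split_ifs <;>
        push_cast at * <;> omega
    rw [e]
    have e2 := s_mul_s i
    calc s i * (s i * signFlip r i * s i * signFlip r i)
        = (s i * s i) * signFlip r i * s i * signFlip r i := by simp only [mul_assoc]
      _ = signFlip r i * s i * signFlip r i * (s i * s i) := by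
          rw [e2, one_mul, mul_one]
      _ = _ := by rw [← e]; simp only [mul_assoc]
  have hprod : Commute (Ts q Q i) (jm q Q r i * jm q Q r (i + 1)) := by
    have e : jm q Q r i * jm q Q r (i + 1) = T q Q (signFlip r i * signFlip r (i + 1)) := by
      rw [jm_eq_T (by omega) hi.le, jm_eq_T (by omega) hi, T_mul_T]
      intro a b ha hb hab
      have h1 : (i : ℕ) ≤ r := hi.le
      have h2 : (i : ℕ) + 1 ≤ r := hi
      rw [signFlip_apply h2 a, signFlip_apply h2 b]
      intro hlt
      rw [signFlip_apply h1, signFlip_apply h1]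
      split_ifs at hlt ⊢ <;> push_cast at * <;> omega
    rw [e]
    exact Ts_commute_T hflip
  have hsum : Commute (Ts q Q i) ((q : R) • jm q Q r i + jm q Q r (i + 1)) := by
    have hq := Ts_mul_self (q := q) (Q := Q) i
    rw [param_of_ne h] at hq
    rw [Commute, SemiconjBy, jm_succ h]
    set t := Ts q Q i
    set J := jm q Q r i
    -- As `J_{i+1} = t J t`, both products are `q (t J + J t) + (q - 1) t J t`.
    have e1 : t * (t * J * t) = (q : R) • (J * t) + ((q : R) - 1) • (t * J * t) := by
      rw [show t * (t * J * t) = (t * t) * (J * t) by simp only [mul_assoc], hq, add_mul,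
        ← Algebra.smul_def, mul_assoc, mul_assoc, ← Algebra.smul_def]
    have e2 : t * J * t * t = (q : R) • (t * J) + ((q : R) - 1) • (t * J * t) := by
      rw [show t * J * t * t = (t * J) * (t * t) by simp only [mul_assoc], hq, mul_add,
        ← Algebra.commutes, ← Algebra.smul_def, ← mul_assoc, ← Algebra.commutes, mul_assoc,
        ← Algebra.smul_def]
    rw [mul_add, add_mul, e1, e2, mul_smul_comm, smul_mul_assoc]
    abel
  have hexp : uFactor q Q r κ ε i * uFactor q Q r κ ε (i + 1) =
      algebraMap R _ (κ * (q : R) ^ ((i : ℕ) - 1) * (κ * (q : R) ^ (i : ℕ))) +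
      (κ * (q : R) ^ ((i : ℕ) - 1) * ε) • ((q : R) • jm q Q r i + jm q Q r (i + 1)) +
      (ε * ε) • (jm q Q r i * jm q Q r (i + 1)) := by
    have hpow : (q : R) ^ (i : ℕ) = (q : R) ^ ((i : ℕ) - 1) * q := by
      rw [← pow_succ]; congr 1; omega
    rw [uFactor, uFactor, Nat.add_sub_cancel, hpow]
    simp only [Algebra.algebraMap_eq_smul_one, add_mul, mul_add, smul_mul_assoc, mul_smul_comm,
      one_mul, mul_one, smul_smul, smul_add]
    module
  rw [hexp]
  exact ((Algebra.commute_algebraMap_right _ _).add_right (hsum.smul_right _)).add_right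
    (hprod.smul_right _)

/-- `u_a^+` and `u_a^-` commute with all `T_j`, except for `T_0` and `T_a`. -/
lemma Ts_commute_uProd_of_lt {κ ε : R} {a : ℕ} {j : Fin r} (h : a < j) :
    Commute (Ts q Q j) (uProd q Q r κ ε a) := by
  have hj := j.2
  induction a with
  | zero => rw [uProd_zero]; exact Commute.one_right _
  | succ a ih =>
    rw [uProd_succ]
    exact (ih (by omega)).mul_right
      (Ts_commute_uFactor (by omega) (by omega) (by omega) (by omega))

lemma Ts_commute_uProd {κ ε : R} {a : ℕ} {j : Fin r} (h0 : (j : ℕ) ≠ 0) (hja : (j : ℕ) ≠ a)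
    (ha : a ≤ r) : Commute (Ts q Q j) (uProd q Q r κ ε a) := by
  by_cases h : a < j
  · exact Ts_commute_uProd_of_lt h
  have h' : (j : ℕ) + 1 ≤ a := by omega
  induction a, h' using Nat.le_induction with
  | base =>
    obtain ⟨k, hk⟩ : ∃ k, (j : ℕ) = k + 1 := ⟨j - 1, by omega⟩
    rw [uProd_succ]
    have e : uProd q Q r κ ε j = uProd q Q r κ ε k * uFactor q Q r κ ε j := by
      rw [hk, uProd_succ]
    rw [e, mul_assoc]
    exact (Ts_commute_uProd_of_lt (by omega)).mul_right (Ts_commute_two_uFactor h0)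
  | succ a h' ih =>
    rw [uProd_succ]
    exact (ih (by omega) (by omega) (by omega)).mul_right
      (Ts_commute_uFactor (by omega) ha (by omega) (by omega))

/-- The product of the factors `uFactor` with the first one split off. -/
lemma exists_uProd_eq {κ ε : R} (h : 0 < r) {a : ℕ} (ha : 1 ≤ a) (ha' : a ≤ r) :
    ∃ x, uProd q Q r κ ε a = (algebraMap R _ κ + ε • Ts q Q ⟨0, h⟩) * x ∧
      Commute (Ts q Q ⟨0, h⟩) x := by
  induction a, ha using Nat.le_induction with
  | base =>
    refine ⟨1, ?_, Commute.one_right _⟩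
    rw [uProd_succ, uProd_zero, uFactor, zero_add, jm_one h]
    simp
  | succ a ha ih =>
    obtain ⟨x, hx, hx'⟩ := ih (by omega)
    refine ⟨x * uFactor q Q r κ ε (a + 1), ?_, ?_⟩
    · rw [uProd_succ, hx, mul_assoc]
    · exact hx'.mul_right (Ts_commute_uFactor (by omega) ha' (by simp) (by simp; omega))

/-- The factor `1 + T_0` of `u_a^+` is an eigenvector of `T_0` with eigenvalue `Q`. -/
lemma uPlus_mul_Ts_zero (h : 0 < r) {a : ℕ} (ha : 1 ≤ a) (ha' : a ≤ r) :
    uPlus q Q r a * Ts q Q ⟨0, h⟩ = (Q : R) • uPlus q Q r a := by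
  obtain ⟨x, hx, hc⟩ := exists_uProd_eq (q := q) (Q := Q) (κ := (1 : R)) (ε := 1) h ha ha'
  have hq := Ts_mul_self (q := q) (Q := Q) ⟨0, h⟩
  rw [param_zero rfl] at hq
  have key : (algebraMap R (Hecke q Q r) 1 + (1 : R) • Ts q Q ⟨0, h⟩) * Ts q Q ⟨0, h⟩ =
      (Q : R) • (algebraMap R (Hecke q Q r) 1 + (1 : R) • Ts q Q ⟨0, h⟩) := by
    rw [map_one, one_smul, add_mul, one_mul, hq, ← Algebra.smul_def,
      Algebra.algebraMap_eq_smul_one]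
    module
  rw [uPlus_eq, hx, mul_assoc, ← hc.eq, ← mul_assoc, key, smul_mul_assoc]

lemma exists_uMinus_eq (h : 0 < r) {b : ℕ} (hb : 1 ≤ b) (hb' : b ≤ r) :
    ∃ x, uMinus q Q r b = (algebraMap R _ (Q : R) - Ts q Q ⟨0, h⟩) * x := by
  obtain ⟨x, hx, -⟩ := exists_uProd_eq (q := q) (Q := Q) (κ := (Q : R)) (ε := -1) h hb hb'
  refine ⟨x, ?_⟩
  rw [uMinus_eq, hx, neg_smul, one_smul, sub_eq_add_neg]

/-- The factor `Q - T_0` of `u_b^-` is an eigenvector of `T_0` with eigenvalue `-1`. -/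
lemma Ts_zero_mul_uMinus (h : 0 < r) {b : ℕ} (hb : 1 ≤ b) (hb' : b ≤ r) :
    Ts q Q ⟨0, h⟩ * uMinus q Q r b = -uMinus q Q r b := by
  obtain ⟨x, hx⟩ := exists_uMinus_eq (q := q) (Q := Q) h hb hb'
  have hq := Ts_mul_self (q := q) (Q := Q) ⟨0, h⟩
  rw [param_zero rfl] at hq
  have key : Ts q Q ⟨0, h⟩ * (algebraMap R (Hecke q Q r) (Q : R) - Ts q Q ⟨0, h⟩) =
      -(algebraMap R (Hecke q Q r) (Q : R) - Ts q Q ⟨0, h⟩) := by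
    rw [mul_sub, hq, ← Algebra.commutes, ← Algebra.smul_def, ← Algebra.smul_def,
      Algebra.algebraMap_eq_smul_one]
    module
  rw [hx, ← mul_assoc, key, neg_mul]

end JucysMurphyElements

/-! ### Leading terms of products with `u_a^+` and `u_a^-` -/

section LeadingTerm

variable {R : Type u} [CommRing R] {q Q : Rˣ} {r : ℕ}

/-- The span of the elements `m T_d` for the `d` with the property `P`. -/
def spanT (m : Hecke q Q r) (P : W r → Prop) : Submodule R (Hecke q Q r) :=
  Submodule.span R {x | ∃ d, P d ∧ x = m * T q Q d}

lemma mem_spanT {m : Hecke q Q r} {P : W r → Prop} {d : W r} (h : P d) :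
    m * T q Q d ∈ spanT m P := Submodule.subset_span ⟨d, h, rfl⟩

lemma mul_mem_of_spanT {m h x : Hecke q Q r} {P : W r → Prop} {N : Submodule R (Hecke q Q r)}
    (hN : ∀ d, P d → m * T q Q d * h ∈ N) (hx : x ∈ spanT m P) : x * h ∈ N := by
  induction hx using Submodule.span_induction with
  | mem x hx => obtain ⟨d, hd, rfl⟩ := hx; exact hN d hd
  | zero => rw [zero_mul]; exact Submodule.zero_mem _
  | add x y _ _ hx hy => rw [add_mul]; exact Submodule.add_mem _ hx hy
  | smul c x _ hx => rw [smul_mul_assoc]; exact Submodule.smul_mem _ _ hx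

lemma spanT_mono {m : Hecke q Q r} {P P' : W r → Prop} (h : ∀ d, P d → P' d) :
    spanT m P ≤ spanT m P' :=
  Submodule.span_mono fun _ ⟨d, hd, hx⟩ => ⟨d, h d hd, hx⟩

lemma mul_T_mul_Ts_mem {m : Hecke q Q r} {N : Submodule R (Hecke q Q r)} {d : W r} {i : Fin r}
    (h1 : m * T q Q (d * s i) ∈ N) (h2 : ¬ Up d i → m * T q Q d ∈ N) :
    m * T q Q d * Ts q Q i ∈ N := by
  by_cases h : Up d i
  · rwa [mul_assoc, T_mul_Ts h]
  · rw [mul_assoc, T_mul_Ts_of_not_up h, mul_add, mul_smul_comm, mul_smul_comm]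
    exact N.add_mem (N.smul_mem _ h1) (N.smul_mem _ (h2 h))

/-- The hypothesis for the extraction of leading terms below: right multiplication by
`T_0, …, T_{b-1}` acts on the elements `m T_d` with `E d` by the formulas of the regular
representation, except that `m T_d` may be an eigenvector of `T_i` (with eigenvalue `q`) if `d i`
and `d (i + 1)` have the same sign. -/
structure RegularOn (m : Hecke q Q r) (E : W r → Prop) (b : ℕ) : Prop where
  le : b ≤ r
  zero : ∀ d, E d → ∀ i : Fin r, (i : ℕ) = 0 → 1 ≤ b → E (d * s i)
  pos : ∀ d, E d → ∀ i : Fin r, (i : ℕ) ≠ 0 → (i : ℕ) < b → E (d * s i) ∨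
    (m * T q Q d * Ts q Q i = (q : R) • (m * T q Q d) ∧ (0 < d.1 i ↔ 0 < d.1 (i + 1)))

variable {m : Hecke q Q r} {E : W r → Prop} {b : ℕ}

/-- The span of the `m T_d` for the `d` that are positive on `(k, b]` but not on `[1, k]`. -/
def negSpan (m : Hecke q Q r) (E : W r → Prop) (b k : ℕ) : Submodule R (Hecke q Q r) :=
  spanT m fun d => E d ∧ (∀ p : ℤ, k < p → p ≤ b → 0 < d.1 p) ∧
    ∃ p : ℤ, 1 ≤ p ∧ p ≤ k ∧ d.1 p < 0

/-- The generators `T_1, …, T_{k-1}` permute `[1, k]`, and keep a negative entry there. -/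
lemma RegularOn.negSpan_mul_Ts (h : RegularOn m E b) {k : ℕ} {i : Fin r} (h0 : (i : ℕ) ≠ 0)
    (hi : (i : ℕ) < k) (hk : k ≤ b) {x : Hecke q Q r} (hx : x ∈ negSpan m E b k) :
    x * Ts q Q i ∈ negSpan m E b k := by
  refine mul_mem_of_spanT (fun d hd => ?_) hx
  obtain ⟨hE, h1, p, hp, hp', hneg⟩ := hd
  rcases h.pos d hE i h0 (by omega) with hE' | ⟨he, -⟩
  · refine mul_T_mul_Ts_mem (mem_spanT ⟨hE', fun p' hp1 hp2 => ?_, (s i).1 p, ?_, ?_, ?_⟩)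
      (fun _ => mem_spanT ⟨hE, h1, p, hp, hp', hneg⟩)
    · rw [W.mul_apply, s_pos_apply h0]
      split_ifs <;> first | omega | exact h1 p' hp1 hp2
    · rw [s_pos_apply h0]; split_ifs <;> omega
    · rw [s_pos_apply h0]; split_ifs <;> omega
    · rwa [W.mul_apply, s_s_apply]
  · rw [he]
    exact Submodule.smul_mem _ _ (mem_spanT ⟨hE, h1, p, hp, hp', hneg⟩)

/-- Multiplication by `T_{j,1} T_0 T_{1,j}` moves the positive entry `j` to `1`, changes its sign
and moves it back; this leaves a negative entry in `[1, k]` in every term. -/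
lemma RegularOn.mul_jm_mem (h : RegularOn m E b) {k j : ℕ} (hj : 1 ≤ j) (hjk : j ≤ k) (hk : k ≤ b)
    {x : Hecke q Q r}
    (hx : x ∈ spanT m fun d => E d ∧ (∀ p : ℤ, k < p → p ≤ b → 0 < d.1 p) ∧ 0 < d.1 j) :
    x * jm q Q r j ∈ negSpan m E b k := by
  have hbr := h.le
  induction j, hj using Nat.le_induction generalizing x with
  | base =>
    have hr : 0 < r := by omega
    rw [jm_one hr]
    refine mul_mem_of_spanT (fun d hd => ?_) hx
    obtain ⟨hE, h1, h2⟩ := hd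
    have hup : Up d ⟨0, hr⟩ := (up_zero rfl).2 h2
    rw [mul_assoc, T_mul_Ts hup]
    refine mem_spanT ⟨h.zero d hE _ rfl (by omega), fun p hp hp' => ?_, 1, le_rfl, by omega, ?_⟩
    · rw [W.mul_apply, s_zero_apply rfl, if_neg (by omega), if_neg (by omega)]
      exact h1 p hp hp'
    · rw [W.mul_apply, s_zero_apply rfl, if_pos rfl, W.map_neg]
      exact neg_neg_of_pos h2
  | succ j hj ih =>
    have hjr : j < r := by omega
    have h0 : ((⟨j, hjr⟩ : Fin r) : ℕ) ≠ 0 := by simp; omega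
    rw [show j + 1 = ((⟨j, hjr⟩ : Fin r) : ℕ) + 1 from rfl, jm_succ h0, ← mul_assoc, ← mul_assoc]
    refine h.negSpan_mul_Ts h0 hjk hk (ih (by omega) ?_)
    refine mul_mem_of_spanT (fun d hd => ?_) hx
    obtain ⟨hE, h1, h2⟩ := hd
    push_cast at h2
    rcases h.pos d hE ⟨j, hjr⟩ h0 (by simp; omega) with hE' | ⟨he, hs⟩
    · refine mul_T_mul_Ts_mem (mem_spanT ⟨hE', fun p hp hp' => ?_, ?_⟩) fun hup =>
        mem_spanT ⟨hE, h1, ?_⟩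
      · rw [W.mul_apply, s_pos_apply h0]
        simp only
        split_ifs <;> first | omega | exact h1 p hp hp'
      · rw [W.mul_apply, s_pos_apply h0]
        simp only [if_true]
        exact h2
      · rw [up_pos h0] at hup
        simp only [not_lt] at hup
        omega
    · rw [he]
      exact Submodule.smul_mem _ _ (mem_spanT ⟨hE, h1, hs.2 h2⟩)

/-- Up to elements `m T_d` with `d` not positive on `[1, k]`, right multiplication by
`uProd κ ε k` is multiplication by the constant term of that product. -/
lemma RegularOn.mul_uProd_sub_mem (h : RegularOn m E b) (κ ε : R) {k : ℕ} (hk : k ≤ b) {d : W r}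
    (hE : E d) (hpos : ∀ p : ℤ, 1 ≤ p → p ≤ b → 0 < d.1 p) :
    m * T q Q d * uProd q Q r κ ε k -
      (∏ i ∈ Finset.range k, κ * (q : R) ^ i) • (m * T q Q d) ∈ negSpan m E b k := by
  induction k with
  | zero => rw [uProd_zero]; simp
  | succ k ih =>
    have hmono : negSpan m E b k ≤ negSpan m E b (k + 1) :=
      spanT_mono fun d ⟨h1, h2, p, hp1, hp2, hp3⟩ =>
        ⟨h1, fun p hp hp' => h2 p (by push_cast at hp; omega) hp', p, hp1, by push_cast; omega, hp3⟩
    have hJ : ∀ x ∈ spanT m (fun d => E d ∧ ∀ p : ℤ, k < p → p ≤ b → 0 < d.1 p),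
        x * jm q Q r (k + 1) ∈ negSpan m E b (k + 1) := fun x hx =>
      h.mul_jm_mem (by omega) le_rfl hk (spanT_mono (fun d ⟨h1, h2⟩ =>
        ⟨h1, fun p hp hp' => h2 p (by push_cast at hp; omega) hp', h2 _ (by push_cast; omega)
          (by exact_mod_cast hk)⟩) hx)
    have ih' := ih (by omega)
    set y := m * T q Q d * uProd q Q r κ ε k -
      (∏ i ∈ Finset.range k, κ * (q : R) ^ i) • (m * T q Q d) with hy
    have e : m * T q Q d * uProd q Q r κ ε k =
        y + (∏ i ∈ Finset.range k, κ * (q : R) ^ i) • (m * T q Q d) := by rw [hy]; abel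
    rw [uProd_succ, ← mul_assoc, e, uFactor, Nat.add_sub_cancel, Finset.prod_range_succ, mul_add,
      ← Algebra.commutes, ← Algebra.smul_def, mul_smul_comm, add_mul, smul_mul_assoc]
    have h1 : y * jm q Q r (k + 1) ∈ negSpan m E b (k + 1) :=
      hJ _ (spanT_mono (fun d ⟨h1, h2, _⟩ => ⟨h1, h2⟩) ih')
    have h2 : m * T q Q d * jm q Q r (k + 1) ∈ negSpan m E b (k + 1) :=
      hJ _ (mem_spanT ⟨hE, fun p hp hp' => hpos p (by omega) hp'⟩)
    set c := ∏ i ∈ Finset.range k, κ * (q : R) ^ i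
    have e2 : (κ * (q : R) ^ k) • (y + c • (m * T q Q d)) + ε • (y * jm q Q r (k + 1) +
        c • (m * T q Q d * jm q Q r (k + 1))) - (c * (κ * (q : R) ^ k)) • (m * T q Q d) =
        (κ * (q : R) ^ k) • y + ε • (y * jm q Q r (k + 1)) +
          (ε * c) • (m * T q Q d * jm q Q r (k + 1)) := by module
    rw [e2]
    exact Submodule.add_mem _ (Submodule.add_mem _ (Submodule.smul_mem _ _ (hmono ih'))
      (Submodule.smul_mem _ _ h1)) (Submodule.smul_mem _ _ h2)

end LeadingTerm

/-! ### Young subgroups and their sums -/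

section Young

variable {r : ℕ}

/-- A labelling of `[1, r]` by the blocks of a set partition into intervals, such that no block
meets both `[1, a]` and `[a + 1, r]`. Rows of `t^λ` and columns of `t̂_λ` are encoded in this way,
by a weakly increasing function that is constant on the blocks and separates them. -/
structure BlockLabels (r a : ℕ) (lab : ℤ → ℤ) : Prop where
  le : a ≤ r
  mono : ∀ p p' : ℤ, 1 ≤ p → p ≤ p' → p' ≤ r → lab p ≤ lab p'
  sep : ∀ p p' : ℤ, 1 ≤ p → p ≤ a → a < p' → p' ≤ r → lab p ≠ lab p'

/-- Membership in the Young subgroup of the unsigned permutations that preserve all blocks. -/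
def Young (lab : ℤ → ℤ) (w : W r) : Prop :=
  ∀ p : ℤ, 1 ≤ p → p ≤ r → 0 < w.1 p ∧ lab (w.1 p) = lab p

lemma W.map_le (w : W r) {p : ℤ} (h : 1 ≤ p) (h' : p ≤ r) : w.1 p ≤ r :=
  (abs_le.1 (W.abs_map_le w (abs_le.2 ⟨by omega, h'⟩))).2

lemma W.neg_le_map (w : W r) {p : ℤ} (h : 1 ≤ p) (h' : p ≤ r) : -(r : ℤ) ≤ w.1 p :=
  (abs_le.1 (W.abs_map_le w (abs_le.2 ⟨by omega, h'⟩))).1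

lemma W.inv_pos {w : W r} (hw : ∀ p : ℤ, 1 ≤ p → p ≤ r → 0 < w.1 p) {p : ℤ} (h : 1 ≤ p)
    (h' : p ≤ r) : 0 < (w⁻¹).1 p := by
  have hb := W.neg_le_map w⁻¹ h h'
  rcases lt_trichotomy ((w⁻¹).1 p) 0 with h0 | h0 | h0
  · have := hw (-(w⁻¹).1 p) (by omega) (by omega)
    rw [W.map_neg, W.apply_inv_self] at this
    omega
  · rw [W.map_eq_zero] at h0; omega
  · exact h0

variable {lab : ℤ → ℤ}

lemma Young.one : Young lab (1 : W r) := fun p hp _ => ⟨by rw [W.one_apply]; omega, rfl⟩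

lemma Young.mul {w v : W r} (hw : Young lab w) (hv : Young lab v) : Young lab (w * v) := by
  intro p hp hp'
  obtain ⟨h1, h2⟩ := hv p hp hp'
  obtain ⟨h3, h4⟩ := hw (v.1 p) (by omega) (W.map_le v hp hp')
  exact ⟨h3, h4.trans h2⟩

lemma Young.inv {w : W r} (hw : Young lab w) : Young lab w⁻¹ := by
  intro p hp hp'
  have h := W.inv_pos (fun p h h' => (hw p h h').1) hp hp'
  refine ⟨h, ?_⟩
  have := (hw ((w⁻¹).1 p) (by omega) (W.map_le _ hp hp')).2
  rw [W.apply_inv_self] at this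
  exact this.symm

lemma young_inv_iff {w : W r} : Young lab w⁻¹ ↔ Young lab w :=
  ⟨fun h => by have := h.inv; rwa [inv_inv] at this, Young.inv⟩

lemma young_s {i : Fin r} (h0 : (i : ℕ) ≠ 0) (h : lab i = lab (i + 1)) : Young lab (s i) := by
  intro p hp hp'
  rw [s_pos_apply h0]
  split_ifs with h1 h2
  · subst h1; exact ⟨by omega, h.symm⟩
  · subst h2; exact ⟨by omega, h⟩
  · omega
  · omega
  · exact ⟨by omega, rfl⟩

lemma young_s_iff {i : Fin r} : Young lab (s i) ↔ (i : ℕ) ≠ 0 ∧ lab i = lab (i + 1) := by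
  have hi := i.2
  refine ⟨fun h => ?_, fun h => young_s h.1 h.2⟩
  have h0 : (i : ℕ) ≠ 0 := by
    intro h0
    have := (h 1 le_rfl (by omega)).1
    rw [s_zero_apply h0] at this
    simp at this
  have := (h i (by omega) (by omega)).2
  rw [s_pos_apply h0, if_pos rfl] at this
  exact ⟨h0, this.symm⟩

lemma mul_s_young_iff {w : W r} {i : Fin r} (h : Young lab (s i)) :
    Young lab (w * s i) ↔ Young lab w :=
  ⟨fun h' => by have := h'.mul h; rwa [mul_s_s] at this, fun h' => h'.mul h⟩

variable {a : ℕ}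

lemma Young.s_of_not_up (hl : BlockLabels r a lab) {w : W r} (hw : Young lab w) {i : Fin r}
    (h : ¬ Up w i) : Young lab (s i) := by
  have hi := i.2
  by_cases h0 : (i : ℕ) = 0
  · rw [up_zero h0] at h
    exact absurd (hw 1 le_rfl (by omega)).1 h
  refine young_s h0 ?_
  rw [up_pos h0, not_lt] at h
  obtain ⟨h1, h2⟩ := hw i (by omega) (by omega)
  obtain ⟨h3, h4⟩ := hw (i + 1) (by omega) (by omega)
  have h5 := hl.mono _ _ (by omega) h (W.map_le w (by omega) (by omega))
  have h6 := hl.mono i (i + 1) (by omega) (by omega) (by omega)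
  omega

/-- Induction over a Young subgroup, along ascents inside the subgroup. -/
lemma Young.induction (hl : BlockLabels r a lab) {P : W r → Prop} (one : P 1)
    (mul : ∀ w i, Young lab w → Young lab (s i) → Up w i → P w → P (w * s i)) {w : W r}
    (hw : Young lab w) : P w := by
  induction w using up_induction with
  | one => exact one
  | mul w i hup ih =>
    have hs : Young lab (s i) := hw.s_of_not_up hl (not_up.not.1 (not_not.2 hup))
    have hw' := (mul_s_young_iff hs).1 hw
    exact mul w i hw' hs hup (ih hw')

lemma BlockLabels.ne_of_young (hl : BlockLabels r a lab) {i : Fin r} (h : Young lab (s i)) :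
    (i : ℕ) ≠ a := by
  rintro rfl
  have hi := i.2
  obtain ⟨h0, h1⟩ := young_s_iff.1 h
  exact hl.sep _ _ (by omega) le_rfl (by omega) (by omega) h1

/-- An element of the Young subgroup inverts only pairs inside a block, up to signs. -/
lemma Young.lt_of_lt (hl : BlockLabels r a lab) {v : W r} (hv : Young lab v) {p p' : ℤ}
    (hp : 1 ≤ p) (h : p < p') (hp' : p' ≤ r) (hne : lab p ≠ lab p') : v.1 p < v.1 p' := by
  obtain ⟨h1, h2⟩ := hv p hp (by omega)
  obtain ⟨h3, h4⟩ := hv p' (by omega) hp'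
  by_contra hcon
  have := hl.mono _ _ (by omega) (not_lt.1 hcon) (W.map_le v hp (by omega))
  have := hl.mono p p' hp h.le hp'
  omega

end Young

section YoungSums

variable {R : Type u} [CommRing R] {q Q : Rˣ} {r : ℕ} {lab : ℤ → ℤ} {a : ℕ}

open Classical in
variable (q Q r) in
/-- The sum `∑ ρ ^ ℓ(w) T_w` over a Young subgroup. -/
def youngSum (lab : ℤ → ℤ) (ρ : R) : Hecke q Q r :=
  ∑ w : W r with Young lab w, ρ ^ len w • T q Q w

lemma hstar_sum {ι : Type*} (t : Finset ι) (f : ι → Hecke q Q r) :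
    hstar q Q (∑ i ∈ t, f i) = ∑ i ∈ t, hstar q Q (f i) := by
  classical
  induction t using Finset.induction_on with
  | empty =>
    rw [Finset.sum_empty, Finset.sum_empty, ← map_zero (algebraMap R _), hstar_algebraMap]
  | insert i t hi ih => rw [Finset.sum_insert hi, Finset.sum_insert hi, hstar_add, ih]

lemma hstar_youngSum (ρ : R) : hstar q Q (youngSum q Q r lab ρ) = youngSum q Q r lab ρ := by
  classical
  rw [youngSum, hstar_sum]
  refine Finset.sum_bij' (fun w _ => w⁻¹) (fun w _ => w⁻¹) ?_ ?_ ?_ ?_ ?_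
  · intro w hw; simpa [young_inv_iff] using hw
  · intro w hw; simpa [young_inv_iff] using hw
  · intro w _; exact inv_inv w
  · intro w _; exact inv_inv w
  · intro w _; rw [hstar_smul, hstar_T, len_inv]

/-- The sum over a Young subgroup is a multiple of the sum over the subgroup `{1, s_i}`. -/
lemma exists_youngSum_eq (ρ : R) {i : Fin r} (hi : Young lab (s i)) :
    ∃ z, youngSum q Q r lab ρ = z * (1 + ρ • Ts q Q i) := by
  classical
  refine ⟨∑ w : W r with Young lab w ∧ Up w i, ρ ^ len w • T q Q w, ?_⟩
  have e : youngSum q Q r lab ρ = ∑ w : W r with Young lab w ∧ Up w i, ρ ^ len w • T q Q w +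
      ∑ w : W r with Young lab w ∧ ¬ Up w i, ρ ^ len w • T q Q w := by
    rw [youngSum, ← Finset.filter_filter, ← Finset.filter_filter,
      Finset.sum_filter_add_sum_filter_not]
  rw [e, mul_add, mul_one, Finset.sum_mul]
  congr 1
  refine Finset.sum_bij' (fun w _ => w * s i) (fun w _ => w * s i) ?_ ?_ ?_ ?_ ?_
  · intro w hw
    rw [Finset.mem_filter] at hw ⊢
    exact ⟨Finset.mem_univ _, hw.2.1.mul hi, not_up.1 hw.2.2⟩
  · intro w hw
    rw [Finset.mem_filter] at hw ⊢
    exact ⟨Finset.mem_univ _, hw.2.1.mul hi, not_up.not.1 (not_not.2 hw.2.2)⟩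
  · intro w _; exact mul_s_s w i
  · intro w _; exact mul_s_s w i
  · intro w hw
    rw [Finset.mem_filter] at hw
    have hup := not_up.1 hw.2.2
    rw [mul_smul_comm, smul_mul_assoc, T_mul_Ts hup, mul_s_s, len_mul_s_of_not_up hw.2.2,
      pow_succ, smul_smul, mul_comm]

lemma exists_youngSum_eq' (ρ : R) {i : Fin r} (hi : Young lab (s i)) :
    ∃ z, youngSum q Q r lab ρ = (1 + ρ • Ts q Q i) * z := by
  obtain ⟨z, hz⟩ := exists_youngSum_eq (q := q) (Q := Q) ρ hi
  refine ⟨hstar q Q z, ?_⟩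
  rw [← hstar_youngSum, hz, hstar_mul, hstar_add, hstar_smul, hstar_T, s_inv, ← T_one, hstar_T,
    inv_one]

/-- The sum over a Young subgroup spans a trivial representation of that subgroup. -/
lemma youngSum_one_mul_Ts {i : Fin r} (hi : Young lab (s i)) :
    youngSum q Q r lab 1 * Ts q Q i = (q : R) • youngSum q Q r lab 1 := by
  obtain ⟨z, hz⟩ := exists_youngSum_eq (q := q) (Q := Q) (1 : R) hi
  have hq := Ts_mul_self (q := q) (Q := Q) i
  rw [param_of_ne (young_s_iff.1 hi).1] at hq
  rw [hz, mul_assoc, one_smul, add_mul, one_mul, hq, ← mul_smul_comm, ← Algebra.smul_def,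
    Algebra.algebraMap_eq_smul_one]
  congr 1
  module

/-- The sum with weights `(-q)^{-ℓ(w)}` spans a sign representation of the Young subgroup. -/
lemma Ts_mul_youngSum_neg {i : Fin r} (hi : Young lab (s i)) :
    Ts q Q i * youngSum q Q r lab ((-q)⁻¹ : Rˣ) = -youngSum q Q r lab ((-q)⁻¹ : Rˣ) := by
  obtain ⟨z, hz⟩ := exists_youngSum_eq' (q := q) (Q := Q) (((-q)⁻¹ : Rˣ) : R) hi
  have hq := Ts_mul_self (q := q) (Q := Q) i
  rw [param_of_ne (young_s_iff.1 hi).1] at hq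
  have e : (((-q)⁻¹ : Rˣ) : R) * (q : R) = -1 := by
    have := (-q).inv_mul
    rw [Units.val_neg, mul_neg] at this
    rw [← this, neg_neg]
  rw [hz, ← mul_assoc, ← neg_mul]
  congr 1
  rw [mul_add, mul_one, mul_smul_comm, hq, ← Algebra.smul_def, Algebra.algebraMap_eq_smul_one,
    smul_add, smul_smul, smul_smul, mul_sub, mul_one, e]
  module

lemma T_mul_youngSum_neg (hl : BlockLabels r a lab) {w : W r} (hw : Young lab w) :
    ∃ c : R, T q Q w * youngSum q Q r lab ((-q)⁻¹ : Rˣ) =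
      c • youngSum q Q r lab ((-q)⁻¹ : Rˣ) := by
  refine Young.induction hl (P := fun w => ∃ c : R, T q Q w * youngSum q Q r lab ((-q)⁻¹ : Rˣ) =
    c • youngSum q Q r lab ((-q)⁻¹ : Rˣ)) ?_ (fun w i _ hs hup ih => ?_) hw
  · exact ⟨1, by rw [T_one, one_mul, one_smul]⟩
  · obtain ⟨c, hc⟩ := ih
    exact ⟨-c, by rw [← T_mul_Ts hup, mul_assoc, Ts_mul_youngSum_neg hs, mul_neg, hc, neg_smul]⟩

lemma T_commute_uProd (hl : BlockLabels r a lab) {κ ε : R} {w : W r} (hw : Young lab w) :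
    Commute (T q Q w) (uProd q Q r κ ε a) := by
  refine Young.induction hl (P := fun w => Commute (T q Q w) (uProd q Q r κ ε a)) ?_
    (fun w i _ hs hup ih => ?_) hw
  · rw [T_one]; exact Commute.one_left _
  · rw [← T_mul_Ts hup]
    exact ih.mul_left (Ts_commute_uProd (young_s_iff.1 hs).1 (hl.ne_of_young hs) hl.le)

lemma youngSum_commute_uProd (hl : BlockLabels r a lab) {κ ε ρ : R} :
    Commute (youngSum q Q r lab ρ) (uProd q Q r κ ε a) := by
  classical
  refine Commute.sum_left _ _ _ fun w hw => ?_
  exact (T_commute_uProd hl (Finset.mem_filter.1 hw).2).smul_left _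

end YoungSums

/-! ### Row standard tableaux -/

section RowStandard

variable {r : ℕ} {lab : ℤ → ℤ} {a : ℕ}

/-- The tableau `t^λ d` is row standard, in terms of the labelling of `[1, r]` by the rows of
`t^λ`: inside a row, larger positions carry larger entries, and the entries at the positions
`1, …, a` are positive. The entry of `t^λ d` at the position of `p` in `t^λ` is `d⁻¹ p`, so that
`d k` is the position of the entry `k`. -/
def RowStd (lab : ℤ → ℤ) (a : ℕ) (d : W r) : Prop :=
  (∀ p p' : ℤ, 1 ≤ p → p < p' → p' ≤ r → lab p = lab p' → (d⁻¹).1 p < (d⁻¹).1 p') ∧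
  ∀ p : ℤ, 1 ≤ p → p ≤ a → 0 < (d⁻¹).1 p

lemma mul_s_inv_apply (d : W r) (i : Fin r) (p : ℤ) :
    ((d * s i)⁻¹).1 p = (s i).1 ((d⁻¹).1 p) := by
  rw [mul_inv_rev, s_inv, W.mul_apply]

lemma W.inv_ne_zero (d : W r) {p : ℤ} (h : 1 ≤ p) : (d⁻¹).1 p ≠ 0 := by
  rw [Ne, W.map_eq_zero]; omega

lemma W.eq_of_inv_apply {d : W r} {p k : ℤ} (h : (d⁻¹).1 p = k) : d.1 k = p := by
  rw [← h, W.apply_inv_self]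

lemma s_pos_iff {i : Fin r} (h0 : (i : ℕ) ≠ 0) (k : ℤ) : 0 < (s i).1 k ↔ 0 < k := by
  rw [s_pos_apply h0]; split_ifs <;> omega

/-- If `t^λ d` is row standard and `t^λ d s_i` is not, where `i ≥ 1`, then `i` and `i + 1` are
adjacent entries of a row of `t^λ d`, up to a common sign. -/
lemma RowStd.exists_of_not (hl : BlockLabels r a lab) {d : W r} (hd : RowStd lab a d) {i : Fin r}
    (h0 : (i : ℕ) ≠ 0) (h : ¬ RowStd lab a (d * s i)) :
    ∃ j : Fin r, Young lab (s j) ∧ (d⁻¹).1 j < (d⁻¹).1 (j + 1) ∧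
      ((d.1 i = j ∧ d.1 (i + 1) = j + 1) ∨ (d.1 i = -(j + 1) ∧ d.1 (i + 1) = -j)) := by
  have hpos : ∀ p : ℤ, 1 ≤ p → p ≤ a → 0 < ((d * s i)⁻¹).1 p := by
    intro p hp hp'
    rw [mul_s_inv_apply, s_pos_iff h0]
    exact hd.2 p hp hp'
  have h1 : ∃ p p' : ℤ, 1 ≤ p ∧ p < p' ∧ p' ≤ r ∧ lab p = lab p' ∧
      ((d * s i)⁻¹).1 p' ≤ ((d * s i)⁻¹).1 p := by
    by_contra hcon
    push Not at hcon
    exact h ⟨fun p p' h1 h2 h3 h4 => hcon p p' h1 h2 h3 h4, hpos⟩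
  obtain ⟨p, p', hp, hlt, hp', hlab, hle⟩ := h1
  have hdlt := hd.1 p p' hp hlt hp' hlab
  rw [mul_s_inv_apply, mul_s_inv_apply] at hle
  have hlt' : (s i).1 ((d⁻¹).1 p') < (s i).1 ((d⁻¹).1 p) :=
    lt_of_le_of_ne hle fun h' => hdlt.ne' ((s i).1.injective h')
  have hrev := s_reverses (W.inv_ne_zero d hp) (W.inv_ne_zero d (by omega)) hdlt hlt'
  rw [lo_pos h0, hi] at hrev
  -- A row is an interval along which the entries increase, so nothing fits between the two.
  have hadj : p' = p + 1 := by
    by_contra hne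
    have hm1 := hl.mono p (p + 1) hp (by omega) (by omega)
    have hm2 := hl.mono (p + 1) p' (by omega) (by omega) hp'
    have h2 := hd.1 p (p + 1) hp (by omega) (by omega) (by omega)
    have h3 := hd.1 (p + 1) p' (by omega) (by omega) hp' (by omega)
    omega
  obtain ⟨j, rfl⟩ : ∃ j : ℕ, p = j := ⟨p.toNat, by omega⟩
  subst hadj
  have hj : j < r := by omega
  refine ⟨⟨j, hj⟩, young_s (by simp; omega) hlab, hdlt, ?_⟩
  rcases hrev with ⟨h1, h2⟩ | ⟨h1, h2⟩
  · exact Or.inl ⟨W.eq_of_inv_apply h1, W.eq_of_inv_apply h2⟩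
  · refine Or.inr ⟨?_, ?_⟩
    · rw [← W.eq_of_inv_apply h2, W.map_neg, neg_neg]
    · rw [← W.eq_of_inv_apply h1, W.map_neg, neg_neg]

/-- If `t^λ d` is row standard and `t^λ d s_0` is not, then the entry `1` is in the first
component. -/
lemma RowStd.one_of_not {d : W r} (hd : RowStd lab a d) {i : Fin r}
    (h0 : (i : ℕ) = 0) (h : ¬ RowStd lab a (d * s i)) : 0 < d.1 1 ∧ d.1 1 ≤ a := by
  have hrow : ∀ p p' : ℤ, 1 ≤ p → p < p' → p' ≤ r → lab p = lab p' →
      ((d * s i)⁻¹).1 p < ((d * s i)⁻¹).1 p' := by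
    intro p p' hp hlt hp' hlab
    have hdlt := hd.1 p p' hp hlt hp' hlab
    rw [mul_s_inv_apply, mul_s_inv_apply]
    by_contra hcon
    have hlt' : (s i).1 ((d⁻¹).1 p') < (s i).1 ((d⁻¹).1 p) :=
      lt_of_le_of_ne (not_lt.1 hcon) fun h' => hdlt.ne' ((s i).1.injective h')
    have hrev := s_reverses (W.inv_ne_zero d hp) (W.inv_ne_zero d (by omega)) hdlt hlt'
    rw [lo_zero h0, hi, h0] at hrev
    have h1 : (d⁻¹).1 p = -1 ∧ (d⁻¹).1 p' = 1 := by
      simp only [Nat.cast_zero, zero_add, neg_neg] at hrev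
      rcases hrev with h | h <;> exact h
    have h2 := W.eq_of_inv_apply h1.1
    rw [W.map_neg, W.eq_of_inv_apply h1.2] at h2
    omega
  have h1 : ∃ p : ℤ, 1 ≤ p ∧ p ≤ a ∧ ((d * s i)⁻¹).1 p ≤ 0 := by
    by_contra hcon
    push Not at hcon
    exact h ⟨hrow, fun p h1 h2 => hcon p h1 h2⟩
  obtain ⟨p, hp, hp', hle⟩ := h1
  have hpos := hd.2 p hp hp'
  have h2 : (d⁻¹).1 p = 1 := by
    rw [mul_s_inv_apply, s_zero_apply h0] at hle
    split_ifs at hle <;> omega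
  rw [W.eq_of_inv_apply h2]
  omega

/-- Representatives of row standard tableaux are determined by their coset. -/
lemma RowStd.eq_one_of_mul (hl : BlockLabels r a lab) {v d : W r} (hv : Young lab v)
    (hd : RowStd lab a d) (hvd : RowStd lab a (v * d)) : v = 1 := by
  refine eq_one_of_forall_up fun i => ?_
  by_contra hup
  have hi := i.2
  obtain ⟨h0, h1⟩ := young_s_iff.1 (hv.s_of_not_up hl hup)
  have hup' := hup
  rw [up_pos h0, not_lt] at hup'
  have hne : v.1 (i + 1) ≠ v.1 i := fun h => by have := v.1.injective h; omega
  obtain ⟨h2, h3⟩ := hv i (by omega) (by omega)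
  obtain ⟨h4, h5⟩ := hv (i + 1) (by omega) (by omega)
  have h6 := hvd.1 (v.1 (i + 1)) (v.1 i) (by omega) (lt_of_le_of_ne hup' hne)
    (W.map_le v (by omega) (by omega)) (by rw [h3, h5, h1])
  rw [mul_inv_rev, W.mul_apply, W.mul_apply, W.inv_apply_self, W.inv_apply_self] at h6
  have h7 := hd.1 i (i + 1) (by omega) (by omega) (by omega) h1
  omega

end RowStandard

/-! ### Bitabloids and their bilinear form -/

section Bitabloids

variable {R : Type u} [CommRing R] {q Q : Rˣ} {r : ℕ} {lab : ℤ → ℤ} {a : ℕ}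

/-- Lengths add for a row standard tableau and a permutation of its rows: the element `d` of
`t^λ d` is the distinguished representative of its coset of the row stabilizer. -/
lemma T_young_mul_T (hl : BlockLabels r a lab) {v d : W r} (hv : Young lab v)
    (hd : RowStd lab a d) : T q Q v * T q Q d = T q Q (v * d) := by
  refine T_mul_T fun x y hx hy hxy hlt => ?_
  have hx0 : d.1 x ≠ 0 := fun h => hx ((W.map_eq_zero d).1 h)
  have hy0 : d.1 y ≠ 0 := fun h => hy ((W.map_eq_zero d).1 h)
  have hvs : ∀ k : ℤ, k < 0 → v.1 k < 0 := by
    intro k hk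
    by_cases hk' : -(r : ℤ) ≤ k
    · have := (hv (-k) (by omega) (by omega)).1
      rw [W.map_neg] at this
      omega
    · rwa [v.2.2 k (by rw [lt_abs]; omega)]
  have hvp : ∀ k : ℤ, 0 < k → 0 < v.1 k := by
    intro k hk
    have := hvs (-k) (by omega)
    rw [W.map_neg] at this
    omega
  -- `v` reverses the order of two positive numbers only inside a block, where `d⁻¹` increases.
  have key : ∀ p p' x y : ℤ, (d⁻¹).1 p = x → (d⁻¹).1 p' = y → 0 < p → p < p' → y < x →
      v.1 p < v.1 p' := by
    intro p p' x y hx hy hp hpp hyx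
    by_cases hp' : p' ≤ r
    · refine hv.lt_of_lt hl hp hpp hp' fun hlab => ?_
      have := hd.1 p p' hp hpp hp' hlab
      omega
    · rw [v.2.2 p' (by rw [lt_abs]; omega)]
      by_cases hpr : p ≤ r
      · have := W.map_le v hp hpr
        omega
      · rwa [v.2.2 p (by rw [lt_abs]; omega)]
  rcases lt_or_gt_of_ne hy0 with hyn | hyp
  · rcases lt_or_gt_of_ne hx0 with hxn | hxp
    · have := key (-d.1 x) (-d.1 y) (-x) (-y) (by rw [W.map_neg, W.inv_apply_self])
        (by rw [W.map_neg, W.inv_apply_self]) (by omega) (by omega) (by omega)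
      rw [W.map_neg, W.map_neg] at this
      omega
    · exact (hvs _ hyn).trans (hvp _ hxp)
  · exact key (d.1 y) (d.1 x) y x (by simp) (by simp) hyp hlt hxy

variable (q Q r) in
/-- The element `u_a^+ x` that generates the module `M^λ`, where `x` is the sum over the Young
subgroup of the rows. -/
def rowElt (lab : ℤ → ℤ) (a : ℕ) : Hecke q Q r := uPlus q Q r a * youngSum q Q r lab 1

lemma rowElt_eq (hl : BlockLabels r a lab) :
    rowElt q Q r lab a = youngSum q Q r lab 1 * uPlus q Q r a := by
  rw [rowElt, uPlus_eq]
  exact (youngSum_commute_uProd hl).eq.symm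

/-- The action of `T_i`, `i ≥ 1`, on a bitabloid with `i` and `i + 1` in the same row. -/
lemma RowStd.mul_Ts (hl : BlockLabels r a lab) {d : W r} (hd : RowStd lab a d) {i : Fin r}
    (h0 : (i : ℕ) ≠ 0) (h : ¬ RowStd lab a (d * s i)) :
    rowElt q Q r lab a * T q Q d * Ts q Q i = (q : R) • (rowElt q Q r lab a * T q Q d) := by
  obtain ⟨j, hj, hlt, hij⟩ := hd.exists_of_not hl h0 h
  have hj0 := (young_s_iff.1 hj).1
  have hup : Up d i := by rw [up_pos h0]; omega
  have hup' : Up d⁻¹ j := by rw [up_pos hj0]; exact hlt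
  -- Up to signs `d` takes `{i, i + 1}` to `{j, j + 1}`, so that `T_i` may be moved past `T_d`.
  have hconj : d * s i = s j * d := by
    have hsj : ∀ k : ℤ, (s j).1 k = if k = j then (j + 1 : ℤ) else if k = j + 1 then (j : ℤ)
      else if k = -j then (-j - 1 : ℤ) else if k = -j - 1 then (-j : ℤ) else k :=
      s_pos_apply hj0
    refine W.ext_pos fun k hk hk' => ?_
    rw [W.mul_apply, W.mul_apply, s_pos_apply h0]
    have hinj : ∀ {x y : ℤ}, d.1 x = d.1 y → x = y := fun h => d.1.injective h
    split_ifs with h1 h2 h3 h4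
    · subst h1; rw [hsj]; split_ifs <;> omega
    · subst h2; rw [hsj]; split_ifs <;> omega
    · omega
    · omega
    · have e1 : d.1 k ≠ d.1 i := fun h => h1 (hinj h)
      have e2 : d.1 k ≠ d.1 (i + 1) := fun h => h2 (hinj h)
      have e3 : d.1 k ≠ - d.1 i := fun h => h3 (hinj (by rw [h, W.map_neg]))
      have e4 : d.1 k ≠ - d.1 (i + 1) := fun h => h4 (hinj (by
        rw [h, ← W.map_neg]; congr 1; ring))
      rw [hsj]; split_ifs <;> omega
  rw [mul_assoc, T_mul_Ts hup, hconj, ← Ts_mul_T hup', rowElt, mul_assoc (uPlus q Q r a),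
    ← mul_assoc (youngSum q Q r lab 1), youngSum_one_mul_Ts hj, smul_mul_assoc, mul_smul_comm,
    mul_assoc]

lemma T_sij_commute_uProd {κ ε : R} {k : ℕ} (hk : 1 ≤ k) (hka : k ≤ a) (ha : a ≤ r) :
    Commute (T q Q (sij r k 1)) (uProd q Q r κ ε a) := by
  induction k, hk using Nat.le_induction with
  | base => rw [sij_one_one, T_one]; exact Commute.one_left _
  | succ k hk ih =>
    have hkr : k < r := by omega
    have h0 : ((⟨k, hkr⟩ : Fin r) : ℕ) ≠ 0 := by simp; omega
    rw [show k + 1 = ((⟨k, hkr⟩ : Fin r) : ℕ) + 1 from rfl, T_sij_succ_one h0]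
    exact (Ts_commute_uProd h0 (by simp; omega) ha).mul_left (ih (by omega))

/-- The action of `T_0` on a bitabloid with `1` in the first component. -/
lemma RowStd.mul_Ts_zero (hl : BlockLabels r a lab) {d : W r} (hd : RowStd lab a d) {i : Fin r}
    (h0 : (i : ℕ) = 0) (h : ¬ RowStd lab a (d * s i)) :
    rowElt q Q r lab a * T q Q d * Ts q Q i = (Q : R) • (rowElt q Q r lab a * T q Q d) := by
  obtain ⟨h1, h2⟩ := hd.one_of_not h0 h
  have har := hl.le
  have hi : i = ⟨0, by have := i.2; omega⟩ := Fin.ext h0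
  obtain ⟨k, hk⟩ : ∃ k : ℕ, d.1 1 = k := ⟨(d.1 1).toNat, by omega⟩
  have hk1 : 1 ≤ k := by omega
  have hka : k ≤ a := by omega
  -- Split off the cycle that moves the entry `1` to the first position.
  set c := sij r 1 k with hc
  have hcapp : ∀ x : ℤ, 1 ≤ x → c.1 x = if x = k then 1 else if x < k then x + 1 else x :=
    sij_one_apply hk1 (by omega)
  set g := sij r k 1 with hg
  have hgc : g = c⁻¹ := (sij_one_inv k hk1 (by omega)).symm
  have hd' : d = g * (c * d) := by rw [hgc, inv_mul_cancel_left]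
  have hfac : T q Q g * T q Q (c * d) = T q Q d := by
    conv_rhs => rw [hd']
    refine T_mul_T fun x y hx hy hxy hlt => ?_
    have e : ∀ z, g.1 ((c * d).1 z) = d.1 z := by
      intro z; rw [← W.mul_apply, ← hd']
    rw [e, e]
    rw [W.mul_apply, W.mul_apply] at hlt
    by_contra hcon
    have hne : d.1 x ≠ d.1 y := fun h => hxy.ne (d.1.injective h)
    have hlt2 : d.1 x < d.1 y := by omega
    have hx0 : d.1 x ≠ 0 := fun h => hx ((W.map_eq_zero d).1 h)
    have hy0 : d.1 y ≠ 0 := fun h => hy ((W.map_eq_zero d).1 h)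
    have hcneg : ∀ z : ℤ, z < 0 →
        c.1 z = -(if -z = k then 1 else if -z < k then -z + 1 else -z) := by
      intro z hz
      rw [← hcapp (-z) (by omega), W.map_neg, neg_neg]
    have hinv : ∀ z m : ℤ, d.1 z = m → (d⁻¹).1 m = z := by rintro z m rfl; simp
    have hinj : ∀ {x y : ℤ}, d.1 x = d.1 y → x = y := fun h => d.1.injective h
    rcases lt_or_gt_of_ne hx0 with hxn | hxp
    · rcases lt_or_gt_of_ne hy0 with hyn | hyp
      · rw [hcneg _ hxn, hcneg _ hyn] at hlt
        have h3 : -d.1 x = k := by split_ifs at hlt <;> omega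
        have h4 : x = -1 := hinj (by rw [W.map_neg, hk]; omega)
        have h5 := hd.2 (-d.1 y) (by omega) (by omega)
        rw [W.map_neg, W.inv_apply_self] at h5
        omega
      · rw [hcneg _ hxn, hcapp _ (by omega)] at hlt
        split_ifs at hlt <;> omega
    · rw [hcapp _ (by omega), hcapp _ (by omega)] at hlt
      have h3 : d.1 y = k := by split_ifs at hlt <;> omega
      have h4 : y = 1 := hinj (by rw [hk, h3])
      have h5 := hd.2 (d.1 x) (by omega) (by omega)
      rw [W.inv_apply_self] at h5
      omega
  have hfix : (c * d).1 1 = 1 := by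
    rw [W.mul_apply, hk, hcapp _ (by omega), if_pos rfl]
  -- As `c d` fixes `1`, it commutes with `s_0`; this moves `T_0` next to `u_a^+`.
  have hcomm : s i * (c * d) = c * d * s i := by
    refine W.ext_pos fun x hx hx' => ?_
    rw [W.mul_apply (s i), W.mul_apply _ (s i), s_zero_apply h0, s_zero_apply h0]
    have hinj : ∀ {x y : ℤ}, (c * d).1 x = (c * d).1 y → x = y := fun h => (c * d).1.injective h
    by_cases hx1 : x = 1
    · subst hx1; rw [hfix, if_pos rfl, W.map_neg, hfix]
    · rw [if_neg fun h => hx1 (hinj (h.trans hfix.symm)), if_neg hx1, if_neg, if_neg (by omega)]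
      intro h
      have := hinj (h.trans (by rw [W.map_neg, hfix] : (-1 : ℤ) = (c * d).1 (-1)))
      omega
  have hcommT := Ts_commute_T (q := q) (Q := Q) hcomm
  have hgu : Commute (T q Q g) (uPlus q Q r a) := by
    rw [uPlus_eq]; exact T_sij_commute_uProd hk1 hka har
  have hu : uPlus q Q r a * Ts q Q i = (Q : R) • uPlus q Q r a := by
    rw [hi]; exact uPlus_mul_Ts_zero _ (by omega) har
  rw [rowElt_eq hl, ← hfac]
  calc youngSum q Q r lab 1 * uPlus q Q r a * (T q Q g * T q Q (c * d)) * Ts q Q i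
      = youngSum q Q r lab 1 * ((uPlus q Q r a * T q Q g) * (T q Q (c * d) * Ts q Q i)) := by
        simp only [mul_assoc]
    _ = youngSum q Q r lab 1 * (T q Q g * (uPlus q Q r a * Ts q Q i) * T q Q (c * d)) := by
        rw [← hgu.eq, ← hcommT.eq]; simp only [mul_assoc]
    _ = (Q : R) • (youngSum q Q r lab 1 * ((T q Q g * uPlus q Q r a) * T q Q (c * d))) := by
        rw [hu, mul_smul_comm, smul_mul_assoc, mul_smul_comm]
    _ = _ := by rw [hgu.eq]; simp only [mul_assoc]

/-- A bitabloid is an eigenvector of `T_i` whenever `s_i` does not take it to another one. -/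
lemma RowStd.mul_Ts_of_not (hl : BlockLabels r a lab) {d : W r} (hd : RowStd lab a d) {i : Fin r}
    (h : ¬ RowStd lab a (d * s i)) :
    rowElt q Q r lab a * T q Q d * Ts q Q i = param q Q i • (rowElt q Q r lab a * T q Q d) := by
  by_cases h0 : (i : ℕ) = 0
  · rw [param_zero h0]; exact hd.mul_Ts_zero hl h0 h
  · rw [param_of_ne h0]; exact hd.mul_Ts hl h0 h

/-- The bitabloids span the right ideal generated by `rowElt`. -/
lemma rowElt_mul_mem (hl : BlockLabels r a lab) (h : Hecke q Q r) :
    rowElt q Q r lab a * h ∈ spanT (rowElt q Q r lab a) (RowStd lab a) := by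
  have h1 : RowStd lab a (1 : W r) :=
    ⟨fun p p' _ h _ _ => by rw [inv_one, W.one_apply, W.one_apply]; exact h,
      fun p h _ => by rw [inv_one, W.one_apply]; omega⟩
  refine mul_mem_of_Ts (fun x hx i => mul_mem_of_spanT (fun d hd => ?_) hx) h _ ?_
  · by_cases hs : RowStd lab a (d * s i)
    · exact mul_T_mul_Ts_mem (mem_spanT hs) fun _ => mem_spanT hd
    · rw [hd.mul_Ts_of_not hl hs]
      exact Submodule.smul_mem _ _ (mem_spanT hd)
  · have := mem_spanT (q := q) (Q := Q) (m := rowElt q Q r lab a) h1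
    rwa [T_one, mul_one] at this

variable (q) in
/-- The constant term of `u_a^+`. -/
def kap (a : ℕ) : Rˣ := ∏ i ∈ Finset.range a, q ^ i

lemma kap_val (a : ℕ) : ((kap q a : Rˣ) : R) = ∏ i ∈ Finset.range a, 1 * (q : R) ^ i := by
  simp [kap]

open Classical in
/-- Among the basis elements whose inverses are positive on `[1, a]`, multiplication by `u_a^+` only
sees the constant term. -/
lemma coeffs_uPlus_mul_T (ha : a ≤ r) {x d : W r} (hx : ∀ p : ℤ, 1 ≤ p → p ≤ a → 0 < (x⁻¹).1 p)
    (hd : ∀ p : ℤ, 1 ≤ p → p ≤ a → 0 < (d⁻¹).1 p) :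
    coeffs q Q (uPlus q Q r a * T q Q x) d = if x = d then ((kap q a : Rˣ) : R) else 0 := by
  classical
  -- Apply the leading term lemma to the regular representation, on the other side via `hstar`.
  have hreg : RegularOn (1 : Hecke q Q r) (fun _ => True) a :=
    ⟨ha, fun _ _ _ _ _ => trivial, fun _ _ _ _ _ => Or.inl trivial⟩
  have key := hreg.mul_uProd_sub_mem 1 1 le_rfl (d := x⁻¹) trivial hx
  have hzero : ∀ y ∈ negSpan (1 : Hecke q Q r) (fun _ => True) a a,
      coeffs q Q (hstar q Q y) d = 0 := by
    intro y hy
    induction hy using Submodule.span_induction with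
    | mem y hy =>
      obtain ⟨e, ⟨-, -, p, hp, hp', hneg⟩, rfl⟩ := hy
      rw [one_mul, hstar_T, coeffs_T, Finsupp.single_apply, if_neg]
      rintro rfl
      have := hd p hp hp'
      rw [inv_inv] at this
      omega
    | zero => rw [← map_zero (algebraMap R _), hstar_algebraMap, map_zero, map_zero]; rfl
    | add y z _ _ hy hz => rw [hstar_add, map_add, Finsupp.add_apply, hy, hz, add_zero]
    | smul c y _ hy => rw [hstar_smul, map_smul, Finsupp.smul_apply, hy, smul_zero]
  have h0 := hzero _ key
  have e : hstar q Q (1 * T q Q x⁻¹ * uProd q Q r 1 1 a -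
      (∏ i ∈ Finset.range a, 1 * (q : R) ^ i) • (1 * T q Q x⁻¹)) =
      uPlus q Q r a * T q Q x - ((kap q a : Rˣ) : R) • T q Q x := by
    rw [sub_eq_add_neg, ← neg_smul, hstar_add, hstar_smul, one_mul, hstar_mul, hstar_T, inv_inv,
      hstar_uProd ha, uPlus_eq, kap_val, neg_smul, ← sub_eq_add_neg]
  rw [e, map_sub, map_smul, coeffs_T, Finsupp.sub_apply, Finsupp.smul_apply, sub_eq_zero] at h0
  rw [h0, Finsupp.single_apply]
  split_ifs <;> simp

open Classical in
/-- The coefficients of the `T_e` with `e` row standard distinguish the bitabloids, so these are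
linearly independent. -/
lemma coeffs_rowElt_mul_T (hl : BlockLabels r a lab) {d e : W r} (hd : RowStd lab a d)
    (he : RowStd lab a e) : coeffs q Q (rowElt q Q r lab a * T q Q d) e =
      if d = e then ((kap q a : Rˣ) : R) else 0 := by
  classical
  have har := hl.le
  have e1 : rowElt q Q r lab a * T q Q d =
      ∑ v : W r with Young lab v, uPlus q Q r a * T q Q (v * d) := by
    rw [rowElt, mul_assoc, youngSum, Finset.sum_mul, Finset.mul_sum]
    refine Finset.sum_congr rfl fun v hv => ?_
    rw [one_pow, one_smul, T_young_mul_T hl (Finset.mem_filter.1 hv).2 hd]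
  have hgood : ∀ v : W r, Young lab v → ∀ p : ℤ, 1 ≤ p → p ≤ a → 0 < ((v * d)⁻¹).1 p := by
    intro v hv p hp hp'
    rw [mul_inv_rev, W.mul_apply]
    obtain ⟨h1, h2⟩ := hv.inv p hp (by omega)
    refine hd.2 _ (by omega) ?_
    by_contra hcon
    exact hl.sep p _ hp hp' (not_le.1 hcon) (W.map_le _ hp (by omega)) h2.symm
  rw [e1, map_sum, Finsupp.finsetSum_apply]
  rw [Finset.sum_congr rfl fun v hv =>
    coeffs_uPlus_mul_T (q := q) (Q := Q) har (hgood v (Finset.mem_filter.1 hv).2) he.2]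
  split_ifs with h
  · subst h
    rw [Finset.sum_eq_single 1]
    · rw [one_mul, if_pos rfl]
    · intro v _ hv
      rw [if_neg]
      intro h
      exact hv (mul_eq_right.1 h)
    · intro h
      exact absurd (Finset.mem_filter.2 ⟨Finset.mem_univ _, Young.one⟩) h
  · refine Finset.sum_eq_zero fun v hv => if_neg ?_
    intro hve
    have := RowStd.eq_one_of_mul hl (Finset.mem_filter.1 hv).2 hd (hve ▸ he)
    rw [this, one_mul] at hve
    exact h hve

open Classical in
variable (q Q r) in
/-- The bilinear form on the right ideal `M^λ` for which the bitabloids are orthogonal with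
`⟨m T_d, m T_d⟩ = q_d`, extended to the Hecke algebra by means of the coefficients of the `T_d`
for the row standard `d`. -/
def rowForm (lab : ℤ → ℤ) (a : ℕ) : LinearMap.BilinForm R (Hecke q Q r) :=
  ∑ d : W r with RowStd lab a d,
    (qlen q Q d * (((kap q a)⁻¹ * (kap q a)⁻¹ : Rˣ) : R)) •
      (LinearMap.mul R R).compl₁₂ ((Finsupp.lapply d).comp (coeffs q Q))
        ((Finsupp.lapply d).comp (coeffs q Q))

open Classical in
lemma rowForm_apply (x y : Hecke q Q r) : rowForm q Q r lab a x y =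
    ∑ d : W r with RowStd lab a d, (qlen q Q d * (((kap q a)⁻¹ * (kap q a)⁻¹ : Rˣ) : R)) *
      (coeffs q Q x d * coeffs q Q y d) := by
  simp [rowForm, LinearMap.sum_apply]

lemma rowForm_symm (x y : Hecke q Q r) : rowForm q Q r lab a x y = rowForm q Q r lab a y x := by
  rw [rowForm_apply, rowForm_apply]
  exact Finset.sum_congr rfl fun d _ => by rw [mul_comm (coeffs q Q x d)]

/-- The normalizing factor in `rowForm` cancels the square of the constant term of `u_a^+`. -/
lemma rowForm_right (hl : BlockLabels r a lab) (x : Hecke q Q r) {e : W r}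
    (he : RowStd lab a e) : rowForm q Q r lab a x (rowElt q Q r lab a * T q Q e) =
      qlen q Q e * (((kap q a)⁻¹ : Rˣ) : R) * coeffs q Q x e := by
  classical
  rw [rowForm_apply, Finset.sum_eq_single e]
  · rw [coeffs_rowElt_mul_T hl he he, if_pos rfl, Units.val_mul]
    have : (((kap q a)⁻¹ : Rˣ) : R) * ((kap q a : Rˣ) : R) = 1 := Units.inv_mul _
    linear_combination (qlen q Q e * (((kap q a)⁻¹ : Rˣ) : R) * coeffs q Q x e) * this
  · intro d hd hde
    rw [coeffs_rowElt_mul_T hl he (Finset.mem_filter.1 hd).2, if_neg (Ne.symm hde), mul_zero,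
      mul_zero]
  · intro h
    exact absurd (Finset.mem_filter.2 ⟨Finset.mem_univ _, he⟩) h

open Classical in
lemma rowForm_bitabloids (hl : BlockLabels r a lab) {d e : W r} (hd : RowStd lab a d)
    (he : RowStd lab a e) : rowForm q Q r lab a (rowElt q Q r lab a * T q Q d)
      (rowElt q Q r lab a * T q Q e) = if d = e then qlen q Q d else 0 := by
  rw [rowForm_right hl _ he, coeffs_rowElt_mul_T hl hd he]
  split_ifs with h
  · rw [h, mul_assoc, Units.inv_mul, mul_one]
  · rw [mul_zero]

/-- The form is nondegenerate on the right ideal generated by `rowElt`. -/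
lemma eq_zero_of_rowForm (hl : BlockLabels r a lab) {x : Hecke q Q r}
    (hx : x ∈ spanT (rowElt q Q r lab a) (RowStd lab a))
    (h : ∀ d, RowStd lab a d → rowForm q Q r lab a x (rowElt q Q r lab a * T q Q d) = 0) :
    x = 0 := by
  classical
  -- The coefficients of the `T_d` give the expansion of `x` in bitabloids.
  have hexp : x = ∑ d : W r with RowStd lab a d,
      ((((kap q a)⁻¹ : Rˣ) : R) * coeffs q Q x d) • (rowElt q Q r lab a * T q Q d) := by
    clear h
    induction hx using Submodule.span_induction with
    | mem x hx =>
      obtain ⟨e, he, rfl⟩ := hx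
      rw [Finset.sum_eq_single e]
      · rw [coeffs_rowElt_mul_T hl he he, if_pos rfl, Units.inv_mul, one_smul]
      · intro d hd hde
        rw [coeffs_rowElt_mul_T hl he (Finset.mem_filter.1 hd).2, if_neg (Ne.symm hde), mul_zero,
          zero_smul]
      · intro h
        exact absurd (Finset.mem_filter.2 ⟨Finset.mem_univ _, he⟩) h
    | zero => simp
    | add x y _ _ hx hy =>
      conv_lhs => rw [hx, hy]
      rw [← Finset.sum_add_distrib]
      refine Finset.sum_congr rfl fun d _ => ?_
      rw [map_add, Finsupp.add_apply, mul_add, add_smul]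
    | smul c x _ hx =>
      conv_lhs => rw [hx]
      rw [Finset.smul_sum]
      refine Finset.sum_congr rfl fun d _ => ?_
      rw [map_smul, Finsupp.smul_apply, smul_smul, smul_eq_mul]
      ring_nf
  rw [hexp]
  refine Finset.sum_eq_zero fun d hd => ?_
  have h1 := h d (Finset.mem_filter.1 hd).2
  rw [rowForm_right hl _ (Finset.mem_filter.1 hd).2] at h1
  have h2 : coeffs q Q x d = 0 := by
    have hu : IsUnit (qlen q Q d * (((kap q a)⁻¹ : Rˣ) : R)) :=
      (isUnit_qlen d).mul (Units.isUnit _)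
    exact (hu.mul_right_eq_zero).1 h1
  rw [h2, mul_zero, zero_smul]

lemma rowForm_bitabloids_mul_Ts_of_not (hl : BlockLabels r a lab) {d e : W r}
    (hd : RowStd lab a d) (he : RowStd lab a e) {i : Fin r} (hds : ¬ RowStd lab a (d * s i)) :
    rowForm q Q r lab a (rowElt q Q r lab a * T q Q d * Ts q Q i)
      (rowElt q Q r lab a * T q Q e) = rowForm q Q r lab a (rowElt q Q r lab a * T q Q d)
      (rowElt q Q r lab a * T q Q e * Ts q Q i) := by
  classical
  rw [hd.mul_Ts_of_not hl hds]
  by_cases hes : RowStd lab a (e * s i)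
  · have h1 : d ≠ e := by rintro rfl; exact hds hes
    have h2 : d ≠ e * s i := by rintro rfl; rw [mul_s_s] at hds; exact hds he
    rw [map_smul, LinearMap.smul_apply, rowForm_bitabloids hl hd he, if_neg h1, smul_zero,
      mul_assoc (rowElt q Q r lab a)]
    by_cases hup : Up e i
    · rw [T_mul_Ts hup, rowForm_bitabloids hl hd hes, if_neg h2]
    · rw [T_mul_Ts_of_not_up hup, mul_add, mul_smul_comm, mul_smul_comm, map_add, map_smul,
        map_smul, rowForm_bitabloids hl hd hes, rowForm_bitabloids hl hd he, if_neg h1, if_neg h2,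
        smul_zero, smul_zero, add_zero]
  · rw [he.mul_Ts_of_not hl hes, map_smul, LinearMap.smul_apply, map_smul]

lemma rowForm_bitabloids_mul_Ts_of_up (hl : BlockLabels r a lab) {d e : W r}
    (hd : RowStd lab a d) (he : RowStd lab a e) {i : Fin r} (hds : RowStd lab a (d * s i))
    (hes : RowStd lab a (e * s i)) (hup : Up d i) :
    rowForm q Q r lab a (rowElt q Q r lab a * T q Q d * Ts q Q i)
      (rowElt q Q r lab a * T q Q e) = rowForm q Q r lab a (rowElt q Q r lab a * T q Q d)
      (rowElt q Q r lab a * T q Q e * Ts q Q i) := by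
  classical
  rw [mul_assoc, T_mul_Ts hup, rowForm_bitabloids hl hds he, mul_assoc (rowElt q Q r lab a)]
  by_cases hue : Up e i
  · have h1 : d * s i ≠ e := by rintro rfl; exact not_up.not.1 (not_not.2 hup) hue
    have h2 : d ≠ e * s i := by rintro rfl; rw [mul_s_s] at h1; exact h1 rfl
    rw [T_mul_Ts hue, rowForm_bitabloids hl hd hes, if_neg h1, if_neg h2]
  · have h3 : d ≠ e := by rintro rfl; exact hue hup
    rw [T_mul_Ts_of_not_up hue, mul_add, mul_smul_comm, mul_smul_comm, map_add, map_smul,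
      map_smul, rowForm_bitabloids hl hd hes, rowForm_bitabloids hl hd he, if_neg h3,
      smul_zero, add_zero]
    by_cases h1 : d * s i = e
    · subst h1
      rw [if_pos rfl, mul_s_s, if_pos rfl, qlen_mul_s hup, smul_eq_mul]
    · rw [if_neg h1, if_neg, smul_zero]
      rintro rfl
      rw [mul_s_s] at h1
      exact h1 rfl

/-- The operators `T_i` are self-adjoint. -/
lemma rowForm_mul_Ts (hl : BlockLabels r a lab) (i : Fin r) {x y : Hecke q Q r}
    (hx : x ∈ spanT (rowElt q Q r lab a) (RowStd lab a))
    (hy : y ∈ spanT (rowElt q Q r lab a) (RowStd lab a)) :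
    rowForm q Q r lab a (x * Ts q Q i) y = rowForm q Q r lab a x (y * Ts q Q i) := by
  classical
  induction hx using Submodule.span_induction with
  | zero => simp
  | add x x' _ _ h h' => simp only [add_mul, map_add, LinearMap.add_apply, h, h']
  | smul c x _ h => simp only [smul_mul_assoc, map_smul, LinearMap.smul_apply, h]
  | mem x hx =>
    obtain ⟨d, hd, rfl⟩ := hx
    induction hy using Submodule.span_induction with
    | zero => simp
    | add y y' _ _ h h' => simp only [add_mul, map_add, h, h']
    | smul c y _ h => simp only [smul_mul_assoc, map_smul, h]
    | mem y hy =>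
      obtain ⟨e, he, rfl⟩ := hy
      by_cases hds : RowStd lab a (d * s i)
      · by_cases hes : RowStd lab a (e * s i)
        · by_cases hup : Up d i
          · exact rowForm_bitabloids_mul_Ts_of_up hl hd he hds hes hup
          · by_cases hue : Up e i
            · exact (rowForm_symm _ _).trans
                ((rowForm_bitabloids_mul_Ts_of_up hl he hd hes hds hue).symm.trans
                  (rowForm_symm _ _))
            -- Two descents: both sides are `(q_i - 1) ⟨m T_d, m T_e⟩`.
            · have h1 : d * s i ≠ e := by rintro rfl; exact hue (not_up.1 hup)
              have h2 : d ≠ e * s i := by rintro rfl; rw [mul_s_s] at h1; exact h1 rfl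
              rw [mul_assoc, T_mul_Ts_of_not_up hup, mul_assoc (rowElt q Q r lab a),
                T_mul_Ts_of_not_up hue]
              simp only [mul_add, mul_smul_comm, map_add, map_smul, LinearMap.add_apply,
                LinearMap.smul_apply, rowForm_bitabloids hl hd hes, rowForm_bitabloids hl hd he,
                rowForm_bitabloids hl hds he, if_neg h1, if_neg h2]
        · exact (rowForm_symm _ _).trans
            ((rowForm_bitabloids_mul_Ts_of_not hl he hd hes).symm.trans (rowForm_symm _ _))
      · exact rowForm_bitabloids_mul_Ts_of_not hl hd he hds

end Bitabloids

/-! ### The form and the Hecke algebra -/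

section Adjoint

variable {R : Type u} [CommRing R] {q Q : Rˣ} {r : ℕ} {lab : ℤ → ℤ} {a : ℕ}

lemma spanT_mul_mem (hl : BlockLabels r a lab) {x : Hecke q Q r} (h : Hecke q Q r)
    (hx : x ∈ spanT (rowElt q Q r lab a) (RowStd lab a)) :
    x * h ∈ spanT (rowElt q Q r lab a) (RowStd lab a) :=
  mul_mem_of_spanT (fun d _ => by rw [mul_assoc]; exact rowElt_mul_mem hl _) hx

/-- Right multiplication by `h` is adjoint to right multiplication by `hstar h`. -/
lemma rowForm_mul (hl : BlockLabels r a lab) (h : Hecke q Q r) : ∀ {x y : Hecke q Q r},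
    x ∈ spanT (rowElt q Q r lab a) (RowStd lab a) →
    y ∈ spanT (rowElt q Q r lab a) (RowStd lab a) →
    rowForm q Q r lab a (x * h) y = rowForm q Q r lab a x (y * hstar q Q h) := by
  induction h using Hecke.induction with
  | scalar c =>
    intro x y _ _
    rw [hstar_algebraMap, ← Algebra.commutes, ← Algebra.commutes, ← Algebra.smul_def,
      ← Algebra.smul_def, map_smul, map_smul, LinearMap.smul_apply]
  | gen i =>
    intro x y hx hy
    rw [hstar_T, s_inv]
    exact rowForm_mul_Ts hl i hx hy
  | add h h' ih ih' =>
    intro x y hx hy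
    rw [mul_add, hstar_add, mul_add, map_add, map_add, LinearMap.add_apply, ih hx hy, ih' hx hy]
  | mul h h' ih ih' =>
    intro x y hx hy
    rw [← mul_assoc, ih' (spanT_mul_mem hl h hx) hy, ih hx (spanT_mul_mem hl _ hy), hstar_mul,
      mul_assoc]

end Adjoint

/-! ### Row elements times column elements -/

section WeylGenerator

variable {R : Type u} [CommRing R] {q Q : Rˣ} {r : ℕ} {lab : ℤ → ℤ} {a : ℕ}

/-- Vanishing of `m T_d u` may be checked after a generator commuting with `u` is applied to `d`. -/
lemma mul_T_mul_eq_zero_of_commute {m u : Hecke q Q r} {d : W r} {i : Fin r}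
    (hc : Commute (Ts q Q i) u) (h : m * T q Q (d * s i) * u = 0) : m * T q Q d * u = 0 := by
  by_cases hup : Up d i
  · have h1 : m * T q Q d * u * Ts q Q i = 0 := by
      rw [mul_assoc _ u, ← hc.eq, ← mul_assoc, mul_assoc m, T_mul_Ts hup, h]
    exact ((isUnit_Ts i).mul_left_eq_zero).1 h1
  · have h1 := T_mul_Ts (q := q) (Q := Q) (not_up.1 hup)
    rw [mul_s_s] at h1
    rw [← h1, ← mul_assoc, mul_assoc _ _ u, hc.eq, ← mul_assoc, h, zero_mul]

/-- Vanishing of `m T_d y` may be checked after a generator that negates `y` is applied to `d`. -/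
lemma mul_T_mul_eq_zero_of_neg {m y : Hecke q Q r} {d : W r} {i : Fin r}
    (hy : Ts q Q i * y = -y) (h : m * T q Q (d * s i) * y = 0) : m * T q Q d * y = 0 := by
  by_cases hup : Up d i
  · rw [← T_mul_Ts hup, ← mul_assoc, mul_assoc _ _ y, hy, mul_neg, neg_eq_zero] at h
    exact h
  · have h1 := T_mul_Ts (q := q) (Q := Q) (not_up.1 hup)
    rw [mul_s_s] at h1
    rw [← h1, ← mul_assoc, mul_assoc _ _ y, hy, mul_neg, h, neg_zero]

/-- `u_b^-` kills every bitabloid with one of the entries `1, …, b` in the first component. -/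
lemma RowStd.mul_uMinus_eq_zero (hl : BlockLabels r a lab) {b : ℕ} (hb : b ≤ r) {k : ℕ}
    (hk : 1 ≤ k) (hkb : k ≤ b) {d : W r} (hd : RowStd lab a d) (h1 : 0 < d.1 k)
    (h2 : d.1 k ≤ a) : rowElt q Q r lab a * T q Q d * uMinus q Q r b = 0 := by
  have har := hl.le
  induction k, hk using Nat.le_induction generalizing d with
  -- The bitabloid is an eigenvector of `T_0` with eigenvalue `Q`, killed by `Q - T_0`.
  | base =>
    have hr : 0 < r := by omega
    have hs : ¬ RowStd lab a (d * s ⟨0, hr⟩) := by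
      intro h
      have := h.2 (d.1 1) (by exact_mod_cast h1) (by exact_mod_cast h2)
      rw [mul_s_inv_apply, W.inv_apply_self, s_zero_apply rfl, if_pos rfl] at this
      omega
    obtain ⟨x, hx⟩ := exists_uMinus_eq (q := q) (Q := Q) hr hkb hb
    rw [hx, ← mul_assoc, mul_sub, hd.mul_Ts_zero hl rfl hs, ← Algebra.commutes,
      ← Algebra.smul_def, sub_self, zero_mul]
  | succ k hk ih =>
    have hkr : k < r := by omega
    have h0 : ((⟨k, hkr⟩ : Fin r) : ℕ) ≠ 0 := by simp; omega
    -- Unless the entry `k` is in the first component too, swap `k` and `k + 1`: the generator `T_k`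
    -- commutes with `u_b^-`.
    by_cases hcase : 0 < d.1 k ∧ d.1 k ≤ a
    · exact ih (by omega) hd hcase.1 hcase.2
    have hs : RowStd lab a (d * s ⟨k, hkr⟩) := by
      by_contra hs
      obtain ⟨j, hj, -, hij⟩ := hd.exists_of_not hl h0 hs
      have hj0 := (young_s_iff.1 hj).1
      simp only at hij
      push_cast at h1 h2
      omega
    refine mul_T_mul_eq_zero_of_commute (i := ⟨k, hkr⟩) ?_ (ih (by omega) hs ?_ ?_)
    · rw [uMinus_eq]
      exact Ts_commute_uProd h0 (by simp; omega) hb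
    · rw [W.mul_apply, s_pos_apply h0, if_pos rfl]; exact_mod_cast h1
    · rw [W.mul_apply, s_pos_apply h0, if_pos rfl]; exact_mod_cast h2

/-- The row standard tableaux with only positive entries, and with `1, …, b` in the second
component. -/
def PosStd (lab : ℤ → ℤ) (a b : ℕ) (d : W r) : Prop :=
  RowStd lab a d ∧ ∀ p : ℤ, 1 ≤ p → p ≤ b → a < d.1 p

/-- By counting, the entries `1, …, b = r - a` fill the second component. -/
lemma PosStd.exists_eq {b : ℕ} (hab : a + b = r) {d : W r} (hd : PosStd lab a b d) {p : ℤ}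
    (hp : a < p) (hp' : p ≤ r) : ∃ k : ℤ, 1 ≤ k ∧ k ≤ b ∧ d.1 k = p := by
  have himg : (Finset.Icc (1 : ℤ) b).image d.1 = Finset.Icc (a + 1 : ℤ) r := by
    refine Finset.eq_of_subset_of_card_le (fun x hx => ?_) ?_
    · obtain ⟨k, hk, rfl⟩ := Finset.mem_image.1 hx
      rw [Finset.mem_Icc] at hk ⊢
      have h1 := hd.2 k hk.1 hk.2
      exact ⟨by omega, W.map_le d hk.1 (by omega)⟩
    · rw [Finset.card_image_of_injective _ d.1.injective]
      simp only [Int.card_Icc]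
      omega
  have : p ∈ (Finset.Icc (1 : ℤ) b).image d.1 := by
    rw [himg, Finset.mem_Icc]; omega
  obtain ⟨k, hk, rfl⟩ := Finset.mem_image.1 this
  rw [Finset.mem_Icc] at hk
  exact ⟨k, hk.1, hk.2, rfl⟩

lemma PosStd.inv_pos {b : ℕ} (hab : a + b = r) {d : W r} (hd : PosStd lab a b d) {p : ℤ}
    (hp : 1 ≤ p) (hp' : p ≤ r) : 0 < (d⁻¹).1 p := by
  by_cases hpa : p ≤ a
  · exact hd.1.2 p hp hpa
  · obtain ⟨k, hk, -, rfl⟩ := hd.exists_eq hab (not_le.1 hpa) hp'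
    rw [W.inv_apply_self]; omega

lemma PosStd.pos {b : ℕ} (hab : a + b = r) {d : W r} (hd : PosStd lab a b d) {p : ℤ}
    (hp : 1 ≤ p) (hp' : p ≤ r) : 0 < d.1 p := by
  have := W.inv_pos (w := d⁻¹) (fun p h h' => hd.inv_pos hab h h') hp hp'
  rwa [inv_inv] at this

lemma spanT_posStd_mul_Ts (hl : BlockLabels r a lab) {b : ℕ} {i : Fin r} (h0 : (i : ℕ) ≠ 0)
    (hib : (i : ℕ) < b) {x : Hecke q Q r}
    (hx : x ∈ spanT (rowElt q Q r lab a) (PosStd lab a b)) :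
    x * Ts q Q i ∈ spanT (rowElt q Q r lab a) (PosStd lab a b) := by
  refine mul_mem_of_spanT (fun d hd => ?_) hx
  by_cases hs : RowStd lab a (d * s i)
  · refine mul_T_mul_Ts_mem (mem_spanT ⟨hs, fun p hp hp' => ?_⟩) fun _ => mem_spanT hd
    rw [W.mul_apply]
    refine hd.2 _ ?_ ?_ <;> rw [s_pos_apply h0] <;> split_ifs <;> omega
  · rw [hd.1.mul_Ts_of_not hl hs]
    exact Submodule.smul_mem _ _ (mem_spanT hd)

/-- Multiplication by `u_b^-` makes all signs irrelevant: `M^λ u_b^-` is spanned by the multiples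
of the bitabloids with only positive entries and with `1, …, b` in the second component. -/
lemma RowStd.exists_mul_uMinus_eq (hl : BlockLabels r a lab) {b : ℕ} (hb : b ≤ r) {d : W r}
    (hd : RowStd lab a d) : ∃ y ∈ spanT (rowElt q Q r lab a) (PosStd lab a b),
      rowElt q Q r lab a * T q Q d * uMinus q Q r b = y * uMinus q Q r b := by
  induction hn : len d using Nat.strong_induction_on generalizing d with
  | _ n ih =>
  -- Move a negative entry down to `1`, where `T_0 u_b^- = -u_b^-` removes the sign; each step
  -- makes `d` shorter.
  have hneg : ∀ k : ℕ, 1 ≤ k → k ≤ b → d.1 k < 0 →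
      ∃ y ∈ spanT (rowElt q Q r lab a) (PosStd lab a b),
        rowElt q Q r lab a * T q Q d * uMinus q Q r b = y * uMinus q Q r b := by
    intro k hk
    induction k, hk using Nat.le_induction with
    | base =>
      intro h1b hd1
      have hr : 0 < r := by omega
      have hup : ¬ Up d ⟨0, hr⟩ := by rw [up_zero rfl]; push_cast at hd1; omega
      have hs : RowStd lab a (d * s ⟨0, hr⟩) := by
        by_contra hs
        have := hd.one_of_not rfl hs
        push_cast at hd1
        omega
      obtain ⟨y, hy, e⟩ := ih _ (by have := len_mul_s_of_not_up hup; omega) hs rfl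
      refine ⟨-y, Submodule.neg_mem _ hy, ?_⟩
      have h1 := T_mul_Ts (q := q) (Q := Q) (not_up.1 hup)
      rw [mul_s_s] at h1
      rw [← h1, ← mul_assoc, mul_assoc _ _ (uMinus q Q r b), Ts_zero_mul_uMinus hr h1b hb,
        mul_neg, e, neg_mul]
    | succ k hk ihk =>
      intro hkb hdk
      by_cases hk0 : d.1 k < 0
      · exact ihk (by omega) hk0
      have hkr : k < r := by omega
      have h0 : ((⟨k, hkr⟩ : Fin r) : ℕ) ≠ 0 := by simp; omega
      have hne : d.1 k ≠ 0 := by rw [Ne, W.map_eq_zero]; omega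
      have hup : ¬ Up d ⟨k, hkr⟩ := by
        rw [up_pos h0]; push_cast at hdk; simp only; omega
      have hs : RowStd lab a (d * s ⟨k, hkr⟩) := by
        by_contra hs
        obtain ⟨j, hj, -, hij⟩ := hd.exists_of_not hl h0 hs
        have hj0 := (young_s_iff.1 hj).1
        simp only at hij
        push_cast at hdk
        omega
      obtain ⟨y, hy, e⟩ := ih _ (by have := len_mul_s_of_not_up hup; omega) hs rfl
      refine ⟨y * Ts q Q ⟨k, hkr⟩, spanT_posStd_mul_Ts hl h0 (by simp; omega) hy, ?_⟩
      have h1 := T_mul_Ts (q := q) (Q := Q) (not_up.1 hup)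
      rw [mul_s_s] at h1
      have hc : Commute (Ts q Q ⟨k, hkr⟩) (uMinus q Q r b) := by
        rw [uMinus_eq]
        exact Ts_commute_uProd h0 (by simp; omega) hb
      rw [← h1, ← mul_assoc, mul_assoc _ _ (uMinus q Q r b), hc.eq, ← mul_assoc, e, mul_assoc,
        mul_assoc, hc.eq]
  by_cases hsmall : ∃ k : ℕ, 1 ≤ k ∧ k ≤ b ∧ 0 < d.1 k ∧ d.1 k ≤ a
  · obtain ⟨k, hk, hkb, h1, h2⟩ := hsmall
    exact ⟨0, Submodule.zero_mem _, by
      rw [hd.mul_uMinus_eq_zero hl hb hk hkb h1 h2, zero_mul]⟩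
  by_cases hex : ∃ k : ℕ, 1 ≤ k ∧ k ≤ b ∧ d.1 k < 0
  · obtain ⟨k, hk, hkb, h1⟩ := hex
    exact hneg k hk hkb h1
  · push Not at hsmall hex
    refine ⟨_, mem_spanT ⟨hd, fun p hp hp' => ?_⟩, rfl⟩
    obtain ⟨k, rfl⟩ : ∃ k : ℕ, p = k := ⟨p.toNat, by omega⟩
    have h1 := hex k (by omega) (by omega)
    have hne : d.1 k ≠ 0 := by rw [Ne, W.map_eq_zero]; omega
    exact hsmall k (by omega) (by omega) (by omega)

variable {clab : ℤ → ℤ} {b : ℕ}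

/-- The alternating sum over a column stabilizer kills each bitabloid that has two entries of a
column in the same row. -/
lemma RowStd.mul_youngSum_eq_zero (hl : BlockLabels r a lab) (hcl : BlockLabels r b clab)
    {p p' : ℕ} (hp : 1 ≤ p) (hlt : p < p') (hp' : p' ≤ r) (hclab : clab p = clab p')
    {d : W r} (hd : RowStd lab a d) (h1 : 0 < d.1 p) (h2 : 0 < d.1 p')
    (hlab : lab (d.1 p) = lab (d.1 p')) :
    rowElt q Q r lab a * T q Q d * youngSum q Q r clab ((-q)⁻¹ : Rˣ) = 0 := by
  induction hn : p' - p using Nat.strong_induction_on generalizing p p' d with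
  | _ n ih =>
  obtain ⟨i, rfl⟩ : ∃ i, p' = i + 1 := ⟨p' - 1, by omega⟩
  have hir : i < r := by omega
  have h0 : ((⟨i, hir⟩ : Fin r) : ℕ) ≠ 0 := by simp; omega
  have hci : clab i = clab (i + 1) := by
    have e1 := hcl.mono p i (by omega) (by omega) (by omega)
    have e2 := hcl.mono i (i + 1) (by omega) (by omega) (by omega)
    push_cast at hclab
    omega
  have hy : Young clab (s ⟨i, hir⟩) := young_s h0 hci
  push_cast at h2 hlab
  by_cases hcase : 0 < d.1 i ∧ lab (d.1 i) = lab (d.1 (i + 1))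
  · -- `i` and `i + 1` lie in the same row and in the same column
    have hs : ¬ RowStd lab a (d * s ⟨i, hir⟩) := by
      intro hs
      have hne : d.1 i ≠ d.1 (i + 1) := fun h => by have := d.1.injective h; omega
      have hle : d.1 (i + 1) ≤ r := W.map_le d (by omega) (by omega)
      have hle' : d.1 i ≤ r := W.map_le d (by omega) (by omega)
      have hlt' : d.1 i < d.1 (i + 1) := by
        by_contra hcon
        have := hd.1 (d.1 (i + 1)) (d.1 i) (by omega) (by omega) hle' hcase.2.symm
        rw [W.inv_apply_self, W.inv_apply_self] at this
        omega
      have := hs.1 (d.1 i) (d.1 (i + 1)) (by omega) hlt' hle hcase.2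
      rw [mul_s_inv_apply, mul_s_inv_apply, W.inv_apply_self, W.inv_apply_self,
        s_pos_apply h0, s_pos_apply h0] at this
      simp only [if_true] at this
      split_ifs at this <;> omega
    obtain ⟨z, hz⟩ := exists_youngSum_eq' (q := q) (Q := Q) (((-q)⁻¹ : Rˣ) : R) hy
    have e : (((-q)⁻¹ : Rˣ) : R) * (q : R) = -1 := by
      have := (-q).inv_mul
      rw [Units.val_neg, mul_neg] at this
      rw [← this, neg_neg]
    rw [hz, ← mul_assoc, mul_add, mul_one, mul_smul_comm, hd.mul_Ts hl h0 hs, smul_smul, e,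
      neg_smul, one_smul, add_neg_cancel, zero_mul]
  · have hpi : p ≠ i := by
      rintro rfl
      exact hcase ⟨h1, hlab⟩
    have hs : RowStd lab a (d * s ⟨i, hir⟩) := by
      by_contra hs
      obtain ⟨j, hj, -, hij⟩ := hd.exists_of_not hl h0 hs
      obtain ⟨hj0, hjl⟩ := young_s_iff.1 hj
      simp only at hij
      rcases hij with ⟨e1, e2⟩ | ⟨e1, e2⟩
      · rw [e1, e2] at hcase
        exact hcase ⟨by omega, hjl⟩
      · omega
    have e1 : (d * s ⟨i, hir⟩).1 p = d.1 p := by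
      rw [W.mul_apply, s_pos_apply h0]
      simp only
      rw [if_neg (by omega), if_neg (by omega), if_neg (by omega), if_neg (by omega)]
    have e2 : (d * s ⟨i, hir⟩).1 i = d.1 (i + 1) := by
      rw [W.mul_apply, s_pos_apply h0, if_pos rfl]
    refine mul_T_mul_eq_zero_of_neg (Ts_mul_youngSum_neg hy)
      (ih (i - p) (by omega) hp (p' := i) (by omega) (by omega) ?_ hs ?_ ?_ ?_ rfl)
    · rw [hclab, hci]; push_cast; rfl
    · rwa [e1]
    · rwa [e2]
    · rw [e1, e2, hlab]

/-- The element `d` represents the tableau whose columns are filled in order, so that its columns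
are the blocks of the labelling `clab` of `[1, r]`: the entries are positive, those up to `b` are in
the second component, columns increase downwards, and permuting the columns leaves the tableau row
standard. Conversely (`exists_eq`) a positive row standard tableau in which no two entries of a
block of `clab` share a row comes from this one by permuting the columns. -/
structure ColumnStd (lab clab : ℤ → ℤ) (a b : ℕ) (d : W r) : Prop where
  pos : ∀ p : ℤ, 1 ≤ p → p ≤ r → 0 < d.1 p
  second : ∀ p : ℤ, 1 ≤ p → p ≤ b → a < d.1 p
  increasing : ∀ p p' : ℤ, 1 ≤ p → p < p' → p' ≤ r → clab p = clab p' → d.1 p < d.1 p'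
  rowStd : ∀ v, Young clab v → RowStd lab a (d * v)
  exists_eq : ∀ e, PosStd lab a b e →
    (∀ p p' : ℤ, 1 ≤ p → p < p' → p' ≤ r → clab p = clab p' → lab (e.1 p) ≠ lab (e.1 p')) →
    ∃ v, Young clab v ∧ e = d * v

variable {d : W r}

lemma ColumnStd.self (h : ColumnStd lab clab a b d) : RowStd lab a d := by
  have := h.rowStd 1 Young.one
  rwa [mul_one] at this

/-- A tableau as in `ColumnStd` may be multiplied by the column stabilizer freely. -/
lemma ColumnStd.T_mul_T (hcl : BlockLabels r b clab) (h : ColumnStd lab clab a b d) {v : W r}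
    (hv : Young clab v) : T q Q d * T q Q v = T q Q (d * v) := by
  have h1 : RowStd clab 0 d⁻¹ := by
    refine ⟨fun p p' hp hlt hp' hlab => ?_, fun p hp hp' => ?_⟩
    · rw [inv_inv]; exact h.increasing p p' hp hlt hp' hlab
    · push_cast at hp'; omega
  have hcl0 : BlockLabels r 0 clab := ⟨Nat.zero_le _, hcl.mono, fun p _ h1 h2 => by
    push_cast at h2; omega⟩
  have h2 := T_young_mul_T (q := q) (Q := Q) hcl0 hv.inv h1
  have h3 := congrArg (hstar q Q) h2
  rwa [hstar_mul, hstar_T, hstar_T, hstar_T, inv_inv, inv_inv, mul_inv_rev, inv_inv, inv_inv] at h3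

variable (q Q r) in
/-- The element `u_b^- ŷ`, where `ŷ` is the alternating sum over the Young subgroup of the
columns. -/
def colElt (clab : ℤ → ℤ) (b : ℕ) : Hecke q Q r :=
  uMinus q Q r b * youngSum q Q r clab ((-q)⁻¹ : Rˣ)

lemma colElt_eq (hcl : BlockLabels r b clab) :
    colElt q Q r clab b = youngSum q Q r clab ((-q)⁻¹ : Rˣ) * uMinus q Q r b := by
  rw [colElt, uMinus_eq]
  exact (youngSum_commute_uProd hcl).eq.symm

lemma hstar_colElt (hcl : BlockLabels r b clab) :
    hstar q Q (colElt q Q r clab b) = colElt q Q r clab b := by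
  rw [colElt, hstar_mul, hstar_youngSum, uMinus_eq, hstar_uProd hcl.le, ← uMinus_eq,
    ← colElt_eq hcl, colElt]

/-- `M^λ u_b^- ŷ` is spanned by a single element: this is where the Weyl module comes from. -/
lemma ColumnStd.exists_rowElt_mul_eq (hab : a + b = r) (hl : BlockLabels r a lab)
    (hcl : BlockLabels r b clab) (hd : ColumnStd lab clab a b d) (h : Hecke q Q r) :
    ∃ c : R, rowElt q Q r lab a * h * colElt q Q r clab b =
      c • (rowElt q Q r lab a * T q Q d * colElt q Q r clab b) := by
  -- Positive tableaux: either two entries of a column share a row, and the product vanishes, or the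
  -- tableau is obtained from that of `d` by permuting the columns.
  have hpos : ∀ e, PosStd lab a b e → ∃ c : R, rowElt q Q r lab a * T q Q e * colElt q Q r clab b =
      c • (rowElt q Q r lab a * T q Q d * colElt q Q r clab b) := by
    intro e he
    rw [colElt_eq hcl, ← mul_assoc, ← mul_assoc]
    by_cases hex : ∃ p p' : ℤ, 1 ≤ p ∧ p < p' ∧ p' ≤ r ∧ clab p = clab p' ∧
        lab (e.1 p) = lab (e.1 p') ∧ 0 < e.1 p ∧ 0 < e.1 p'
    · obtain ⟨p, p', hp, hlt, hp', h1, h2, h3, h4⟩ := hex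
      obtain ⟨k, rfl⟩ : ∃ k : ℕ, p = k := ⟨p.toNat, by omega⟩
      obtain ⟨k', rfl⟩ : ∃ k' : ℕ, p' = k' := ⟨p'.toNat, by omega⟩
      refine ⟨0, ?_⟩
      rw [RowStd.mul_youngSum_eq_zero hl hcl (by omega) (by omega) (by omega) h1 he.1 h3 h4 h2,
        zero_mul, zero_smul]
    · have hepos : ∀ p : ℤ, 1 ≤ p → p ≤ r → 0 < e.1 p := fun p hp hp' => he.pos hab hp hp'
      push Not at hex
      obtain ⟨v, hv, rfl⟩ := hd.exists_eq e he fun p p' h1 h2 h3 h4 h5 =>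
        absurd (hepos p' (by omega) h3) (not_lt.2 (hex p p' h1 h2 h3 h4 h5
          (hepos p h1 (by omega))))
      obtain ⟨c, hc⟩ := T_mul_youngSum_neg (q := q) (Q := Q) hcl hv
      refine ⟨c, ?_⟩
      rw [← hd.T_mul_T hcl hv, ← mul_assoc, mul_assoc _ (T q Q v), hc, mul_smul_comm,
        smul_mul_assoc]
  have hspan : ∀ y ∈ spanT (rowElt q Q r lab a) (PosStd lab a b),
      ∃ c : R, y * colElt q Q r clab b =
        c • (rowElt q Q r lab a * T q Q d * colElt q Q r clab b) := by
    intro y hy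
    have := mul_mem_of_spanT (h := colElt q Q r clab b)
      (N := Submodule.span R {rowElt q Q r lab a * T q Q d * colElt q Q r clab b})
      (fun e he => ?_) hy
    · obtain ⟨c, hc⟩ := Submodule.mem_span_singleton.1 this
      exact ⟨c, hc.symm⟩
    · obtain ⟨c, hc⟩ := hpos e he
      rw [hc]
      exact Submodule.smul_mem _ _ (Submodule.mem_span_singleton_self _)
  have := mul_mem_of_spanT (h := colElt q Q r clab b)
    (N := Submodule.span R {rowElt q Q r lab a * T q Q d * colElt q Q r clab b})
    (fun e he => ?_) (rowElt_mul_mem hl h)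
  · obtain ⟨c, hc⟩ := Submodule.mem_span_singleton.1 this
    exact ⟨c, hc.symm⟩
  · obtain ⟨y, hy, e1⟩ := he.exists_mul_uMinus_eq (q := q) (Q := Q) hl hcl.le
    obtain ⟨c, hc⟩ := hspan y hy
    have e2 : rowElt q Q r lab a * T q Q e * colElt q Q r clab b = y * colElt q Q r clab b := by
      rw [colElt, ← mul_assoc, e1, mul_assoc]
    rw [e2, hc]
    exact Submodule.smul_mem _ _ (Submodule.mem_span_singleton_self _)

/-- The hypothesis for the leading term lemma holds where `1, …, b` are in the second component up
to signs, as no row of that component constrains signs. -/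
lemma ColumnStd.regularOn (hl : BlockLabels r a lab) (hb : b ≤ r) :
    RegularOn (rowElt q Q r lab a)
      (fun d => RowStd lab a d ∧ ∀ p : ℤ, 1 ≤ p → p ≤ b → a < |d.1 p|) b := by
  refine ⟨hb, fun d hd i h0 hb1 => ⟨?_, fun p hp hp' => ?_⟩, fun d hd i h0 hib => ?_⟩
  · by_contra hs
    obtain ⟨h1, h2⟩ := hd.1.one_of_not h0 hs
    have := hd.2 1 le_rfl (by omega)
    rw [abs_of_pos h1] at this
    omega
  · rw [W.mul_apply, s_zero_apply h0]
    split_ifs with h1 h2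
    · subst h1; rw [W.map_neg, abs_neg]; exact hd.2 1 le_rfl hp'
    · omega
    · exact hd.2 p hp hp'
  · by_cases hs : RowStd lab a (d * s i)
    · refine Or.inl ⟨hs, fun p hp hp' => ?_⟩
      rw [W.mul_apply]
      refine hd.2 _ ?_ ?_ <;> rw [s_pos_apply h0] <;> split_ifs <;> omega
    · refine Or.inr ⟨hd.1.mul_Ts hl h0 hs, ?_⟩
      obtain ⟨j, hj, -, hij⟩ := hd.1.exists_of_not hl h0 hs
      have := (young_s_iff.1 hj).1
      omega

/-- The coefficient of a bitabloid with columns filled in order in its own multiple by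
`u_b^- ŷ` comes from the constant term of `u_b^-`, hence is invertible. -/
lemma ColumnStd.rowForm_self (hl : BlockLabels r a lab) (hcl : BlockLabels r b clab)
    (hd : ColumnStd lab clab a b d) :
    rowForm q Q r lab a (rowElt q Q r lab a * T q Q d)
      (rowElt q Q r lab a * T q Q d * colElt q Q r clab b) =
      (∏ i ∈ Finset.range b, (Q : R) * (q : R) ^ i) * qlen q Q d := by
  classical
  set m := rowElt q Q r lab a
  set K := ∏ i ∈ Finset.range b, (Q : R) * (q : R) ^ i
  have hmd := rowElt_mul_mem (q := q) (Q := Q) hl (T q Q d)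
  have hlead := (ColumnStd.regularOn (q := q) (Q := Q) hl hcl.le).mul_uProd_sub_mem (Q : R) (-1)
    le_rfl (d := d) ⟨hd.self, fun p hp hp' => (hd.second p hp hp').trans_le (le_abs_self _)⟩
    (fun p hp hp' => by have := hd.second p hp hp'; omega)
  rw [← uMinus_eq] at hlead
  -- The terms with `v ≠ 1` of the column sum are orthogonal to `m T_d`.
  have hone : rowForm q Q r lab a (m * T q Q d * youngSum q Q r clab ((-q)⁻¹ : Rˣ))
      (m * T q Q d) = qlen q Q d := by
    have e : m * T q Q d * youngSum q Q r clab ((-q)⁻¹ : Rˣ) =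
        ∑ v : W r with Young clab v, (((-q)⁻¹ : Rˣ) : R) ^ len v • (m * T q Q (d * v)) := by
      rw [youngSum, Finset.mul_sum]
      refine Finset.sum_congr rfl fun v hv => ?_
      rw [mul_smul_comm, mul_assoc, hd.T_mul_T hcl (Finset.mem_filter.1 hv).2]
    rw [e, map_sum, LinearMap.sum_apply, Finset.sum_eq_single 1]
    · rw [len_one, pow_zero, one_smul, mul_one, rowForm_bitabloids hl hd.self hd.self, if_pos rfl]
    · intro v hv hv1
      rw [map_smul, LinearMap.smul_apply, rowForm_bitabloids hl
        (hd.rowStd v (Finset.mem_filter.1 hv).2) hd.self, if_neg, smul_zero]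
      exact fun h => hv1 (mul_eq_left.1 h)
    · intro h
      exact absurd (Finset.mem_filter.2 ⟨Finset.mem_univ _, Young.one⟩) h
  -- All tableaux occurring in `m T_d ŷ` are positive, hence orthogonal to those with a
  -- negative entry.
  have hzero : ∀ y ∈ negSpan m (fun d => RowStd lab a d ∧ ∀ p : ℤ, 1 ≤ p → p ≤ b → a < |d.1 p|) b b,
      rowForm q Q r lab a (m * T q Q d * youngSum q Q r clab ((-q)⁻¹ : Rˣ)) y = 0 := by
    intro y hy
    induction hy using Submodule.span_induction with
    | zero => simp
    | add x y _ _ hx hy => rw [map_add, hx, hy, add_zero]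
    | smul c x _ hx => rw [map_smul, hx, smul_zero]
    | mem x hx =>
      obtain ⟨e, ⟨he, -, p, hp, hp', hneg⟩, rfl⟩ := hx
      rw [youngSum, Finset.mul_sum, map_sum, LinearMap.sum_apply]
      refine Finset.sum_eq_zero fun v hv => ?_
      have hv' := (Finset.mem_filter.1 hv).2
      rw [mul_smul_comm, mul_assoc m, hd.T_mul_T hcl hv', map_smul, LinearMap.smul_apply,
        rowForm_bitabloids hl (hd.rowStd v hv') he.1, if_neg, smul_zero]
      rintro rfl
      have hbr := hcl.le
      have h1 := hv' p hp (by omega)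
      have h2 := hd.pos (v.1 p) (by omega) (W.map_le v hp (by omega))
      rw [W.mul_apply] at hneg
      omega
  have h1 := hzero _ hlead
  rw [map_sub, map_smul, hone, sub_eq_zero, smul_eq_mul] at h1
  rw [colElt_eq hcl, ← mul_assoc, ← h1, rowForm_symm]
  have h2 := rowForm_mul (q := q) (Q := Q) hl (uMinus q Q r b)
    (spanT_mul_mem hl (youngSum q Q r clab ((-q)⁻¹ : Rˣ)) hmd) hmd
  have h3 : hstar q Q (uMinus q Q r b) = uMinus q Q r b := by
    rw [uMinus_eq, hstar_uProd hcl.le]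
  rw [h2, h3]

end WeylGenerator

/-! ### Entries of the standard fillings -/

namespace Bicomp

lemma sum_take_succ (l : List ℕ) (i : ℕ) :
    (l.take (i + 1)).sum = (l.take i).sum + l.getD i 0 := by
  rw [List.take_add_one, List.sum_append, List.getD_eq_getElem?_getD]
  cases l[i]? <;> simp

lemma sum_take_mono (l : List ℕ) {i i' : ℕ} (h : i ≤ i') : (l.take i).sum ≤ (l.take i').sum := by
  induction i', h using Nat.le_induction with
  | base => exact le_rfl
  | succ k _ ih => rw [sum_take_succ]; omega

lemma sum_take_le (l : List ℕ) (i : ℕ) : (l.take i).sum ≤ l.sum := by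
  conv_rhs => rw [← List.take_append_drop i l, List.sum_append]
  omega

lemma rowEntry_lt {l : List ℕ} {i i' j : ℕ} (j' : ℕ) (hj : j < l.getD i 0) (h : i < i') :
    rowEntry l i j < rowEntry l i' j' := by
  have h1 := sum_take_succ l i
  have h2 := sum_take_mono l (Nat.succ_le_of_lt h)
  rw [Nat.succ_eq_add_one] at h2
  unfold rowEntry
  omega

lemma rowEntry_le {l : List ℕ} {i j : ℕ} (hj : j < l.getD i 0) : rowEntry l i j ≤ l.sum := by
  have h1 := sum_take_succ l i
  have h2 := sum_take_le l (i + 1)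
  unfold rowEntry
  omega

lemma exists_rowEntry (l : List ℕ) {k : ℕ} (hk : 1 ≤ k) (hk' : k ≤ l.sum) :
    ∃ i j, j < l.getD i 0 ∧ rowEntry l i j = k := by
  induction l generalizing k with
  | nil => simp at hk'; omega
  | cons p l ih =>
    rw [List.sum_cons] at hk'
    by_cases h : k ≤ p
    · exact ⟨0, k - 1, by simp; omega, by simp [rowEntry]; omega⟩
    · obtain ⟨i, j, hj, hij⟩ := ih (k := k - p) (by omega) (by omega)
      refine ⟨i + 1, j, by simpa using hj, ?_⟩
      unfold rowEntry at hij ⊢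
      rw [List.take_succ_cons, List.sum_cons]
      omega

lemma countP_take_succ {l : List ℕ} {i j : ℕ} (hj : j < l.getD i 0) :
    (l.take (i + 1)).countP (fun p => j < p) = (l.take i).countP (fun p => j < p) + 1 := by
  rw [List.getD_eq_getElem?_getD] at hj
  rw [List.take_add_one, List.countP_append]
  cases h : l[i]? with
  | none => rw [h] at hj; simp at hj
  | some p => rw [h] at hj; simp at hj; simp [hj]

lemma countP_take_le (l : List ℕ) (i j : ℕ) :
    (l.take i).countP (fun p => j < p) ≤ l.countP (fun p => j < p) :=
  (List.take_sublist i l).countP_le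

lemma countP_take_mono (l : List ℕ) (j : ℕ) {i i' : ℕ} (h : i ≤ i') :
    (l.take i).countP (fun p => j < p) ≤ (l.take i').countP (fun p => j < p) :=
  (List.take_sublist_take_left h).countP_le

lemma colEntry_le_sum {l : List ℕ} {i j : ℕ} (hj : j < l.getD i 0) :
    colEntry l i j ≤ ∑ k ∈ Finset.range (j + 1), l.countP (fun p => k < p) := by
  have h1 := countP_take_succ hj
  have h2 := countP_take_le l (i + 1) j
  rw [colEntry, Finset.sum_range_succ]
  omega

lemma colEntry_lt {l : List ℕ} {i j j' : ℕ} (i' : ℕ) (hj : j < l.getD i 0) (h : j < j') :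
    colEntry l i j < colEntry l i' j' := by
  have h1 := colEntry_le_sum hj
  have h2 : ∑ k ∈ Finset.range (j + 1), l.countP (fun p => k < p) ≤
      ∑ k ∈ Finset.range j', l.countP (fun p => k < p) :=
    Finset.sum_le_sum_of_subset (Finset.range_mono h)
  rw [colEntry.eq_1 l i' j']
  omega

lemma colEntry_lt_of_row {l : List ℕ} {i i' j : ℕ} (hj : j < l.getD i 0) (h : i < i') :
    colEntry l i j < colEntry l i' j := by
  have h1 := countP_take_succ hj
  have h2 := countP_take_mono l j (Nat.succ_le_of_lt h)
  rw [Nat.succ_eq_add_one] at h2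
  unfold colEntry
  omega

lemma sum_countP_le (l : List ℕ) (m : ℕ) :
    ∑ k ∈ Finset.range m, l.countP (fun p => k < p) ≤ l.sum := by
  induction l with
  | nil => simp
  | cons p l ih =>
    simp only [List.countP_cons, Finset.sum_add_distrib, List.sum_cons, decide_eq_true_eq]
    have : ∑ k ∈ Finset.range m, (if k < p then 1 else 0) ≤ p := by
      rw [← Finset.sum_filter, Finset.sum_const, smul_eq_mul, mul_one]
      calc _ ≤ (Finset.range p).card := Finset.card_le_card fun k hk => by
            simp at hk ⊢; exact hk.2
        _ = p := Finset.card_range p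
    omega

lemma colEntry_le {l : List ℕ} {i j : ℕ} (hj : j < l.getD i 0) : colEntry l i j ≤ l.sum :=
  (colEntry_le_sum hj).trans (sum_countP_le l _)

lemma colEntry_pos (l : List ℕ) (i j : ℕ) : 1 ≤ colEntry l i j := by unfold colEntry; omega

lemma rowEntry_pos (l : List ℕ) (i j : ℕ) : 1 ≤ rowEntry l i j := by unfold rowEntry; omega

end Bicomp

/-! ### Numberings of a set of nodes -/

section Labels

variable {ι κ : Type*} {r : ℕ} {t : ι → ℤ} {ℓ : ι → ℤ} {key : ι → κ}

open Classical in
/-- The labelling of the entries of the filling `t` that corresponds to a labelling `ℓ` of the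
nodes. -/
def labOf (t ℓ : ι → ℤ) (p : ℤ) : ℤ := if h : ∃ x, t x = p then ℓ h.choose else 0

lemma labOf_apply (ht : Function.Injective t) (x : ι) : labOf t ℓ (t x) = ℓ x := by
  have h : ∃ y, t y = t x := ⟨x, rfl⟩
  rw [labOf, dif_pos h, ht h.choose_spec]

/-- The filling `t` uses each of the numbers `1, …, r` exactly once. -/
structure IsNumbering (r : ℕ) (t : ι → ℤ) : Prop where
  injective : Function.Injective t
  mem_iff : ∀ p : ℤ, (∃ x, t x = p) ↔ 1 ≤ p ∧ p ≤ r

lemma IsNumbering.pos (ht : IsNumbering r t) (x : ι) : 1 ≤ t x := ((ht.mem_iff _).1 ⟨x, rfl⟩).1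

lemma IsNumbering.le (ht : IsNumbering r t) (x : ι) : t x ≤ r := ((ht.mem_iff _).1 ⟨x, rfl⟩).2

lemma IsNumbering.exists_eq (ht : IsNumbering r t) {p : ℤ} (h : 1 ≤ p) (h' : p ≤ r) :
    ∃ x, t x = p := (ht.mem_iff p).2 ⟨h, h'⟩

lemma IsNumbering.blockLabels (ht : IsNumbering r t) {a : ℕ} (ha : a ≤ r)
    (hmono : ∀ x y, ℓ x < ℓ y → t x < t y) (hsep : ∀ x y, t x ≤ a → a < t y → ℓ x ≠ ℓ y) :
    BlockLabels r a (labOf t ℓ) := by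
  refine ⟨ha, fun p p' hp hle hp' => ?_, fun p p' hp hpa hap hp' => ?_⟩
  all_goals
    obtain ⟨x, rfl⟩ := ht.exists_eq (p := p) hp (by omega)
    obtain ⟨y, rfl⟩ := ht.exists_eq (p := p') (by omega) hp'
    rw [labOf_apply ht.injective, labOf_apply ht.injective]
  · by_contra hcon
    have := hmono y x (not_le.1 hcon)
    omega
  · exact hsep x y hpa hap

lemma IsNumbering.exists_of_young (ht : IsNumbering r t) {w : W r} (hw : Young (labOf t ℓ) w)
    (x : ι) : ∃ y, w.1 (t x) = t y ∧ ℓ y = ℓ x := by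
  obtain ⟨h1, h2⟩ := hw (t x) (ht.pos x) (ht.le x)
  obtain ⟨y, hy⟩ := ht.exists_eq (p := w.1 (t x)) (by omega) (W.map_le w (ht.pos x) (ht.le x))
  rw [← hy, labOf_apply ht.injective, labOf_apply ht.injective] at h2
  exact ⟨y, hy.symm, h2⟩

lemma IsNumbering.young_of_exists (ht : IsNumbering r t) {w : W r}
    (h : ∀ x, ∃ y, w.1 (t x) = t y ∧ ℓ y = ℓ x) : Young (labOf t ℓ) w := by
  intro p hp hp'
  obtain ⟨x, rfl⟩ := ht.exists_eq hp hp'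
  obtain ⟨y, hy, hl⟩ := h x
  have := ht.pos y
  rw [hy, labOf_apply ht.injective, labOf_apply ht.injective]
  exact ⟨by omega, hl⟩

/-- The setwise stabilizer of the blocks of a numbering is the Young subgroup of the labels. -/
lemma IsNumbering.stab_iff (ht : IsNumbering r t) (hkey : ∀ x y, ℓ x = ℓ y ↔ key x = key y)
    (w : W r) : (∀ k : κ, (fun p => act p w) '' {p | ∃ x, key x = k ∧ t x = p} =
      {p | ∃ x, key x = k ∧ t x = p}) ↔ Young (labOf t ℓ) w := by
  constructor
  · intro h
    rw [← young_inv_iff]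
    refine ht.young_of_exists fun x => ?_
    have hx : act (t x) w ∈ {p | ∃ y, key y = key x ∧ t y = p} := by
      rw [← h]; exact ⟨t x, ⟨x, rfl, rfl⟩, rfl⟩
    obtain ⟨y, hy, hty⟩ := hx
    exact ⟨y, hty.symm, (hkey _ _).2 hy⟩
  · intro h k
    ext p
    constructor
    · rintro ⟨_, ⟨x, hx, rfl⟩, rfl⟩
      obtain ⟨y, hy, hl⟩ := ht.exists_of_young h.inv x
      exact ⟨y, ((hkey _ _).1 hl).trans hx, hy.symm⟩
    · rintro ⟨x, hx, rfl⟩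
      obtain ⟨y, hy, hl⟩ := ht.exists_of_young h x
      refine ⟨t y, ⟨y, ((hkey _ _).1 hl).trans hx, rfl⟩, ?_⟩
      simp only [act]
      rw [← hy, W.inv_apply_self]

end Labels

section OddExtension

variable {r : ℕ}

open Classical in
/-- The odd extension to `ℤ` of a self-map of `[1, r]`. -/
def oddExt (r : ℕ) (f : ℤ → ℤ) (k : ℤ) : ℤ :=
  if 1 ≤ k ∧ k ≤ r then f k else if 1 ≤ -k ∧ -k ≤ r then -f (-k) else k

lemma oddExt_oddExt {f g : ℤ → ℤ} (hf : ∀ k : ℤ, 1 ≤ k → k ≤ r → 1 ≤ f k ∧ f k ≤ r)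
    (hgf : ∀ k : ℤ, 1 ≤ k → k ≤ r → g (f k) = k) (k : ℤ) :
    oddExt r g (oddExt r f k) = k := by
  rw [oddExt.eq_1 r f]
  split_ifs with h1 h2
  · have := hf k h1.1 h1.2
    rw [oddExt, if_pos this, hgf k h1.1 h1.2]
  · have := hf (-k) h2.1 h2.2
    rw [oddExt, if_neg (by omega), if_pos (by rwa [neg_neg]), neg_neg, hgf _ h2.1 h2.2, neg_neg]
  · rw [oddExt, if_neg h1, if_neg h2]

/-- There is an unsigned permutation taking one numbering to another one. -/
lemma IsNumbering.exists_perm {ι : Type*} {t t' : ι → ℤ} (ht : IsNumbering r t)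
    (ht' : IsNumbering r t') : ∃ w : W r, ∀ x, w.1 (t x) = t' x := by
  have key : ∀ {t t' : ι → ℤ}, IsNumbering r t → IsNumbering r t' →
      ∀ k : ℤ, 1 ≤ k → k ≤ r → 1 ≤ labOf t t' k ∧ labOf t t' k ≤ r := by
    intro t t' ht ht' k hk hk'
    obtain ⟨x, rfl⟩ := ht.exists_eq hk hk'
    rw [labOf_apply ht.injective]
    exact ⟨ht'.pos x, ht'.le x⟩
  have key' : ∀ {t t' : ι → ℤ}, IsNumbering r t → IsNumbering r t' →
      ∀ k : ℤ, 1 ≤ k → k ≤ r → labOf t' t (labOf t t' k) = k := by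
    intro t t' ht ht' k hk hk'
    obtain ⟨x, rfl⟩ := ht.exists_eq hk hk'
    rw [labOf_apply ht.injective, labOf_apply ht'.injective]
  refine ⟨⟨⟨oddExt r (labOf t t'), oddExt r (labOf t' t), oddExt_oddExt (key ht ht') (key' ht ht'),
    oddExt_oddExt (key ht' ht) (key' ht' ht)⟩, fun k => ?_, fun k hk => ?_⟩, fun x => ?_⟩
  · simp only [Equiv.coe_fn_mk, oddExt, neg_neg]
    split_ifs <;> omega
  · have hk' : (r : ℤ) < k ∨ (r : ℤ) < -k := lt_abs.mp hk
    simp only [Equiv.coe_fn_mk, oddExt]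
    rw [if_neg (by omega), if_neg (by omega)]
  · simp only [Equiv.coe_fn_mk, oddExt]
    rw [if_pos ⟨ht.pos x, ht.le x⟩, labOf_apply ht.injective]

end OddExtension

/-! ### The tableaux attached to a bicomposition -/

namespace Bicomp

variable {n r : ℕ} (lam : Bicomp n r)

lemma a_le : lam.a ≤ r := by have := lam.sum_add; unfold a; omega

lemma snd_sum : lam.snd.sum = r - lam.a := by have := lam.sum_add; unfold a; omega

lemma a_add : lam.a + (r - lam.a) = r := by have := lam.a_le; omega

variable {lam}

lemma Diagram.cases (x : lam.Diagram) :
    (x.1.1 = 0 ∧ x.1.2.2 < lam.fst.getD x.1.2.1 0) ∨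
      (x.1.1 = 1 ∧ x.1.2.2 < lam.snd.getD x.1.2.1 0) := by
  have h := x.2
  rcases (show ∀ c : Fin 2, c = 0 ∨ c = 1 by decide) x.1.1 with h0 | h0
  · refine Or.inl ⟨h0, ?_⟩
    rw [h0] at h
    exact h
  · refine Or.inr ⟨h0, ?_⟩
    rw [h0] at h
    exact h

lemma Diagram.ext {x y : lam.Diagram} (h1 : x.1.1 = y.1.1) (h2 : x.1.2.1 = y.1.2.1)
    (h3 : x.1.2.2 = y.1.2.2) : x = y :=
  Subtype.ext (Prod.ext h1 (Prod.ext h2 h3))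

lemma tUp_zero {x : lam.Diagram} (h : x.1.1 = 0) :
    lam.tUp x = (rowEntry lam.fst x.1.2.1 x.1.2.2 : ℕ) := if_pos h

lemma tUp_one {x : lam.Diagram} (h : x.1.1 = 1) :
    lam.tUp x = (lam.a + rowEntry lam.snd x.1.2.1 x.1.2.2 : ℤ) :=
  if_neg (by rw [h]; exact one_ne_zero)

lemma tHatUp_zero {x : lam.Diagram} (h : x.1.1 = 0) :
    lam.tHatUp x = (lam.snd.sum + rowEntry lam.fst x.1.2.1 x.1.2.2 : ℤ) := if_pos h

lemma tHatUp_one {x : lam.Diagram} (h : x.1.1 = 1) :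
    lam.tHatUp x = (rowEntry lam.snd x.1.2.1 x.1.2.2 : ℕ) :=
  if_neg (by rw [h]; exact one_ne_zero)

lemma tHatDown_zero {x : lam.Diagram} (h : x.1.1 = 0) :
    lam.tHatDown x = (lam.snd.sum + colEntry lam.fst x.1.2.1 x.1.2.2 : ℤ) := if_pos h

lemma tHatDown_one {x : lam.Diagram} (h : x.1.1 = 1) :
    lam.tHatDown x = (colEntry lam.snd x.1.2.1 x.1.2.2 : ℕ) :=
  if_neg (by rw [h]; exact one_ne_zero)

lemma tUp_le_iff (x : lam.Diagram) : lam.tUp x ≤ lam.a ↔ x.1.1 = 0 := by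
  rcases x.cases with ⟨h, hj⟩ | ⟨h, hj⟩
  · rw [tUp_zero h]
    have := rowEntry_le hj
    simp only [h, iff_true]
    unfold a; omega
  · rw [tUp_one h]
    have := rowEntry_pos lam.snd x.1.2.1 x.1.2.2
    simp only [h, one_ne_zero, iff_false]
    omega

lemma tHatDown_le_iff (x : lam.Diagram) : lam.tHatDown x ≤ (r - lam.a : ℕ) ↔ x.1.1 = 1 := by
  rw [← lam.snd_sum]
  rcases x.cases with ⟨h, hj⟩ | ⟨h, hj⟩
  · rw [tHatDown_zero h]
    have := colEntry_pos lam.fst x.1.2.1 x.1.2.2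
    simp only [h, zero_ne_one, iff_false]
    omega
  · rw [tHatDown_one h]
    have := colEntry_le hj
    simp only [h, iff_true]
    omega

/-- The number of the row of a node, counted through both components. -/
def rowLab (x : lam.Diagram) : ℤ :=
  if x.1.1 = 0 then (x.1.2.1 : ℤ) else (lam.fst.length + x.1.2.1 : ℤ)

/-- A label for the column of a node; the columns of the second component come first. -/
def colLab (x : lam.Diagram) : ℤ :=
  if x.1.1 = 1 then (x.1.2.2 : ℤ) else (r + x.1.2.2 : ℤ)

lemma row_lt_length {l : List ℕ} {i j : ℕ} (h : j < l.getD i 0) : i < l.length := by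
  by_contra hcon
  rw [List.getD_eq_default _ _ (not_lt.1 hcon)] at h
  omega

lemma getD_le_sum (l : List ℕ) (i : ℕ) : l.getD i 0 ≤ l.sum := by
  have h1 := sum_take_succ l i
  have h2 := sum_take_le l (i + 1)
  omega

lemma rowLab_eq_iff (x y : lam.Diagram) :
    rowLab x = rowLab y ↔ (x.1.1, x.1.2.1) = (y.1.1, y.1.2.1) := by
  rw [Prod.mk.injEq]
  unfold rowLab
  rcases x.cases with ⟨h, hj⟩ | ⟨h, hj⟩ <;> rcases y.cases with ⟨h', hj'⟩ | ⟨h', hj'⟩ <;>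
    have := row_lt_length hj <;> have := row_lt_length hj' <;>
    simp only [h, h', if_true, one_ne_zero, zero_ne_one, if_false, true_and, false_and,
      iff_false] <;> omega

lemma colLab_eq_iff (x y : lam.Diagram) :
    colLab x = colLab y ↔ (x.1.1, x.1.2.2) = (y.1.1, y.1.2.2) := by
  rw [Prod.mk.injEq]
  have hs := lam.sum_add
  unfold colLab
  rcases x.cases with ⟨h, hj⟩ | ⟨h, hj⟩ <;> rcases y.cases with ⟨h', hj'⟩ | ⟨h', hj'⟩ <;>
    simp only [h, h', if_true, one_ne_zero, zero_ne_one, if_false, true_and, false_and, iff_false]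
  · omega
  · have := getD_le_sum lam.snd y.1.2.1; omega
  · have := getD_le_sum lam.snd x.1.2.1; omega
  · omega

lemma tUp_lt_of_rowLab {x y : lam.Diagram} (h : rowLab x < rowLab y) : lam.tUp x < lam.tUp y := by
  unfold rowLab at h
  rcases x.cases with ⟨hx, hj⟩ | ⟨hx, hj⟩ <;> rcases y.cases with ⟨hy, hj'⟩ | ⟨hy, hj'⟩ <;>
    simp only [hx, hy, if_true, one_ne_zero, if_false] at h
  · rw [tUp_zero hx, tUp_zero hy]
    exact_mod_cast rowEntry_lt _ hj (by omega)
  · have h1 := (tUp_le_iff x).2 hx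
    have h2 := (tUp_le_iff y).not.2 (by rw [hy]; exact one_ne_zero)
    omega
  · have := row_lt_length hj'; omega
  · rw [tUp_one hx, tUp_one hy]
    have := rowEntry_lt y.1.2.2 hj (i' := y.1.2.1) (by omega)
    omega

lemma tUp_lt_iff_of_row {x y : lam.Diagram} (h1 : x.1.1 = y.1.1) (h2 : x.1.2.1 = y.1.2.1) :
    lam.tUp x < lam.tUp y ↔ x.1.2.2 < y.1.2.2 := by
  unfold tUp
  rw [h1, h2]
  unfold rowEntry
  split_ifs <;> push_cast <;> omega

lemma tUp_isNumbering (lam : Bicomp n r) : IsNumbering r lam.tUp := by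
  refine ⟨fun x y h => ?_, fun p => ⟨?_, fun ⟨hp, hp'⟩ => ?_⟩⟩
  · have h1 : rowLab x = rowLab y := by
      by_contra hne
      rcases lt_or_gt_of_ne hne with h' | h'
      · have := tUp_lt_of_rowLab h'; omega
      · have := tUp_lt_of_rowLab h'; omega
    rw [rowLab_eq_iff, Prod.mk.injEq] at h1
    have h2 := tUp_lt_iff_of_row h1.1 h1.2
    have h3 := tUp_lt_iff_of_row h1.1.symm h1.2.symm
    exact Diagram.ext h1.1 h1.2 (by omega)
  · rintro ⟨x, rfl⟩
    have hs := lam.sum_add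
    rcases x.cases with ⟨hx, hj⟩ | ⟨hx, hj⟩
    · rw [tUp_zero hx]
      have := rowEntry_le hj
      have := rowEntry_pos lam.fst x.1.2.1 x.1.2.2
      omega
    · rw [tUp_one hx]
      have := rowEntry_le hj
      have := rowEntry_pos lam.snd x.1.2.1 x.1.2.2
      unfold a; omega
  · have hs := lam.sum_add
    by_cases hpa : p ≤ lam.a
    · obtain ⟨i, j, hj, hij⟩ := exists_rowEntry lam.fst (k := p.toNat) (by omega)
        (by unfold a at hpa; omega)
      let x : lam.Diagram := ⟨(0, i, j), hj⟩
      refine ⟨x, (tUp_zero (x := x) rfl).trans ?_⟩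
      change ((rowEntry lam.fst i j : ℕ) : ℤ) = p
      omega
    · obtain ⟨i, j, hj, hij⟩ := exists_rowEntry lam.snd (k := p.toNat - lam.a) (by omega)
        (by unfold a at hpa ⊢; omega)
      let x : lam.Diagram := ⟨(1, i, j), hj⟩
      refine ⟨x, (tUp_one (x := x) rfl).trans ?_⟩
      change (lam.a + rowEntry lam.snd i j : ℤ) = p
      omega

lemma tHatDown_lt_of_colLab {x y : lam.Diagram} (h : colLab x < colLab y) :
    lam.tHatDown x < lam.tHatDown y := by
  have hs := lam.sum_add
  unfold colLab at h
  rcases x.cases with ⟨hx, hj⟩ | ⟨hx, hj⟩ <;> rcases y.cases with ⟨hy, hj'⟩ | ⟨hy, hj'⟩ <;>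
    simp only [hx, hy, if_true, zero_ne_one, if_false] at h
  · rw [tHatDown_zero hx, tHatDown_zero hy]
    have := colEntry_lt y.1.2.1 hj (j' := y.1.2.2) (by omega)
    omega
  · have := getD_le_sum lam.snd y.1.2.1; omega
  · have h1 := (tHatDown_le_iff x).2 hx
    have h2 := (tHatDown_le_iff y).not.2 (by rw [hy]; exact zero_ne_one)
    omega
  · rw [tHatDown_one hx, tHatDown_one hy]
    exact_mod_cast colEntry_lt _ hj (by omega)

lemma tHatDown_lt_of_col {x y : lam.Diagram} (h1 : x.1.1 = y.1.1) (h2 : x.1.2.2 = y.1.2.2)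
    (h : x.1.2.1 < y.1.2.1) : lam.tHatDown x < lam.tHatDown y := by
  rcases x.cases with ⟨hx, hj⟩ | ⟨hx, hj⟩
  · rw [tHatDown_zero hx, tHatDown_zero (h1 ▸ hx), ← h2]
    have := colEntry_lt_of_row hj h
    omega
  · rw [tHatDown_one hx, tHatDown_one (h1 ▸ hx), ← h2]
    exact_mod_cast colEntry_lt_of_row hj h

lemma tHatDown_lt_iff_of_col {x y : lam.Diagram} (h1 : x.1.1 = y.1.1) (h2 : x.1.2.2 = y.1.2.2) :
    lam.tHatDown x < lam.tHatDown y ↔ x.1.2.1 < y.1.2.1 := by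
  refine ⟨fun h => ?_, tHatDown_lt_of_col h1 h2⟩
  by_contra hcon
  rcases (not_lt.1 hcon).lt_or_eq with h' | h'
  · exact lt_asymm h (tHatDown_lt_of_col h1.symm h2.symm h')
  · rw [Diagram.ext h1 h'.symm h2] at h
    exact lt_irrefl _ h

instance Diagram.finite (lam : Bicomp n r) : Finite lam.Diagram := by
  have ht := lam.tUp_isNumbering
  refine Finite.of_injective (β := Set.Icc (1 : ℤ) r)
    (fun x => ⟨lam.tUp x, ht.pos x, ht.le x⟩) fun x y h => ht.injective ?_
  exact congrArg Subtype.val h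

lemma tHatDown_isNumbering (lam : Bicomp n r) : IsNumbering r lam.tHatDown := by
  have hinj : Function.Injective lam.tHatDown := by
    intro x y h
    have h1 : colLab x = colLab y := by
      by_contra hne
      rcases lt_or_gt_of_ne hne with h' | h'
      · have := tHatDown_lt_of_colLab h'; omega
      · have := tHatDown_lt_of_colLab h'; omega
    rw [colLab_eq_iff, Prod.mk.injEq] at h1
    have h2 := tHatDown_lt_iff_of_col h1.1 h1.2
    have h3 := tHatDown_lt_iff_of_col h1.1.symm h1.2.symm
    exact Diagram.ext h1.1 (by omega) h1.2
  have hbd : ∀ x, 1 ≤ lam.tHatDown x ∧ lam.tHatDown x ≤ r := by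
    intro x
    have hs := lam.sum_add
    rcases x.cases with ⟨hx, hj⟩ | ⟨hx, hj⟩
    · rw [tHatDown_zero hx]
      have := colEntry_le hj
      have := colEntry_pos lam.fst x.1.2.1 x.1.2.2
      omega
    · rw [tHatDown_one hx]
      have := colEntry_le hj
      have := colEntry_pos lam.snd x.1.2.1 x.1.2.2
      omega
  refine ⟨hinj, fun p => ⟨?_, fun ⟨hp, hp'⟩ => ?_⟩⟩
  · rintro ⟨x, rfl⟩; exact hbd x
  · -- surjectivity follows from injectivity, as the nodes are in bijection with `[1, r]`
    have ht := lam.tUp_isNumbering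
    let e : lam.Diagram ≃ Set.Icc (1 : ℤ) r := Equiv.ofBijective
      (fun x => ⟨lam.tUp x, ht.pos x, ht.le x⟩) ⟨fun x y h => ht.injective (congrArg Subtype.val h),
        fun p => by obtain ⟨x, hx⟩ := ht.exists_eq p.2.1 p.2.2; exact ⟨x, Subtype.ext hx⟩⟩
    let f : Set.Icc (1 : ℤ) r → Set.Icc (1 : ℤ) r := fun p => ⟨lam.tHatDown (e.symm p), hbd _⟩
    have hf : Function.Injective f := fun p p' h =>
      e.symm.injective (hinj (congrArg Subtype.val h))
    obtain ⟨k, hk⟩ := Finite.surjective_of_injective hf ⟨p, hp, hp'⟩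
    exact ⟨e.symm k, congrArg Subtype.val hk⟩

variable (lam) in
/-- The labelling of the positions `1, …, r` by the rows of `t^λ`. -/
def rlab : ℤ → ℤ := labOf lam.tUp rowLab

variable (lam) in
/-- The labelling of the numbers `1, …, r` by the columns of `t̂_λ`. -/
def clab : ℤ → ℤ := labOf lam.tHatDown colLab

variable (lam)

lemma rlab_tUp (x : lam.Diagram) : lam.rlab (lam.tUp x) = rowLab x :=
  labOf_apply lam.tUp_isNumbering.injective x

lemma clab_tHatDown (x : lam.Diagram) : lam.clab (lam.tHatDown x) = colLab x :=
  labOf_apply lam.tHatDown_isNumbering.injective x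

lemma blockLabels_rlab : BlockLabels r lam.a lam.rlab := by
  refine lam.tUp_isNumbering.blockLabels lam.a_le (fun x y => tUp_lt_of_rowLab) ?_
  intro x y hx hy h
  rw [rowLab_eq_iff, Prod.mk.injEq] at h
  rw [tUp_le_iff] at hx
  have := (tUp_le_iff y).2 (h.1 ▸ hx)
  omega

lemma blockLabels_clab : BlockLabels r (r - lam.a) lam.clab := by
  refine lam.tHatDown_isNumbering.blockLabels (Nat.sub_le _ _)
    (fun x y => tHatDown_lt_of_colLab) ?_
  intro x y hx hy h
  rw [colLab_eq_iff, Prod.mk.injEq] at h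
  rw [tHatDown_le_iff] at hx
  have := (tHatDown_le_iff y).2 (h.1 ▸ hx)
  omega

/-- The row stabilizer of `t^λ` in `W_r` contains no sign changes: it is a Young subgroup. -/
lemma stabRows_iff (w : W r) : lam.tUp.StabRows w ↔ Young lam.rlab w := by
  rw [rlab, ← lam.tUp_isNumbering.stab_iff (key := fun x => (x.1.1, x.1.2.1)) rowLab_eq_iff w,
    Prod.forall]
  simp only [Filling.StabRows, Filling.row, Prod.mk.injEq, and_assoc]

lemma stabCols_iff (w : W r) : lam.tHatDown.StabCols w ↔ Young lam.clab w := by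
  rw [clab, ← lam.tHatDown_isNumbering.stab_iff (key := fun x => (x.1.1, x.1.2.2)) colLab_eq_iff w,
    Prod.forall]
  simp only [Filling.StabCols, Filling.col, Prod.mk.injEq, and_assoc]

lemma rowStandard_iff (d : W r) : (lam.tUp.act d).RowStandard ↔ RowStd lam.rlab lam.a d := by
  have ht := lam.tUp_isNumbering
  constructor
  · intro ⟨h1, h2⟩
    refine ⟨fun p p' hp hlt hp' hlab => ?_, fun p hp hpa => ?_⟩
    · obtain ⟨x, rfl⟩ := ht.exists_eq hp (by omega)
      obtain ⟨y, rfl⟩ := ht.exists_eq (by omega) hp'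
      rw [rlab_tUp, rlab_tUp, rowLab_eq_iff, Prod.mk.injEq] at hlab
      exact h1 x y hlab.1 hlab.2 ((tUp_lt_iff_of_row hlab.1 hlab.2).1 hlt)
    · have := lam.a_le
      obtain ⟨x, rfl⟩ := ht.exists_eq hp (by omega)
      exact h2 x ((tUp_le_iff x).1 hpa)
  · intro ⟨h1, h2⟩
    refine ⟨fun x y hc hr hlt => ?_, fun x hx => ?_⟩
    · refine h1 _ _ (ht.pos x) ((tUp_lt_iff_of_row hc hr).2 hlt) (ht.le y) ?_
      rw [rlab_tUp, rlab_tUp, rowLab_eq_iff, hc, hr]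
    · exact h2 _ (ht.pos x) ((tUp_le_iff x).2 hx)

/-- The powers of the cycle `s_{1,r}` are the rotations of `[1, r]`. -/
lemma sij_pow_apply (r m : ℕ) (hm : m ≤ r) {k : ℤ} (hk : 1 ≤ k) (hk' : k ≤ r) :
    (sij r 1 r ^ m).1 k = if k + m ≤ r then k + m else k + m - r := by
  induction m with
  | zero => rw [pow_zero, W.one_apply]; split_ifs <;> push_cast <;> omega
  | succ m ih =>
    rw [pow_succ', W.mul_apply, ih (by omega), Nat.cast_add, Nat.cast_one]
    split_ifs
    all_goals
      rw [sij_one_apply (by omega) le_rfl _ (by omega)]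
      split_ifs <;> omega

lemma wa_apply {k : ℤ} (hk : 1 ≤ k) (hk' : k ≤ r) :
    (wa r lam.a).1 k = if k ≤ (r - lam.a : ℕ) then k + lam.a else k - (r - lam.a : ℕ) := by
  have := lam.a_le
  rw [wa, sij_pow_apply r lam.a lam.a_le hk hk']
  split_ifs <;> omega

lemma wa_tHatUp (x : lam.Diagram) : (wa r lam.a).1 (lam.tHatUp x) = lam.tUp x := by
  have h1 := lam.tUp_isNumbering.pos x
  have h2 := lam.tUp_isNumbering.le x
  have h3 := lam.sum_add
  have h4 := lam.snd_sum
  rcases x.cases with ⟨hx, hj⟩ | ⟨hx, hj⟩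
  · rw [tUp_zero hx] at h1 h2 ⊢
    have := rowEntry_le hj
    rw [tHatUp_zero hx, wa_apply lam (by omega) (by omega), if_neg (by omega)]
    omega
  · rw [tUp_one hx] at h1 h2 ⊢
    have := rowEntry_le hj
    have := rowEntry_pos lam.snd x.1.2.1 x.1.2.2
    rw [tHatUp_one hx, wa_apply lam (by omega) (by omega), if_pos (by omega)]
    omega

/-- The element of `W_r` representing the tableau `t̂_λ`. -/
def dHat : W r := wa r lam.a * lam.piHat

lemma piHat_spec : lam.tHatUp.act lam.piHat = lam.tHatDown := by
  obtain ⟨w, hw⟩ := lam.tUp_isNumbering.exists_perm lam.tHatDown_isNumbering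
  refine Classical.epsilon_spec (p := fun w : W r => lam.tHatUp.act w = lam.tHatDown)
    ⟨(w * wa r lam.a)⁻¹, funext fun x => ?_⟩
  rw [Filling.act, act, inv_inv, W.mul_apply, wa_tHatUp, hw]

lemma piHat_apply (x : lam.Diagram) : lam.piHat.1 (lam.tHatDown x) = lam.tHatUp x := by
  rw [← lam.piHat_spec, Filling.act, act, W.apply_inv_self]

/-- Both `t^λ` and `t̂_λ` number the nodes, and `dHat` takes the second numbering to the first. -/
lemma dHat_apply (x : lam.Diagram) : lam.dHat.1 (lam.tHatDown x) = lam.tUp x := by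
  rw [dHat, W.mul_apply, piHat_apply, wa_tHatUp]

/-- `t̂_λ` has the property `ColumnStd`. For the converse part of it, let `e` be a tableau such that
no two entries of a column of `t̂_λ` share a row of `e`. The entries of each row of `e` then lie in
distinct columns of `t̂_λ`, in increasing order, so that the `j`-th of them lies in column `j` or to
the right of it. By counting, it is in column `j`. -/
lemma columnStd_dHat : ColumnStd lam.rlab lam.clab lam.a (r - lam.a) lam.dHat := by
  have ht := lam.tUp_isNumbering
  have hd := lam.tHatDown_isNumbering
  have hsecond : ∀ p : ℤ, 1 ≤ p → p ≤ (r - lam.a : ℕ) → lam.a < lam.dHat.1 p := by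
    intro p hp hp'
    obtain ⟨x, rfl⟩ := hd.exists_eq hp (by omega)
    rw [dHat_apply]
    rw [tHatDown_le_iff] at hp'
    have := (tUp_le_iff x).not.2 (by rw [hp']; exact one_ne_zero)
    omega
  refine ⟨fun p hp hp' => ?_, hsecond, fun p p' hp hlt hp' hlab => ?_, fun v hv => ?_,
    fun e he hcol => ?_⟩
  · obtain ⟨x, rfl⟩ := hd.exists_eq hp hp'
    rw [dHat_apply]
    have := ht.pos x
    omega
  · obtain ⟨x, rfl⟩ := hd.exists_eq hp (by omega)
    obtain ⟨y, rfl⟩ := hd.exists_eq (by omega) hp'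
    rw [clab_tHatDown, clab_tHatDown, colLab_eq_iff, Prod.mk.injEq] at hlab
    rw [tHatDown_lt_iff_of_col hlab.1 hlab.2] at hlt
    rw [dHat_apply, dHat_apply]
    refine tUp_lt_of_rowLab ?_
    unfold rowLab
    rw [hlab.1]
    split_ifs <;> omega
  · have hinv : ∀ x : lam.Diagram, ∃ y, ((lam.dHat * v)⁻¹).1 (lam.tUp x) = lam.tHatDown y ∧
        colLab y = colLab x := by
      intro x
      obtain ⟨y, hy, hl⟩ := hd.exists_of_young hv.inv x
      refine ⟨y, ?_, hl⟩
      rw [mul_inv_rev, W.mul_apply, ← dHat_apply, W.inv_apply_self, hy]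
    refine ⟨fun p p' hp hlt hp' hlab => ?_, fun p hp hpa => ?_⟩
    · obtain ⟨x, rfl⟩ := ht.exists_eq hp (by omega)
      obtain ⟨y, rfl⟩ := ht.exists_eq (by omega) hp'
      rw [rlab_tUp, rlab_tUp, rowLab_eq_iff, Prod.mk.injEq] at hlab
      rw [tUp_lt_iff_of_row hlab.1 hlab.2] at hlt
      obtain ⟨x', hx', hlx⟩ := hinv x
      obtain ⟨y', hy', hly⟩ := hinv y
      rw [hx', hy']
      refine tHatDown_lt_of_colLab ?_
      rw [hlx, hly]
      unfold colLab
      rw [hlab.1]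
      split_ifs <;> omega
    · have := lam.a_le
      obtain ⟨x, rfl⟩ := ht.exists_eq hp (by omega)
      obtain ⟨y, hy, -⟩ := hinv x
      rw [hy]
      have := hd.pos y
      omega
  · -- `f x` is the node of `t̂_λ` that contains the entry of the tableau `e` at the node `x`
    have hex : ∀ x : lam.Diagram, ∃ y, lam.tHatDown y = (e⁻¹).1 (lam.tUp x) := by
      intro x
      have h1 := he.inv_pos lam.a_add (ht.pos x) (ht.le x)
      exact hd.exists_eq (by omega) (W.map_le _ (ht.pos x) (ht.le x))
    choose f hf using hex
    have hef : ∀ x, e.1 (lam.tHatDown (f x)) = lam.tUp x := by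
      intro x; rw [hf, W.apply_inv_self]
    have hcomp : ∀ x, (f x).1.1 = x.1.1 := by
      intro x
      rcases x.cases with ⟨hx, -⟩ | ⟨hx, -⟩
      · rcases (f x).cases with ⟨hy, -⟩ | ⟨hy, -⟩
        · rw [hx, hy]
        · have h1 := he.2 _ (hd.pos (f x)) ((tHatDown_le_iff (f x)).2 hy)
          rw [hef] at h1
          have h2 := (tUp_le_iff x).2 hx
          omega
      · have h1 := (tUp_le_iff x).not.2 (by rw [hx]; exact one_ne_zero)
        obtain ⟨k, hk, hk', hek⟩ := he.exists_eq lam.a_add (not_le.1 h1) (ht.le x)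
        rw [← hef x] at hek
        rw [e.1.injective hek, tHatDown_le_iff] at hk'
        rw [hx, hk']
    have hge : ∀ (c : Fin 2) (i j : ℕ) (h : j < (lam.comp c).getD i 0),
        j ≤ (f ⟨(c, i, j), h⟩).1.2.2 := by
      intro c i j
      induction j with
      | zero => intro _; exact Nat.zero_le _
      | succ j ih =>
        intro h
        have h' : j < (lam.comp c).getD i 0 := by omega
        let x : lam.Diagram := ⟨(c, i, j), h'⟩
        let y : lam.Diagram := ⟨(c, i, j + 1), h⟩
        have hxy : lam.tUp x < lam.tUp y :=
          (tUp_lt_iff_of_row (x := x) (y := y) rfl rfl).2 (Nat.lt_succ_self j)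
        have hlab : lam.rlab (lam.tUp x) = lam.rlab (lam.tUp y) := by
          rw [rlab_tUp, rlab_tUp, rowLab_eq_iff]
        have h1 := he.1.1 _ _ (ht.pos x) hxy (ht.le y) hlab
        rw [← hf, ← hf] at h1
        have h2 : colLab (f x) ≠ colLab (f y) := by
          intro hcl
          refine hcol _ _ (hd.pos (f x)) h1 (hd.le (f y)) ?_ ?_
          · rw [clab_tHatDown, clab_tHatDown, hcl]
          · rw [hef, hef, hlab]
        have h3 : ¬ colLab (f y) < colLab (f x) := fun h3 =>
          lt_asymm h1 (tHatDown_lt_of_colLab h3)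
        have h4 : (f x).1.1 = (f y).1.1 := by rw [hcomp, hcomp]
        unfold colLab at h2 h3
        rw [h4] at h2 h3
        have h5 := ih h'
        change j + 1 ≤ (f y).1.2.2
        change j ≤ (f x).1.2.2 at h5
        split_ifs at h2 h3 <;> omega
    have hfinj : Function.Injective f := by
      intro x y h
      refine ht.injective ((e⁻¹).1.injective ?_)
      rw [← hf, ← hf, h]
    have hfbij : Function.Bijective f := Finite.injective_iff_bijective.1 hfinj
    -- Moving every node weakly to the right, the bijection `f` has to preserve the columns.
    have hcolf : ∀ x, (f x).1.2.2 = x.1.2.2 := by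
      classical
      have : Fintype lam.Diagram := Fintype.ofFinite _
      have hsum : ∑ x : lam.Diagram, x.1.2.2 = ∑ x : lam.Diagram, (f x).1.2.2 :=
        (hfbij.sum_comp (fun x : lam.Diagram => x.1.2.2)).symm
      have := (Finset.sum_eq_sum_iff_of_le fun x _ => hge x.1.1 x.1.2.1 x.1.2.2 x.2).1 hsum
      exact fun x => (this x (Finset.mem_univ x)).symm
    refine ⟨lam.dHat⁻¹ * e, ?_, by rw [mul_inv_cancel_left]⟩
    rw [← young_inv_iff]
    refine hd.young_of_exists fun x => ⟨f x, ?_, ?_⟩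
    · rw [mul_inv_rev, inv_inv, W.mul_apply, dHat_apply, hf]
    · rw [colLab_eq_iff, hcomp, hcolf]

end Bicomp

/-! ### The generators `u_a^+ x_λ` and `u_{r-a}^- ŷ_λ` -/

section Translation

variable {R : Type u} [CommRing R] {q Q : Rˣ} {n r : ℕ} (lam : Bicomp n r)

/-- Lengths add in `h_{a,r-a} T_{π̂_λ}`: `π̂_λ` permutes `[1, r-a]` and `[r-a+1, r]` separately, and
`(s_{1,r})^a` increases on both intervals. -/
lemma T_wa_mul_T_piHat : T q Q (wa r lam.a) * T q Q lam.piHat = T q Q lam.dHat := by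
  have hd := lam.tHatDown_isNumbering
  have har := lam.a_le
  set b := r - lam.a with hb
  -- The two intervals, as blocks of a labelling.
  set l : ℤ → ℤ := fun p => if p ≤ b then 0 else 1 with hl
  have hbl : BlockLabels r 0 l := by
    refine ⟨Nat.zero_le _, fun p p' _ h _ => ?_, fun p _ h1 h2 => by push_cast at h2; omega⟩
    simp only [hl]
    split_ifs <;> omega
  have hpi : Young l lam.piHat := by
    intro p hp hp'
    obtain ⟨x, rfl⟩ := hd.exists_eq hp hp'
    rw [Bicomp.piHat_apply]
    have h4 := lam.snd_sum
    have h5 := Bicomp.tHatDown_le_iff x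
    rcases x.cases with ⟨hx, hj⟩ | ⟨hx, hj⟩
    · rw [Bicomp.tHatUp_zero hx]
      rw [hx] at h5
      simp only [zero_ne_one, iff_false] at h5
      have := Bicomp.rowEntry_pos lam.fst x.1.2.1 x.1.2.2
      simp only [hl]
      rw [if_neg h5, if_neg (by omega)]
      exact ⟨by omega, rfl⟩
    · rw [Bicomp.tHatUp_one hx]
      have := Bicomp.rowEntry_le hj
      have := Bicomp.rowEntry_pos lam.snd x.1.2.1 x.1.2.2
      simp only [hl]
      rw [if_pos (h5.2 hx), if_pos (by omega)]
      exact ⟨by omega, rfl⟩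
  have hw : RowStd l 0 (wa r lam.a)⁻¹ := by
    refine ⟨fun p p' hp hlt hp' hlab => ?_, fun p hp hp' => by push_cast at hp'; omega⟩
    rw [inv_inv, lam.wa_apply hp (by omega), lam.wa_apply (by omega) hp']
    simp only [hl] at hlab
    split_ifs at hlab ⊢ <;> omega
  have h2 := T_young_mul_T (q := q) (Q := Q) hbl hpi.inv hw
  have h3 := congrArg (hstar q Q) h2
  rwa [hstar_mul, hstar_T, hstar_T, hstar_T, inv_inv, inv_inv, mul_inv_rev, inv_inv, inv_inv] at h3

lemma mElt_eq : mElt q Q lam = rowElt q Q r lam.rlab lam.a := by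
  classical
  rw [mElt, rowElt, xElt, youngSum]
  congr 1
  refine Finset.sum_congr (Finset.filter_congr fun w _ => lam.stabRows_iff w) fun w _ => ?_
  rw [one_pow, one_smul]

lemma cElt_eq : cElt q Q lam = colElt q Q r lam.clab (r - lam.a) := by
  classical
  rw [cElt, colElt, yHatElt, youngSum]
  congr 1
  refine Finset.sum_congr (Finset.filter_congr fun w _ => lam.stabCols_iff w) fun w _ => ?_
  rw [Units.val_pow_eq_pow_val]

/-- The rows of `t^ω` are single nodes, and the first component is empty. -/
lemma mElt_omega (h : r ≤ n) : mElt q Q (Bicomp.omega h) = 1 := by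
  classical
  have hone : ∀ w : W r, (Bicomp.omega h).tUp.StabRows w ↔ w = 1 := by
    intro w
    rw [Bicomp.stabRows_iff]
    constructor
    · intro hw
      have ht := (Bicomp.omega h).tUp_isNumbering
      refine W.ext_pos fun p hp hp' => ?_
      obtain ⟨x, rfl⟩ := ht.exists_eq hp hp'
      obtain ⟨y, hy, hl⟩ := ht.exists_of_young hw x
      rw [W.one_apply, hy]
      rw [Bicomp.rowLab_eq_iff, Prod.mk.injEq] at hl
      have hcol : ∀ z : (Bicomp.omega h).Diagram, z.1.2.2 = 0 := by
        intro z
        rcases z.cases with ⟨_, hj⟩ | ⟨_, hj⟩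
        · simp [Bicomp.omega] at hj
        · have hle : ∀ k ∈ (Bicomp.omega h).snd, k ≤ 1 := by
            intro k hk
            rcases List.mem_append.1 hk with hk | hk
            · rw [List.eq_of_mem_replicate hk]
            · rw [List.eq_of_mem_replicate hk]; exact Nat.zero_le _
          have hlen := Bicomp.row_lt_length hj
          rw [List.getD_eq_getElem _ _ hlen] at hj
          have := hle _ (List.getElem_mem hlen)
          omega
      rw [Bicomp.Diagram.ext hl.1 hl.2 (by rw [hcol, hcol])]
    · rintro rfl
      exact Young.one
  have hx : xElt q Q (Bicomp.omega h) = 1 := by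
    rw [xElt, Finset.filter_congr fun w _ => hone w, Finset.sum_filter]
    simp
  have ha : (Bicomp.omega h).a = 0 := by simp [Bicomp.a, Bicomp.omega]
  rw [mElt, hx, ha, uPlus_eq, uProd_zero, mul_one]

end Translation

/-! ### Cyclic modules with a contravariant form -/

section CyclicModules

variable {K : Type u} [Field K] {S : Type v} [Ring S] [Algebra K S]

/-- A symmetric bilinear form `D` on an `S`-module `V` that is contravariant for the
anti-automorphism `star`, a generator `z` of `V` with `D z z ≠ 0`, and a self-adjoint `e` in `S`
that fixes `z` and maps `V` to the line spanned by `z`. -/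
structure ContravariantForm {V : Type*} [AddCommGroup V] [Module K V] [Module S V]
    (star : S ≃ₐ[K] Sᵐᵒᵖ) (D : LinearMap.BilinForm K V) (z : V) (e : S) : Prop where
  symm : ∀ x y, D x y = D y x
  adjoint : ∀ (φ : S) x y, D (φ • x) y = D x ((star φ).unop • y)
  generates : ∀ x, ∃ φ : S, x = φ • z
  self_ne_zero : D z z ≠ 0
  selfAdjoint : ∀ x y, D (e • x) y = D x (e • y)
  fixes : e • z = z
  line : ∀ x, ∃ c : K, e • x = c • z

variable {V : Type*} [AddCommGroup V] [Module K V] [Module S V]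
  {star : S ≃ₐ[K] Sᵐᵒᵖ} {D : LinearMap.BilinForm K V} {z : V} {e : S}

/-- The radical of a contravariant form. -/
def ContravariantForm.radical (h : ContravariantForm star D z e) : Submodule S V where
  carrier := {x | ∀ w, D w x = 0}
  zero_mem' w := map_zero _
  add_mem' hx hy w := by rw [map_add, hx w, hy w, add_zero]
  smul_mem' φ x hx w := by rw [h.symm, h.adjoint, h.symm]; exact hx _

/-- `e` is the orthogonal projection to the line spanned by `z`. -/
lemma ContravariantForm.smul_eq (h : ContravariantForm star D z e) (x : V) :
    e • x = ((D z z)⁻¹ * D z x) • z := by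
  obtain ⟨c, hc⟩ := h.line x
  have h1 : D z x = c * D z z := by
    rw [← h.fixes, h.selfAdjoint, hc, map_smul, h.fixes, smul_eq_mul]
  rw [hc, h1, mul_comm c, inv_mul_cancel_left₀ h.self_ne_zero]

/-- A submodule either contains the generator or is killed by `e`, and then it is orthogonal to
the generator, and so to the whole module. -/
lemma ContravariantForm.eq_top_or_le_radical [IsScalarTower K S V]
    (h : ContravariantForm star D z e) (U : Submodule S V) : U = ⊤ ∨ U ≤ h.radical := by
  by_cases hU : ∀ u ∈ U, D z u = 0
  · refine Or.inr fun u hu w => ?_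
    obtain ⟨φ, rfl⟩ := h.generates w
    rw [h.adjoint]
    exact hU _ (U.smul_mem _ hu)
  · push Not at hU
    obtain ⟨u, hu, hne⟩ := hU
    refine Or.inl (eq_top_iff.2 fun x _ => ?_)
    obtain ⟨φ, rfl⟩ := h.generates x
    refine U.smul_mem _ ?_
    have h1 : e • u ∈ U := U.smul_mem _ hu
    rw [h.smul_eq] at h1
    have h2 := U.smul_of_tower_mem ((D z z)⁻¹ * D z u)⁻¹ h1
    rwa [inv_smul_smul₀ (mul_ne_zero (inv_ne_zero h.self_ne_zero) hne)] at h2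

/-- The radical is the unique maximal submodule. -/
lemma ContravariantForm.isCoatom_iff [IsScalarTower K S V] (h : ContravariantForm star D z e)
    (N : Submodule S V) :
    IsCoatom N ↔ N = h.radical := by
  have hne : h.radical ≠ ⊤ := by
    intro htop
    have hz : z ∈ h.radical := by rw [htop]; trivial
    exact h.self_ne_zero (hz z)
  constructor
  · intro hN
    rcases h.eq_top_or_le_radical N with h1 | h1
    · exact absurd h1 hN.1
    · by_contra hcon
      exact hne (hN.2 _ (lt_of_le_of_ne h1 hcon))
  · rintro rfl
    refine ⟨hne, fun U hU => ?_⟩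
    rcases h.eq_top_or_le_radical U with h1 | h1
    · exact h1
    · exact absurd h1 (not_le_of_gt hU)

/-- A contravariant form induces one on the quotient by its radical, and this is
nondegenerate. -/
lemma ContravariantForm.exists_quotient [IsScalarTower K S V] (h : ContravariantForm star D z e) :
    ∃ D' : LinearMap.BilinForm K (V ⧸ h.radical),
      ContravariantForm star D' (h.radical.mkQ z) e ∧ ∀ y, (∀ x, D' x y = 0) → y = 0 := by
  let π : V →ₗ[K] V ⧸ h.radical := h.radical.mkQ.restrictScalars K
  have hπ : Function.Surjective π := h.radical.mkQ_surjective
  obtain ⟨σ, hσ⟩ := π.exists_rightInverse_of_surjective (LinearMap.range_eq_top.2 hπ)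
  have hσπ : ∀ x w, D w (σ (π x)) = D w x := by
    intro x w
    have h1 : σ (π x) - x ∈ h.radical := by
      rw [← Submodule.Quotient.mk_eq_zero, Submodule.Quotient.mk_sub, sub_eq_zero]
      exact LinearMap.congr_fun hσ (π x)
    have h2 := h1 w
    rwa [map_sub, sub_eq_zero] at h2
  -- Any linear section of the projection serves, as it is well defined up to the radical.
  let D' : LinearMap.BilinForm K (V ⧸ h.radical) := D.compl₁₂ σ σ
  have hD' : ∀ x y, D' (π x) (π y) = D x y := by
    intro x y
    change D (σ (π x)) (σ (π y)) = D x y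
    rw [hσπ, h.symm, hσπ, h.symm]
  have hsmul : ∀ (φ : S) x, φ • π x = π (φ • x) := fun φ x => (map_smul h.radical.mkQ φ x).symm
  refine ⟨D', ⟨?_, ?_, ?_, ?_, ?_, ?_, ?_⟩, ?_⟩
  · exact fun x y => h.symm _ _
  · intro φ x y
    obtain ⟨x, rfl⟩ := hπ x
    obtain ⟨y, rfl⟩ := hπ y
    rw [hsmul, hsmul, hD', hD', h.adjoint]
  · intro x
    obtain ⟨x, rfl⟩ := hπ x
    obtain ⟨φ, rfl⟩ := h.generates x
    exact ⟨φ, (hsmul φ z).symm⟩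
  · exact (hD' z z).trans_ne h.self_ne_zero
  · intro x y
    obtain ⟨x, rfl⟩ := hπ x
    obtain ⟨y, rfl⟩ := hπ y
    rw [hsmul, hsmul, hD', hD', h.selfAdjoint]
  · exact (hsmul e z).trans (congrArg π h.fixes)
  · intro x
    obtain ⟨x, rfl⟩ := hπ x
    obtain ⟨c, hc⟩ := h.line x
    exact ⟨c, by rw [hsmul, hc, map_smul]; rfl⟩
  · intro y hy
    obtain ⟨y, rfl⟩ := hπ y
    refine (Submodule.Quotient.mk_eq_zero _).2 fun w => ?_
    rw [← hD']
    exact hy _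

variable [FiniteDimensional K V]

lemma ContravariantForm.exists_dual_equiv (h : ContravariantForm star D z e)
    (hD : ∀ y, (∀ x, D x y = 0) → y = 0) :
    ∃ Φ : V ≃ₗ[K] Module.Dual K V, ∀ x y, Φ x y = D x y := by
  have hinj : Function.Injective D := by
    rw [injective_iff_map_eq_zero]
    intro x hx
    refine hD x fun y => ?_
    rw [h.symm, hx, LinearMap.zero_apply]
  exact ⟨LinearEquiv.ofInjectiveOfFinrankEq D hinj (Subspace.dual_finrank_eq).symm,
    fun x y => rfl⟩

lemma ContravariantForm.isSelfDual (h : ContravariantForm star D z e)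
    (hD : ∀ y, (∀ x, D x y = 0) → y = 0) : IsSelfDual V star := by
  obtain ⟨Φ, hΦ⟩ := h.exists_dual_equiv hD
  exact ⟨Φ, fun φ x y => by rw [hΦ, hΦ, h.adjoint]⟩

/-- The base changes of the linear functionals separate the points of `K' ⊗ V`. -/
lemma eq_zero_of_baseChange_dual {K' : Type*} [Field K'] [Algebra K K'] {t : K' ⊗[K] V}
    (ht : ∀ f : Module.Dual K V, f.baseChange K' t = 0) : t = 0 := by
  let b := Module.finBasis K V
  let b' := b.baseChange K'
  rw [← b'.repr.map_eq_zero_iff]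
  ext i
  have key : ∀ t : K' ⊗[K] V, Module.Dual.baseChange K' (b.coord i) t = b'.repr t i := by
    intro t
    induction t using TensorProduct.induction_on with
    | zero => simp
    | tmul k x => simp [b', Algebra.smul_def, mul_comm]
    | add x y hx hy => rw [map_add, map_add, Finsupp.add_apply, hx, hy]
  rw [← key, ht]
  rfl

/-- A nondegenerate contravariant form forces absolute irreducibility: if `t ≠ 0` lies in a stable
subspace of `K' ⊗ V`, some functional of the form `D z (φ • ·)` does not vanish at `t`, so that
`e * φ` maps `t` to a nonzero multiple of the generator `1 ⊗ z`. -/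
lemma ContravariantForm.isAbsolutelyIrreducible [IsScalarTower K S V]
    (h : ContravariantForm star D z e) (hD : ∀ y, (∀ x, D x y = 0) → y = 0) :
    IsAbsolutelyIrreducible K S V := by
  intro K' _ _
  have hz : z ≠ 0 := by
    rintro rfl
    exact h.self_ne_zero (map_zero _)
  have : Nontrivial V := ⟨z, 0, hz⟩
  refine ⟨inferInstance, fun U hU => ?_⟩
  rw [or_iff_not_imp_left]
  intro hne
  obtain ⟨t, htU, ht⟩ := U.ne_bot_iff.1 hne
  obtain ⟨f, hf⟩ : ∃ f : Module.Dual K V, f.baseChange K' t ≠ 0 := by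
    by_contra! hcon
    exact ht (eq_zero_of_baseChange_dual hcon)
  obtain ⟨Φ, hΦ⟩ := h.exists_dual_equiv hD
  obtain ⟨x, rfl⟩ := Φ.surjective f
  obtain ⟨φ, rfl⟩ := h.generates x
  set k := (Φ (φ • z)).baseChange K' t 
  -- `e (φ* t) = (D z z)⁻¹ D z (φ* t) z`, extended to `K' ⊗ V`.
  have he : ∀ t : K' ⊗[K] V, (Algebra.lsmul K K V e).baseChange K'
      ((Algebra.lsmul K K V (star φ).unop).baseChange K' t) =
      (algebraMap K K' (D z z)⁻¹ * (Φ (φ • z)).baseChange K' t) •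
        ((1 : K') ⊗ₜ[K] z) := by
    intro t
    induction t using TensorProduct.induction_on with
    | zero => simp only [map_zero, mul_zero, zero_smul]
    | tmul k x =>
      simp only [LinearMap.baseChange_tmul, Algebra.lsmul_coe, Module.Dual.baseChange_apply_tmul]
      rw [h.smul_eq, hΦ, h.adjoint, TensorProduct.tmul_smul, TensorProduct.smul_tmul',
        TensorProduct.smul_tmul']
      congr 1
      simp only [Algebra.smul_def, Algebra.algebraMap_self, RingHom.id_apply, map_mul, mul_one]
      ring
    | add x y hx hy =>
      simp only [map_add] at hx hy ⊢
      rw [hx, hy, mul_add, add_smul]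
  have h1 : (1 : K') ⊗ₜ[K] z ∈ U := by
    have h2 := hU e _ (hU (star φ).unop t htU)
    rw [he] at h2
    have hne' : algebraMap K K' (D z z)⁻¹ * k ≠ 0 :=
      mul_ne_zero (by rw [Ne, map_eq_zero]; exact inv_ne_zero h.self_ne_zero) hf
    have h3 := U.smul_mem (algebraMap K K' (D z z)⁻¹ * k)⁻¹ h2
    rwa [inv_smul_smul₀ hne'] at h3
  refine eq_top_iff.2 fun t _ => ?_
  induction t using TensorProduct.induction_on with
  | zero => exact U.zero_mem
  | tmul k x =>
    obtain ⟨ψ, rfl⟩ := h.generates x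
    have h2 := U.smul_mem k (hU ψ _ h1)
    rwa [LinearMap.baseChange_tmul, Algebra.lsmul_coe, TensorProduct.smul_tmul', smul_eq_mul,
      mul_one] at h2
  | add x y hx hy => exact U.add_mem (hx trivial) (hy trivial)

end CyclicModules

/-! ### Tensor space and its bilinear form -/

section TensorSpace

variable {K : Type u} [Field K] {q Q : Kˣ} {n r : ℕ}

instance : Fintype (Bicomp n r) := Fintype.ofFinite _

/-- The component in `M^λ` of an element of tensor space. -/
def coord (lam : Bicomp n r) : TensorSpace q Q n r →ₗ[(Hecke q Q r)ᵐᵒᵖ] Hecke q Q r :=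
  (M q Q lam).subtype.comp (LinearMap.proj (φ := fun mu : Bicomp n r => M q Q mu) lam)

lemma tensorSpace_ext {x y : TensorSpace q Q n r} (h : ∀ lam, coord lam x = coord lam y) :
    x = y := funext fun lam => Subtype.ext (h lam)

lemma exists_coord_eq (lam : Bicomp n r) (x : TensorSpace q Q n r) :
    ∃ h, coord lam x = mElt q Q lam * h := by
  obtain ⟨h, hh⟩ := Submodule.mem_span_singleton.1 (x lam).2
  exact ⟨h.unop, hh.symm⟩

lemma coord_mem (lam : Bicomp n r) (x : TensorSpace q Q n r) :
    coord lam x ∈ spanT (rowElt q Q r lam.rlab lam.a) (RowStd lam.rlab lam.a) := by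
  obtain ⟨h, hh⟩ := exists_coord_eq lam x
  rw [hh, mElt_eq]
  exact rowElt_mul_mem lam.blockLabels_rlab h

lemma coord_op_smul (lam : Bicomp n r) (h : Hecke q Q r) (x : TensorSpace q Q n r) :
    coord lam (MulOpposite.op h • x) = coord lam x * h := map_smul _ _ _

lemma coord_smul (lam : Bicomp n r) (c : K) (x : TensorSpace q Q n r) :
    coord lam (c • x) = c • coord lam x := rfl

lemma coord_inM (lam : Bicomp n r) (h : Hecke q Q r) :
    coord lam (inM q Q lam h) = mElt q Q lam * h := by
  classical
  exact congrArg Subtype.val (Pi.single_eq_same (M := fun mu : Bicomp n r => M q Q mu) lam _)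

lemma coord_inM_of_ne {lam mu : Bicomp n r} (hne : mu ≠ lam) (h : Hecke q Q r) :
    coord mu (inM q Q lam h) = 0 := by
  classical
  exact congrArg Subtype.val (Pi.single_eq_of_ne (M := fun mu : Bicomp n r => M q Q mu) hne _)

lemma inM_mul (lam : Bicomp n r) (h g : Hecke q Q r) :
    inM q Q lam (h * g) = MulOpposite.op g • inM q Q lam h := by
  refine tensorSpace_ext fun mu => ?_
  rw [coord_op_smul]
  by_cases hmu : mu = lam
  · rw [hmu, coord_inM, coord_inM, mul_assoc]
  · rw [coord_inM_of_ne hmu, coord_inM_of_ne hmu, zero_mul]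

/-- The bitabloids span tensor space. -/
lemma span_bitabloids : Submodule.span K {x : TensorSpace q Q n r |
    ∃ (lam : Bicomp n r) (w : W r), (lam.tUp.act w).RowStandard ∧ x = inM q Q lam (T q Q w)} =
      ⊤ := by
  classical
  refine eq_top_iff.2 fun x _ => ?_
  have hM : ∀ lam : Bicomp n r, ∀ y ∈ spanT (rowElt q Q r lam.rlab lam.a) (RowStd lam.rlab lam.a),
      ∃ t ∈ Submodule.span K {x : TensorSpace q Q n r | ∃ (lam : Bicomp n r) (w : W r),
        (lam.tUp.act w).RowStandard ∧ x = inM q Q lam (T q Q w)},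
        coord lam t = y ∧ ∀ mu, mu ≠ lam → coord mu t = 0 := by
    intro lam y hy
    induction hy using Submodule.span_induction with
    | mem y hy =>
      obtain ⟨d, hd, rfl⟩ := hy
      refine ⟨_, Submodule.subset_span ⟨lam, d, (lam.rowStandard_iff d).2 hd, rfl⟩, ?_,
        fun mu hmu => coord_inM_of_ne hmu _⟩
      rw [coord_inM, mElt_eq]
    | zero => exact ⟨0, Submodule.zero_mem _, map_zero _, fun _ _ => map_zero _⟩
    | add y y' _ _ hy hy' =>
      obtain ⟨t, ht, h1, h2⟩ := hy
      obtain ⟨t', ht', h1', h2'⟩ := hy'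
      exact ⟨t + t', Submodule.add_mem _ ht ht', by rw [map_add, h1, h1'],
        fun mu hmu => by rw [map_add, h2 mu hmu, h2' mu hmu, add_zero]⟩
    | smul c y _ hy =>
      obtain ⟨t, ht, h1, h2⟩ := hy
      exact ⟨c • t, Submodule.smul_mem _ c ht, by rw [coord_smul, h1],
        fun mu hmu => by rw [coord_smul, h2 mu hmu, smul_zero]⟩
  choose t ht h1 h2 using fun lam => hM lam (coord lam x) (coord_mem lam x)
  have hx : x = ∑ lam, t lam := by
    refine tensorSpace_ext fun lam => ?_
    rw [map_sum, Finset.sum_eq_single lam, h1]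
    · exact fun mu _ hmu => h2 mu lam hmu.symm
    · exact fun h => absurd (Finset.mem_univ _) h
  rw [hx]
  exact Submodule.sum_mem _ fun lam _ => ht lam

instance : FiniteDimensional K (TensorSpace q Q n r) := by
  refine Module.finite_def.2 ?_
  rw [← span_bitabloids]
  refine Submodule.fg_span ((Set.finite_range fun p : Bicomp n r × W r =>
    inM q Q p.1 (T q Q p.2)).subset ?_)
  rintro _ ⟨lam, w, -, rfl⟩
  exact ⟨(lam, w), rfl⟩

variable (q Q n r) in
/-- The bilinear form on tensor space for which the summands `M^λ` are orthogonal and the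
bitabloids form an orthogonal basis of each of them. -/
def tensorForm : LinearMap.BilinForm K (TensorSpace q Q n r) :=
  ∑ lam : Bicomp n r, (rowForm q Q r lam.rlab lam.a).compl₁₂ ((coord lam).restrictScalars K)
    ((coord lam).restrictScalars K)

lemma tensorForm_apply (x y : TensorSpace q Q n r) : tensorForm q Q n r x y =
    ∑ lam : Bicomp n r, rowForm q Q r lam.rlab lam.a (coord lam x) (coord lam y) := by
  rw [tensorForm, LinearMap.sum_apply, LinearMap.sum_apply]
  rfl

lemma tensorForm_inM (lam : Bicomp n r) (h : Hecke q Q r) (y : TensorSpace q Q n r) :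
    tensorForm q Q n r (inM q Q lam h) y =
      rowForm q Q r lam.rlab lam.a (mElt q Q lam * h) (coord lam y) := by
  rw [tensorForm_apply, Finset.sum_eq_single lam, coord_inM]
  · intro mu _ hmu
    rw [coord_inM_of_ne hmu, map_zero, LinearMap.zero_apply]
  · exact fun h => absurd (Finset.mem_univ _) h

lemma tensorForm_symm (x y : TensorSpace q Q n r) :
    tensorForm q Q n r x y = tensorForm q Q n r y x := by
  rw [tensorForm_apply, tensorForm_apply]
  exact Finset.sum_congr rfl fun lam _ => rowForm_symm _ _

lemma tensorForm_op_smul (h : Hecke q Q r) (x y : TensorSpace q Q n r) :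
    tensorForm q Q n r (MulOpposite.op h • x) y =
      tensorForm q Q n r x (MulOpposite.op (hstar q Q h) • y) := by
  rw [tensorForm_apply, tensorForm_apply]
  refine Finset.sum_congr rfl fun lam _ => ?_
  rw [coord_op_smul, coord_op_smul]
  exact rowForm_mul lam.blockLabels_rlab h (coord_mem lam x) (coord_mem lam y)

lemma eq_zero_of_tensorForm {x : TensorSpace q Q n r} (h : ∀ y, tensorForm q Q n r y x = 0) :
    x = 0 := by
  refine tensorSpace_ext fun lam => ?_
  rw [map_zero]
  refine eq_zero_of_rowForm lam.blockLabels_rlab (coord_mem lam x) fun d _ => ?_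
  rw [rowForm_symm, ← mElt_eq, ← tensorForm_inM]
  exact h _

lemma isTensorForm_tensorForm : IsTensorForm q Q (tensorForm q Q n r) := by
  intro lam mu w v hw hv
  rw [tensorForm_inM]
  by_cases h : lam = mu
  · subst h
    rw [coord_inM, mElt_eq, rowForm_bitabloids lam.blockLabels_rlab
      ((lam.rowStandard_iff w).1 hw) ((lam.rowStandard_iff v).1 hv)]
    by_cases hwv : w = v
    · rw [if_pos hwv, if_pos ⟨rfl, hwv⟩]
    · rw [if_neg hwv, if_neg fun h => hwv h.2]
  · rw [coord_inM_of_ne h, map_zero, if_neg fun h' => h h'.1]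

lemma IsTensorForm.eq {B B' : LinearMap.BilinForm K (TensorSpace q Q n r)}
    (h : IsTensorForm q Q B) (h' : IsTensorForm q Q B') : B = B' := by
  refine LinearMap.ext_on span_bitabloids ?_
  rintro _ ⟨lam, w, hw, rfl⟩
  refine LinearMap.ext_on span_bitabloids ?_
  rintro _ ⟨mu, v, hv, rfl⟩
  rw [h lam mu w v hw hv, h' lam mu w v hw hv]

end TensorSpace

/-! ### Adjoints in the Schur algebra -/

section Adjoints

variable {K : Type u} [Field K] {q Q : Kˣ} {n r : ℕ}

lemma eq_of_tensorForm {x y : TensorSpace q Q n r}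
    (h : ∀ t, tensorForm q Q n r t x = tensorForm q Q n r t y) : x = y := by
  rw [← sub_eq_zero]
  refine eq_zero_of_tensorForm fun t => ?_
  rw [map_sub, h, sub_self]

lemma tensorForm_op_smul_right (h : Hecke q Q r) (x y : TensorSpace q Q n r) :
    tensorForm q Q n r x (MulOpposite.op h • y) =
      tensorForm q Q n r (MulOpposite.op (hstar q Q h) • x) y := by
  rw [tensorForm_symm, tensorForm_op_smul, tensorForm_symm]

/-- The linear adjoint of an element of the Schur algebra is in the Schur algebra, since the adjoint
of the action of `h` is the action of `hstar h`. -/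
lemma exists_adjoint (φ : Schur q Q n r) : ∃ ψ : Schur q Q n r, ∀ x y,
    tensorForm q Q n r (φ x) y = tensorForm q Q n r x (ψ y) := by
  have hinj : Function.Injective (tensorForm q Q n r) := by
    rw [injective_iff_map_eq_zero]
    intro x hx
    refine eq_zero_of_tensorForm fun y => ?_
    rw [tensorForm_symm, hx, LinearMap.zero_apply]
  let e : TensorSpace q Q n r ≃ₗ[K] Module.Dual K (TensorSpace q Q n r) :=
    LinearEquiv.ofInjectiveOfFinrankEq (tensorForm q Q n r) hinj (Subspace.dual_finrank_eq).symm
  have he : ∀ f x, tensorForm q Q n r x (e.symm f) = f x := by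
    intro f x
    rw [tensorForm_symm]
    exact LinearMap.congr_fun (e.apply_symm_apply f) x
  let ψ : TensorSpace q Q n r → TensorSpace q Q n r := fun y =>
    e.symm ((tensorForm q Q n r y).comp (φ.restrictScalars K))
  have hψ : ∀ x y, tensorForm q Q n r x (ψ y) = tensorForm q Q n r (φ x) y := by
    intro x y
    rw [he, tensorForm_symm]
    rfl
  refine ⟨⟨⟨ψ, fun y y' => eq_of_tensorForm fun t => ?_⟩, fun h y => eq_of_tensorForm fun t => ?_⟩,
    fun x y => (hψ x y).symm⟩
  · rw [map_add, hψ, hψ, hψ, map_add]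
  · obtain ⟨h, rfl⟩ := MulOpposite.op_surjective h
    change tensorForm q Q n r t (ψ (MulOpposite.op h • y)) =
      tensorForm q Q n r t (MulOpposite.op h • ψ y)
    rw [hψ, tensorForm_op_smul_right, tensorForm_op_smul_right, hψ, map_smul φ]

/-- The adjoint of an element of the Schur algebra with respect to the form on tensor space. -/
def adj (φ : Schur q Q n r) : Schur q Q n r := (exists_adjoint φ).choose

lemma tensorForm_adj (φ : Schur q Q n r) (x y : TensorSpace q Q n r) :
    tensorForm q Q n r (φ x) y = tensorForm q Q n r x (adj φ y) :=
  (exists_adjoint φ).choose_spec x y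

lemma adj_unique {φ ψ : Schur q Q n r}
    (h : ∀ x y, tensorForm q Q n r (φ x) y = tensorForm q Q n r x (ψ y)) : ψ = adj φ :=
  LinearMap.ext fun y => eq_of_tensorForm fun t => by rw [← h, tensorForm_adj]

lemma adj_adj (φ : Schur q Q n r) : adj (adj φ) = φ :=
  (adj_unique fun x y => by rw [tensorForm_symm, ← tensorForm_adj, tensorForm_symm]).symm

variable (q Q n r) in
/-- Taking adjoints, as an isomorphism of the Schur algebra with its opposite. -/
def adjEquiv : Schur q Q n r ≃ₐ[K] (Schur q Q n r)ᵐᵒᵖ :=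
  AlgEquiv.ofBijective
    { toFun := fun φ => MulOpposite.op (adj φ)
      map_one' := congrArg _ (adj_unique fun x y => rfl).symm
      map_zero' := congrArg MulOpposite.op (adj_unique (φ := (0 : Schur q Q n r)) (ψ := 0)
        fun x y => by
          rw [LinearMap.zero_apply, LinearMap.zero_apply, map_zero, map_zero,
            LinearMap.zero_apply]).symm
      map_mul' := fun φ ψ => by
        rw [← MulOpposite.op_mul]
        refine congrArg MulOpposite.op (adj_unique fun x y => ?_).symm
        rw [Module.End.mul_apply, Module.End.mul_apply, tensorForm_adj, tensorForm_adj]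
      map_add' := fun φ ψ => by
        rw [← MulOpposite.op_add]
        refine congrArg MulOpposite.op (adj_unique fun x y => ?_).symm
        rw [LinearMap.add_apply, LinearMap.add_apply, map_add, map_add, LinearMap.add_apply,
          tensorForm_adj, tensorForm_adj]
      commutes' := fun c => by
        refine congrArg MulOpposite.op (adj_unique fun x y => ?_).symm
        rw [Module.algebraMap_end_apply, Module.algebraMap_end_apply, map_smul, map_smul,
          LinearMap.smul_apply] }
    ⟨fun φ ψ h => by rw [← adj_adj φ, ← adj_adj ψ]; exact congrArg adj (MulOpposite.op_injective h),
      fun φ => ⟨adj φ.unop, congrArg MulOpposite.op (adj_adj φ.unop)⟩⟩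

lemma isAdjointStar_adjEquiv : IsAdjointStar (tensorForm q Q n r) (adjEquiv q Q n r) :=
  fun φ x y => tensorForm_adj φ x y

lemma IsAdjointStar.eq {star : Schur q Q n r ≃ₐ[K] (Schur q Q n r)ᵐᵒᵖ}
    (h : IsAdjointStar (tensorForm q Q n r) star) : star = adjEquiv q Q n r :=
  AlgEquiv.ext fun φ => MulOpposite.unop_injective (adj_unique fun x y => h φ x y)

end Adjoints

/-! ### The contracted form and the Weyl module -/

section WeylModules

variable {K : Type u} [Field K] {q Q : Kˣ} {n r : ℕ}

/-- The homomorphism of right modules from `H` to tensor space that takes `1` to `x`. -/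
def fromHecke (x : TensorSpace q Q n r) :
    Hecke q Q r →ₗ[(Hecke q Q r)ᵐᵒᵖ] TensorSpace q Q n r where
  toFun h := MulOpposite.op h • x
  map_add' h g := by rw [MulOpposite.op_add, add_smul]
  map_smul' g h := by
    rw [RingHom.id_apply, smul_smul]
    rfl

/-- Since `M^ω = H`, the Schur algebra moves `1 ∈ M^ω` to any element of tensor space. -/
lemma exists_smul_one_eq (hnr : r ≤ n) (x : TensorSpace q Q n r) :
    ∃ φ : Schur q Q n r, φ • inM q Q (Bicomp.omega hnr) 1 = x := by
  refine ⟨(fromHecke x).comp (coord (Bicomp.omega hnr)), ?_⟩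
  rw [Module.End.smul_def, LinearMap.comp_apply, coord_inM, mElt_omega, mul_one]
  exact one_smul _ x

lemma smul_cVec (hnr : r ≤ n) (lam : Bicomp n r) (φ : Schur q Q n r) :
    φ • cVec q Q hnr lam =
      MulOpposite.op (cElt q Q lam) • (φ • inM q Q (Bicomp.omega hnr) 1) := by
  have h := inM_mul (q := q) (Q := Q) (Bicomp.omega hnr) 1 (cElt q Q lam)
  rw [one_mul] at h
  rw [cVec, h]
  exact map_smul φ _ _

/-- `L^λ = S c_λ` consists of the elements `x c_λ` with `x` in tensor space. -/
lemma mem_LMod_iff {hnr : r ≤ n} {lam : Bicomp n r} {y : TensorSpace q Q n r} :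
    y ∈ LMod q Q hnr lam ↔ ∃ x, y = MulOpposite.op (cElt q Q lam) • x := by
  rw [Submodule.mem_span_singleton]
  constructor
  · rintro ⟨φ, rfl⟩
    exact ⟨_, smul_cVec hnr lam φ⟩
  · rintro ⟨x, rfl⟩
    obtain ⟨φ, rfl⟩ := exists_smul_one_eq hnr x
    exact ⟨φ, smul_cVec hnr lam φ⟩

lemma hstar_cElt (lam : Bicomp n r) : hstar q Q (cElt q Q lam) = cElt q Q lam := by
  rw [cElt_eq, hstar_colElt lam.blockLabels_clab]

/-- The contracted form exists: as `c_λ` is fixed by the anti-involution of the Hecke algebra,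
`⟨x, y c_λ⟩ = ⟨x c_λ, y⟩` depends only on `x c_λ` and `y c_λ`. -/
lemma exists_contractedForm (hnr : r ≤ n) (lam : Bicomp n r) :
    ∃ C : LinearMap.BilinForm K (LMod q Q hnr lam), (∀ x y, C x y = C y x) ∧
      ∀ (x y : LMod q Q hnr lam) (t : TensorSpace q Q n r),
        (x : TensorSpace q Q n r) = MulOpposite.op (cElt q Q lam) • t →
          C x y = tensorForm q Q n r t y := by
  let π : TensorSpace q Q n r →ₗ[K] LMod q Q hnr lam :=
    { toFun := fun t => ⟨MulOpposite.op (cElt q Q lam) • t, mem_LMod_iff.2 ⟨t, rfl⟩⟩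
      map_add' := fun t t' => Subtype.ext (smul_add _ _ _)
      map_smul' := fun c t => Subtype.ext (smul_comm _ _ _) }
  have hπ : Function.Surjective π := fun y => by
    obtain ⟨x, hx⟩ := mem_LMod_iff.1 y.2
    exact ⟨x, Subtype.ext hx.symm⟩
  obtain ⟨σ, hσ⟩ := π.exists_rightInverse_of_surjective (LinearMap.range_eq_top.2 hπ)
  have hσ' : ∀ y : LMod q Q hnr lam, MulOpposite.op (cElt q Q lam) • σ y = y :=
    fun y => congrArg Subtype.val (LinearMap.congr_fun hσ y)
  let ι : LMod q Q hnr lam →ₗ[K] TensorSpace q Q n r :=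
    (LMod q Q hnr lam).subtype.restrictScalars K
  let C : LinearMap.BilinForm K (LMod q Q hnr lam) := (tensorForm q Q n r).compl₁₂ σ ι
  have hC : ∀ x y, C x y = tensorForm q Q n r (σ x) y := fun x y => rfl
  have hC1 : ∀ (x y : LMod q Q hnr lam) (t : TensorSpace q Q n r),
      (y : TensorSpace q Q n r) = MulOpposite.op (cElt q Q lam) • t →
        C x y = tensorForm q Q n r x t := by
    intro x y t ht
    rw [hC, ht, tensorForm_op_smul_right, hstar_cElt, hσ']
  have hC2 : ∀ (x y : LMod q Q hnr lam) (t : TensorSpace q Q n r),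
      (x : TensorSpace q Q n r) = MulOpposite.op (cElt q Q lam) • t →
        C x y = tensorForm q Q n r t y := by
    intro x y t ht
    obtain ⟨t', ht'⟩ := mem_LMod_iff.1 y.2
    rw [hC1 x y t' ht', ht, ht', tensorForm_op_smul, hstar_cElt]
  refine ⟨C, fun x y => ?_, hC2⟩
  rw [hC1 x y (σ y) (hσ' y).symm, hC y x, tensorForm_symm]

lemma zElt_eq (lam : Bicomp n r) : zElt q Q lam =
    MulOpposite.op (cElt q Q lam) • inM q Q lam (T q Q lam.dHat) := by
  rw [zElt, T_wa_mul_T_piHat, inM_mul]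

/-- The component of `z_λ` in `M^λ` in terms of the row and column elements. -/
lemma coord_zElt (lam : Bicomp n r) : coord lam (zElt q Q lam) =
    rowElt q Q r lam.rlab lam.a * T q Q lam.dHat * colElt q Q r lam.clab (r - lam.a) := by
  rw [zElt_eq, coord_op_smul, coord_inM, mElt_eq, cElt_eq]

lemma weyl_le_LMod (hnr : r ≤ n) (lam : Bicomp n r) : Weyl q Q lam ≤ LMod q Q hnr lam := by
  rw [Submodule.span_singleton_le_iff_mem, mem_LMod_iff]
  exact ⟨_, zElt_eq lam⟩

/-- This is the value `≪z_λ, z_λ≫`. -/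
lemma tensorForm_zElt_ne_zero (lam : Bicomp n r) :
    tensorForm q Q n r (inM q Q lam (T q Q lam.dHat)) (zElt q Q lam) ≠ 0 := by
  rw [tensorForm_inM, coord_zElt, mElt_eq,
    lam.columnStd_dHat.rowForm_self lam.blockLabels_rlab lam.blockLabels_clab]
  refine mul_ne_zero (Finset.prod_ne_zero_iff.2 fun i _ => ?_) (isUnit_qlen _).ne_zero
  exact mul_ne_zero Q.ne_zero (pow_ne_zero _ q.ne_zero)

open Classical in
/-- The projection of tensor space to its summand `M^λ`. -/
def projM (lam : Bicomp n r) : Schur q Q n r :=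
  (LinearMap.single (Hecke q Q r)ᵐᵒᵖ (fun mu : Bicomp n r => M q Q mu) lam).comp
    (LinearMap.proj (φ := fun mu : Bicomp n r => M q Q mu) lam)

lemma coord_projM (lam : Bicomp n r) (x : TensorSpace q Q n r) :
    coord lam (projM lam x) = coord lam x := by
  classical
  exact congrArg Subtype.val (Pi.single_eq_same (M := fun mu : Bicomp n r => M q Q mu) lam (x lam))

lemma coord_projM_of_ne {lam mu : Bicomp n r} (hne : mu ≠ lam) (x : TensorSpace q Q n r) :
    coord mu (projM lam x) = 0 := by
  classical
  exact congrArg Subtype.val (Pi.single_eq_of_ne (M := fun mu : Bicomp n r => M q Q mu) hne (x lam))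

lemma adj_projM (lam : Bicomp n r) : adj (projM (q := q) (Q := Q) lam) = projM lam := by
  refine (adj_unique fun x y => ?_).symm
  rw [tensorForm_apply, tensorForm_apply]
  refine Finset.sum_congr rfl fun mu _ => ?_
  by_cases hmu : mu = lam
  · rw [hmu, coord_projM, coord_projM]
  · rw [coord_projM_of_ne hmu, coord_projM_of_ne hmu, map_zero, map_zero, LinearMap.zero_apply]

/-- The component of `L^λ` in `M^λ` is the line spanned by `z_λ`. -/
lemma exists_projM_eq {hnr : r ≤ n} {lam : Bicomp n r} {y : TensorSpace q Q n r}
    (hy : y ∈ LMod q Q hnr lam) : ∃ c : K, projM lam y = c • zElt q Q lam := by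
  obtain ⟨x, rfl⟩ := mem_LMod_iff.1 hy
  obtain ⟨h, hh⟩ := exists_coord_eq lam x
  obtain ⟨c, hc⟩ := lam.columnStd_dHat.exists_rowElt_mul_eq lam.a_add (q := q) (Q := Q)
    lam.blockLabels_rlab lam.blockLabels_clab h
  refine ⟨c, tensorSpace_ext fun mu => ?_⟩
  rw [coord_smul]
  by_cases hmu : mu = lam
  · rw [hmu, coord_projM, coord_op_smul, hh, coord_zElt, mElt_eq, cElt_eq, hc]
  · rw [coord_projM_of_ne hmu, zElt, coord_inM_of_ne hmu, smul_zero]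

lemma projM_zElt (lam : Bicomp n r) : projM lam (zElt q Q lam) = zElt q Q lam := by
  refine tensorSpace_ext fun mu => ?_
  by_cases hmu : mu = lam
  · rw [hmu, coord_projM]
  · rw [coord_projM_of_ne hmu, zElt, coord_inM_of_ne hmu]

instance (lam : Bicomp n r) : FiniteDimensional K (Weyl q Q lam) :=
  Module.Finite.of_injective ((Weyl q Q lam).subtype.restrictScalars K) Subtype.val_injective

/-- The contracted form restricted to the Weyl module is contravariant; the idempotent of the Schur
algebra that projects to `M^λ` fixes `z_λ` and maps `W^λ` to its multiples. -/
lemma contravariantForm_weyl {hnr : r ≤ n} {lam : Bicomp n r}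
    {C : LinearMap.BilinForm K (LMod q Q hnr lam)} (hsymm : ∀ x y, C x y = C y x)
    (hC : ∀ (x y : LMod q Q hnr lam) (t : TensorSpace q Q n r),
      (x : TensorSpace q Q n r) = MulOpposite.op (cElt q Q lam) • t →
        C x y = tensorForm q Q n r t y) :
    ContravariantForm (V := Weyl q Q lam) (adjEquiv q Q n r)
      (C.compl₁₂ ((Submodule.inclusion (weyl_le_LMod hnr lam)).restrictScalars K)
        ((Submodule.inclusion (weyl_le_LMod hnr lam)).restrictScalars K))
      ⟨zElt q Q lam, Submodule.mem_span_singleton_self _⟩ (projM lam) := by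
  have hadj : ∀ (φ : Schur q Q n r) (x y : LMod q Q hnr lam),
      C (φ • x) y = C x (adj φ • y) := by
    intro φ x y
    obtain ⟨t, ht⟩ := mem_LMod_iff.1 x.2
    rw [hC (φ • x) y (φ • t), hC x _ t ht]
    · exact tensorForm_adj φ t y
    · rw [Submodule.coe_smul, ht]
      exact map_smul φ _ _
  refine ⟨fun x y => hsymm _ _, fun φ x y => hadj φ (Submodule.inclusion (weyl_le_LMod hnr lam) x)
    (Submodule.inclusion (weyl_le_LMod hnr lam) y), fun x => ?_, ?_, fun x y => ?_, ?_,
    fun x => ?_⟩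
  · obtain ⟨φ, hφ⟩ := Submodule.mem_span_singleton.1 x.2
    exact ⟨φ, Subtype.ext hφ.symm⟩
  · exact (hC _ _ _ (zElt_eq lam)).trans_ne (tensorForm_zElt_ne_zero lam)
  · have h := hadj (projM lam) (Submodule.inclusion (weyl_le_LMod hnr lam) x)
      (Submodule.inclusion (weyl_le_LMod hnr lam) y)
    rw [adj_projM] at h
    exact h
  · exact Subtype.ext (projM_zElt lam)
  · obtain ⟨c, hc⟩ := exists_projM_eq (weyl_le_LMod hnr lam x.2)
    exact ⟨c, Subtype.ext hc⟩

end WeylModules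

end QqSchur

end

theorem mainTheorem4 {K : Type*} [Field K] (q Q : Kˣ) (n r : ℕ) (hnr : r ≤ n)
    (lam : QqSchur.Bicomp n r) :
    ∃ B : LinearMap.BilinForm K (QqSchur.TensorSpace q Q n r),
      (QqSchur.IsTensorForm q Q B ∧ ∀ B', QqSchur.IsTensorForm q Q B' → B' = B) ∧
    ∃ star : QqSchur.Schur q Q n r ≃ₐ[K] (QqSchur.Schur q Q n r)ᵐᵒᵖ,
      (QqSchur.IsAdjointStar B star ∧ ∀ star', QqSchur.IsAdjointStar B star' → star' = star) ∧
    ∃ C : LinearMap.BilinForm K (QqSchur.LMod q Q hnr lam),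
      (QqSchur.IsContractedForm hnr lam B C ∧
        ∀ C', QqSchur.IsContractedForm hnr lam B C' → C' = C) ∧
      QqSchur.Weyl q Q lam ≤ QqSchur.LMod q Q hnr lam ∧
      (∀ z : QqSchur.LMod q Q hnr lam,
        (z : QqSchur.TensorSpace q Q n r) = QqSchur.zElt q Q lam → C z z ≠ 0) ∧
    ∃ N : Submodule (QqSchur.Schur q Q n r) (QqSchur.Weyl q Q lam),
      (∀ x : QqSchur.Weyl q Q lam,
        x ∈ N ↔ (x : QqSchur.TensorSpace q Q n r) ∈ QqSchur.weylPerp hnr lam C) ∧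
      (∀ N' : Submodule (QqSchur.Schur q Q n r) (QqSchur.Weyl q Q lam),
        IsCoatom N' ↔ N' = N) ∧
      QqSchur.IsAbsolutelyIrreducible K (QqSchur.Schur q Q n r) (QqSchur.Weyl q Q lam ⧸ N) ∧
      QqSchur.IsSelfDual (QqSchur.Weyl q Q lam ⧸ N) star := by
  refine ⟨QqSchur.tensorForm q Q n r, ⟨QqSchur.isTensorForm_tensorForm, fun B' hB' =>
    hB'.eq QqSchur.isTensorForm_tensorForm⟩, QqSchur.adjEquiv q Q n r,
    ⟨QqSchur.isAdjointStar_adjEquiv, fun star' h => h.eq⟩, ?_⟩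
  obtain ⟨C, hsymm, hC⟩ := QqSchur.exists_contractedForm (q := q) (Q := Q) hnr lam
  have hcontr : QqSchur.IsContractedForm hnr lam (QqSchur.tensorForm q Q n r) C := by
    intro φ ψ x y hx hy
    rw [hC x y _ (hx.trans (QqSchur.smul_cVec hnr lam φ)), hy]
  have hW := QqSchur.contravariantForm_weyl hsymm hC
  obtain ⟨D, hD, hnondeg⟩ := hW.exists_quotient
  refine ⟨C, ⟨hcontr, fun C' hC' => ?_⟩, QqSchur.weyl_le_LMod hnr lam, fun z hz => ?_,
    hW.radical, fun x => ?_, hW.isCoatom_iff, hD.isAbsolutelyIrreducible hnondeg,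
    hD.isSelfDual hnondeg⟩
  · refine LinearMap.ext₂ fun x y => ?_
    obtain ⟨φ, hφ⟩ := Submodule.mem_span_singleton.1 x.2
    obtain ⟨ψ, hψ⟩ := Submodule.mem_span_singleton.1 y.2
    rw [hC' φ ψ x y hφ.symm hψ.symm, hcontr φ ψ x y hφ.symm hψ.symm]
  · rw [hC z z _ (hz.trans (QqSchur.zElt_eq lam)), hz]
    exact QqSchur.tensorForm_zElt_ne_zero lam
  · constructor
    · intro hx
      exact ⟨Submodule.inclusion (QqSchur.weyl_le_LMod hnr lam) x, rfl,
        fun w hw => hx ⟨w, hw⟩⟩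
    · rintro ⟨y, hy, h⟩ w
      have hyx : y = Submodule.inclusion (QqSchur.weyl_le_LMod hnr lam) x := Subtype.ext hy
      rw [hyx] at h
      exact h (Submodule.inclusion (QqSchur.weyl_le_LMod hnr lam) w) w.2
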